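/- **Conventions.** Let $\Bbbk$ be a field of characteristic $0$. Vector spaces are $\mathbb Z$-graded; a *pointed* graded vector space $V$ has a distinguished element $1_V$ of degree $0$. $P(n)$ is the set of partitions $\pi=B_1\sqcup\dots\sqcup B_{|\pi|}$ of $\{1,\dots,n\}$ (elements of blocks in increasing order, blocks ordered by their maxima), $x_B=x_{j_1}\otimes\dots\otimes x_{j_r}$ for $B=\{j_1<\dots<j_r\}$, and $\theta(x_B)=\theta_r(x_{j_1},\dots,x_{j_r})$ for a family $\underline\theta$. $\epsilon(\pi)$ is the Koszul sign of $x_1\otimes\dots\otimes x_n\mapsto \epsilon(\pi)\,x_{B_1}\otimes\dots\otimes x_{B_{|\pi|}}$ and $\epsilon(\pi,i)=\epsilon(\pi)(-1)^{|x_{B_1}|+\dots+|x_{B_{i-1}}|}$. All families $\underline f=f_1,f_2,\dots$ consist of linear maps $f_n:S^nV\to W$, i.e. graded symmetric multilinear maps. We write $$(f\bullet g)_n=\sum_{\pi\in P(n)}\epsilon(\pi)f_{|\pi|}\big(g(x_{B_1}),\dots,g(x_{B_{|\pi|}})\big),\qquad (f\star h)_n=\sum_{\substack{\pi\in P(n)\\|B_i|=n-|\pi|+1}}\epsilon(\pi,i)f_{|\pi|}\big(x_{B_1},\dots,h(x_{B_i}),\dots,x_{B_{|\pi|}}\big).$$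 **Unital $sL_\infty$-algebras.** A unital $sL_\infty$-algebra $(V,1_V,\underline\ell)$ is a pointed graded vector space with $\ell_n:S^nV\to V$ of degree $1$, $\underline\ell\star\underline\ell=0$ and $\ell_{n}(x_1,\dots,x_{n-1},1_V)=0$ for $n\ge1$. A morphism $\underline\phi:(V,1_V,\underline\ell)\to(V',1_{V'},\underline\ell')$ is a family of degree $0$ with $\underline\ell'\bullet\underline\phi=\underline\phi\star\underline\ell$, $\phi_1(1_V)=1_{V'}$ and $\phi_n(x_1,\dots,x_{n-1},1_V)=0$ for $n\ge2$; it is a quasi-isomorphism if $\phi_1$ is one for the differentials $\ell_1,\ell'_1$. Composition is $\bullet$. Two morphisms $\underline\phi,\underline{\tilde\phi}$ are homotopic if there are families $\underline\Phi(\tau)$ of degree $0$ and $\underline\eta(\tau)$ of degree $-1$, depending polynomially on $\tau$, with $\eta_n(x_1,\dots,x_{n-1},1_V)=0$ for $n\geq 1$, $\underline\Phi(0)=\underline\phi$, $\underline\Phi(1)=\underline{\tilde\phi}$ and $$\frac{d}{d\tau}\Phi_n=\sum_{\pi\in P(n)}\sum_{i}\epsilon(\pi,i)\,\ell'_{|\pi|}\big(\Phi(x_{B_1}),\dots,\Phi(x_{B_{i-1}}),\eta(x_{B_i}),\Phi(x_{B_{i+1}}),\dots,\Phi(x_{B_{|\pi|}})\big)+(\eta\star\ell)_n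 .$$ Homotopy types, the classes for the equivalence relation generated by this relation, are the morphisms of the homotopy category $\mathrm{hoUsL}_\infty$. **Homotopy probability algebras.** A homotopy probability algebra $\mathcal C_C=(\mathcal C,1_{\mathcal C},\underline M,K)$ consists of a pointed graded vector space, a family $M_n:S^n\mathcal C\to\mathcal C$ of degree $0$ with $M_1=\mathrm{id}$ and $M_{n+1}(x_1,\dots,x_n,1_{\mathcal C})=M_n(x_1,\dots,x_n)$ for $n\ge1$ (so that $(\mathcal C,\underline M)$ is a *correlation algebra*), and a differential $K$ of degree $1$, $K^2=0$, with $K1_{\mathcal C}=0$ and $1_{\mathcal C}\notin\operatorname{im}K$. Morphisms are degree $0$ cochain maps preserving the units; $f,\tilde f$ are homotopic if $f-\tilde f=sK+K's$ for some $s$ of degree $-1$ with $s(1)=0$. Homotopy types $[f]$ are the morphisms of $\mathrm{hoPAlg}_C$. The field $\Bbbk$ is a homotopy probability algebra with $M_n(x_1,\dots,x_n)=x_1\cdots x_n$ and zero differential. A *homotopy probability space* is an object $\mathcal C_C$ with a morphism $[\mathfrak c]:\mathcal C_C\to\Bbbk$ of $\mathrm{hoPAlg}_C$. **Descendants.** The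 descendant of $\mathcal C_C$ is $\mathcal C_{L_\infty}=(\mathcal C,1_{\mathcal C},\underline\ell^K)$, where $\underline\ell^K$ is determined recursively by $KM_n=(M\star\ell^K)_n$. The descendant $\underline\phi^{f,\underline\Lambda}$ of a morphism $f:\mathcal C_C\to\mathcal C'_C$ up to a homotopy $\underline\Lambda$ (a family of degree $-1$ with $\Lambda_1(1)=0$ and $\Lambda_{n+1}(x_1,\dots,x_n,1)=\Lambda_n(x_1,\dots,x_n)$ for $n\ge1$) is determined recursively by $$f\circ M_n=(M'\bullet\phi^{f,\Lambda})_n+K'\Lambda_n+(\Lambda\star\ell^K)_n .$$ The homotopy descendant functor $\mathrm{hoDes}$ sends $\mathcal C_C$ to $\mathcal C_{L_\infty}$ and $[f]$ to the homotopy type of $\underline\phi^{f,\underline\Lambda}$, for any representative $f$ and any $\underline\Lambda$. **Complete spaces.** Let $(\mathcal C_C,[\mathfrak c])$ be a homotopy probability space. A complete space $\bm{\mathcal S}$ of homotopical random variables is a unital $sL_\infty$-algebra $\mathcal S_{L_\infty}=(\mathcal S,1_{\mathcal S},\underline0)$ with zero structure together with the homotopy type $[\bm{\mathcal S}]$ of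 a unital $sL_\infty$-quasi-isomorphism $\mathcal S_{L_\infty}\to\mathcal C_{L_\infty}$. For a representative $\underline\varphi$ of $[\bm{\mathcal S}]$ let $\Pi^{\underline\varphi}_n=(M\bullet\varphi)_n$, let $f=\varphi_1$, let $h:\mathcal C\to\mathcal S$ be a homotopy inverse of $f$ ($h$ of degree $0$, $hK=0$, $hf=\mathrm{id}$, $fh=\mathrm{id}+K\beta+\beta K$ for some $\beta$ of degree $-1$), and put $$M^{\bm{\mathcal S}}_n=h\circ\Pi^{\underline\varphi}_n,\qquad \mathcal S_C=(\mathcal S,1_{\mathcal S},\underline M^{\bm{\mathcal S}},0),\qquad \iota^{\bm{\mathcal S}}=\mathfrak c\circ f,\qquad \underline\kappa^{\bm{\mathcal S}}=\underline\phi^{\mathfrak c,\underline\Lambda}\bullet\underline\varphi .$$ **Theorem.** Such $h$ exist, and $\underline M^{\bm{\mathcal S}}$, $[f]$, $\iota^{\bm{\mathcal S}}$ and $\underline\kappa^{\bm{\mathcal S}}$ do not depend on the choices of $\underline\varphi$, $h$, $\mathfrak c$ and $\underline\Lambda$. $\mathcal S_C$ is a homotopy probability algebra with zero differential, $f:\mathcal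 S_C\to\mathcal C_C$ and $\iota^{\bm{\mathcal S}}:\mathcal S_C\to\Bbbk$ are morphisms of homotopy probability algebras, $\mathcal C_{L_\infty}$ is a unital $sL_\infty$-algebra, the descendant of $\Bbbk$ is $(\Bbbk,1,\underline 0)$, and $\underline\kappa^{\bm{\mathcal S}}:\mathcal S_{L_\infty}\to(\Bbbk,1,\underline0)$ is a unital $sL_\infty$-morphism. Moreover, $$\mathrm{hoDes}(\mathcal S_C)=\mathcal S_{L_\infty},\qquad \mathrm{hoDes}([\iota^{\bm{\mathcal S}}])=[\underline\kappa^{\bm{\mathcal S}}],\qquad \mathrm{hoDes}([f])=[\bm{\mathcal S}],$$ where the descendants of all representatives of $[\iota^{\bm{\mathcal S}}]$, $[f]$ and $[\mathfrak c]$, up to all homotopies $\underline\Lambda$, are unital $sL_\infty$-morphisms. The inner triangle commutes in $\mathrm{hoPAlg}_C$, $[\iota^{\bm{\mathcal S}}]=[\mathfrak c]\circ[f]$, and the outer triangle commutes in $\mathrm{hoUsL}_\infty$, $[\underline\kappa^{\bm{\mathcal S}}]=\mathrm{hoDes}([\mathfrak c])\bullet[\bm{\mathcal S}]$. -/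

import Mathlib

universe u v w w'

noncomputable section

/-! ### Pointed graded vector spaces and families of multilinear maps -/

/-- A pointed graded vector space over `k`: a vector space which is the internal direct sum of its
homogeneous components `gr j`, `j : ℤ`, with a distinguished element `one` (the unit) of degree
zero. -/
structure PtGr (k : Type u) [Field k] where
  carrier : Type v
  [instAddCommGroup : AddCommGroup carrier]
  [instModule : Module k carrier]
  gr : ℤ → Submodule k carrier
  internal : DirectSum.IsInternal gr
  one : carrier
  one_mem : one ∈ gr 0

attribute [instance] PtGr.instAddCommGroup PtGr.instModule

instance PtGr.instCoeSort (k : Type u) [Field k] : CoeSort (PtGr.{u, v} k) (Type v) :=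
  ⟨PtGr.carrier⟩

/-- A family of `n`-ary multilinear maps `V × ⋯ × V → W`. Only the members with `n ≥ 1` carry
information; the member `n = 0` is required to vanish wherever families occur as data. -/
abbrev Fam (k : Type u) [Field k] (V : Type v) (W : Type w) [AddCommGroup V] [Module k V]
    [AddCommGroup W] [Module k W] : Type _ :=
  ∀ n : ℕ, MultilinearMap k (fun _ : Fin n => V) W

/-- A linear map is homogeneous of degree `p`. -/
def HasDeg {k : Type u} [Field k] (V : PtGr.{u, v} k) (W : PtGr.{u, w} k) (p : ℤ)
    (f : V →ₗ[k] W) : Prop :=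
  ∀ (j : ℤ) (x : V), x ∈ V.gr j → f x ∈ W.gr (j + p)

/-- The Koszul sign `ε(σ)` in
`x_1 ⊗ ⋯ ⊗ x_n ↦ ε(σ) x_{σ(1)} ⊗ ⋯ ⊗ x_{σ(n)}`, where `p i` is the parity of `x_i`:
one factor `(-1)^{|x||y|}` for each pair that is put out of order. -/
def permSign {n : ℕ} (σ : Equiv.Perm (Fin n)) (p : Fin n → ZMod 2) : ℤˣ :=
  ∏ i : Fin n, ∏ j : Fin n,
    if i < j ∧ σ j < σ i then (-1 : ℤˣ) ^ (p (σ i) * p (σ j)) else 1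

/-- The family `f` consists of linear maps `f n : S^n V → W` of degree `p`. -/
def IsSymFam {k : Type u} [Field k] (V : PtGr.{u, v} k) (W : PtGr.{u, w} k) (p : ℤ)
    (f : Fam k V W) : Prop :=
  f 0 = 0 ∧
  ∀ (n : ℕ) (d : Fin n → ℤ) (x : Fin n → V), (∀ i, x i ∈ V.gr (d i)) →
    f n x ∈ W.gr ((∑ i, d i) + p) ∧
    ∀ σ : Equiv.Perm (Fin n),
      f n x = permSign σ (fun i => (d i : ZMod 2)) • f n (fun i => x (σ i))

/-- The projection of a graded vector space onto its part of parity `e`, that is, onto the sum of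
the `gr j` with `j ≡ e` modulo `2`. -/
def PtGr.parityProj {k : Type u} [Field k] (V : PtGr.{u, v} k) (e : ZMod 2) : V →ₗ[k] V :=
  letI := V.internal.chooseDecomposition
  (DirectSum.toModule k ℤ V
      (fun j => if (j : ZMod 2) = e then (V.gr j).subtype else 0)) ∘ₗ
    (DirectSum.decomposeLinearEquiv V.gr).toLinearMap

/-- The multilinear extension of the expression
`(x_1, …, x_n) ↦ s(|x_1|, …, |x_n|) • L(x_1, …, x_n)` for homogeneous `x_i`, where the sign `s`
depends only on the parities of the arguments. -/
def PtGr.signed {k : Type u} [Field k] (V : PtGr.{u, v} k) {W : Type w} [AddCommGroup W]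
    [Module k W] {n : ℕ} (s : (Fin n → ZMod 2) → ℤˣ)
    (L : MultilinearMap k (fun _ : Fin n => V.carrier) W) :
    MultilinearMap k (fun _ : Fin n => V.carrier) W :=
  ∑ p : Fin n → ZMod 2, (s p : ℤ) • L.compLinearMap (fun i => V.parityProj (p i))

theorem PtGr.parityProj_apply {k : Type u} [Field k] (V : PtGr.{u, v} k) (e : ZMod 2) (j : ℤ)
    (x : V) (hx : x ∈ V.gr j) : V.parityProj e x = if (j : ZMod 2) = e then x else 0 := by
  let _ := V.internal.chooseDecomposition
  have h : DirectSum.decompose V.gr x = DirectSum.of (fun i => V.gr i) j ⟨x, hx⟩ :=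
    DirectSum.decompose_of_mem V.gr hx
  unfold PtGr.parityProj
  simp only [LinearMap.comp_apply, LinearEquiv.coe_coe, DirectSum.decomposeLinearEquiv_apply]
  erw [h]
  erw [DirectSum.toModule_lof]
  split_ifs <;> simp

theorem PtGr.signed_apply {k : Type u} [Field k] (V : PtGr.{u, v} k) {W : Type w}
    [AddCommGroup W] [Module k W] {n : ℕ} (s : (Fin n → ZMod 2) → ℤˣ)
    (L : MultilinearMap k (fun _ : Fin n => V.carrier) W) (d : Fin n → ℤ) (x : Fin n → V)
    (hx : ∀ i, x i ∈ V.gr (d i)) :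
    V.signed s L x = (s (fun i => (d i : ZMod 2)) : ℤ) • L x := by
  unfold PtGr.signed
  simp only [sum_apply, smul_apply, MultilinearMap.compLinearMap_apply]
  rw [Finset.sum_eq_single (fun i => (d i : ZMod 2))]
  · congr 2
    funext i
    rw [V.parityProj_apply _ _ _ (hx i), if_pos rfl]
  · intro p _ hp
    obtain ⟨i, hi⟩ := Function.ne_iff.mp hp
    rw [L.map_coord_zero i, smul_zero]
    rw [V.parityProj_apply _ _ _ (hx i), if_neg (Ne.symm hi)]
  · simp

/-! ### Sums over partitions

`OrderedFinpartition n` is the type of partitions `π = B_1 ⊔ ⋯ ⊔ B_{|π|}` of `n` letters in their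
strictly ordered representation: each block is enumerated increasingly by `π.emb i`, and the blocks
are ordered by their maximal elements. -/

/-- The Koszul sign `ε(π)` of
`x_1 ⊗ ⋯ ⊗ x_n ↦ ε(π) x_{B_1} ⊗ ⋯ ⊗ x_{B_{|π|}}`; `p i` is the parity of `x_i`. -/
def partSign {n : ℕ} (π : OrderedFinpartition n) (p : Fin n → ZMod 2) : ℤˣ :=
  ∏ a : Fin n, ∏ b : Fin n,
    if a < b ∧ π.index b < π.index a then (-1 : ℤˣ) ^ (p a * p b) else 1

/-- The sign `ε(π,i) = ε(π) (-1)^{|x_{B_1}| + ⋯ + |x_{B_{i-1}}|}`. -/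
def partSignAt {n : ℕ} (π : OrderedFinpartition n) (i : Fin π.length)
    (p : Fin n → ZMod 2) : ℤˣ :=
  partSign π p * ∏ a : Fin n, if π.index a < i then (-1 : ℤˣ) ^ (p a) else 1

section Partitions

variable {k : Type u} [Field k] {U V W : Type*} [AddCommGroup U] [Module k U]
  [AddCommGroup V] [Module k V] [AddCommGroup W] [Module k W]

/-- The multilinear map `x ↦ f(g_1(x_{B_1}), …, g_r(x_{B_r}))`, without sign. -/
def blockComp {n : ℕ} (π : OrderedFinpartition n)
    (f : MultilinearMap k (fun _ : Fin π.length => W) U)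
    (g : ∀ i : Fin π.length, MultilinearMap k (fun _ : Fin (π.partSize i) => V) W) :
    MultilinearMap k (fun _ : Fin n => V) U :=
  (f.compMultilinearMap g).domDomCongr π.equivSigma

theorem blockComp_apply {n : ℕ} (π : OrderedFinpartition n)
    (f : MultilinearMap k (fun _ : Fin π.length => W) U)
    (g : ∀ i : Fin π.length, MultilinearMap k (fun _ : Fin (π.partSize i) => V) W)
    (x : Fin n → V) :
    blockComp π f g x = f (fun i => g i (fun a => x (π.emb i a))) := rfl

end Partitions

/-- The family `(id, 0, 0, …)`. -/
def Fam.id (k : Type u) [Field k] (V : Type v) [AddCommGroup V] [Module k V] : Fam k V V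
  | 1 => MultilinearMap.ofSubsingleton k V V (0 : Fin 1) LinearMap.id
  | _ => 0

/-- The family `f • g`:
`(f • g)_n(x_1, …, x_n) = ∑_{π ∈ P(n)} ε(π) f_{|π|}(g(x_{B_1}), …, g(x_{B_{|π|}}))`. -/
def Fam.bullet {k : Type u} [Field k] {V : PtGr.{u, v} k} {W : Type w} {U : Type w'}
    [AddCommGroup W] [Module k W] [AddCommGroup U] [Module k U]
    (f : Fam k W U) (g : Fam k V W) : Fam k V U := fun n =>
  ∑ π : OrderedFinpartition n,
    V.signed (partSign π) (blockComp π (f π.length) (fun i => g (π.partSize i)))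

/-- The family
`∑_{π ∈ P(n)} ∑_i ε(π,i) f_{|π|}(g(x_{B_1}), …, g(x_{B_{i-1}}), h(x_{B_i}), g(x_{B_{i+1}}), …)`,
for `g` of degree zero and `h` of odd degree. -/
def Fam.insert {k : Type u} [Field k] {V : PtGr.{u, v} k} {W : Type w} {U : Type w'}
    [AddCommGroup W] [Module k W] [AddCommGroup U] [Module k U]
    (f : Fam k W U) (g h : Fam k V W) : Fam k V U := fun n =>
  ∑ π : OrderedFinpartition n, ∑ i : Fin π.length,
    V.signed (partSignAt π i) (blockComp π (f π.length)
      (fun j => if j = i then h (π.partSize j) else g (π.partSize j)))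

/-- The family
`∑_{π ∈ P(n), |B_i| = n - |π| + 1} ε(π,i) f_{|π|}(x_{B_1}, …, x_{B_{i-1}}, h(x_{B_i}), x_{B_{i+1}}, …)`
for `h` of odd degree. The condition on `|B_i|` says that the blocks other than `B_i` are singletons;
the family `(id, 0, 0, …)` in these places drops all the other partitions from the sum. -/
def Fam.circ {k : Type u} [Field k] {V : PtGr.{u, v} k} {U : Type w'}
    [AddCommGroup U] [Module k U] (f : Fam k V U) (h : Fam k V V) : Fam k V U :=
  Fam.insert (V := V) f (Fam.id k V) h

theorem Fam.bullet_apply {k : Type u} [Field k] {V : PtGr.{u, v} k} {W : Type w} {U : Type w'}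
    [AddCommGroup W] [Module k W] [AddCommGroup U] [Module k U]
    (f : Fam k W U) (g : Fam k V W) (n : ℕ) (d : Fin n → ℤ) (x : Fin n → V)
    (hx : ∀ i, x i ∈ V.gr (d i)) :
    Fam.bullet f g n x = ∑ π : OrderedFinpartition n,
      (partSign π (fun i => (d i : ZMod 2)) : ℤ) •
        f π.length (fun i => g (π.partSize i) (fun a => x (π.emb i a))) := by
  simp only [Fam.bullet, sum_apply]
  exact Finset.sum_congr rfl fun π _ => V.signed_apply _ _ d x hx

theorem Fam.insert_apply {k : Type u} [Field k] {V : PtGr.{u, v} k} {W : Type w} {U : Type w'}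
    [AddCommGroup W] [Module k W] [AddCommGroup U] [Module k U]
    (f : Fam k W U) (g h : Fam k V W) (n : ℕ) (d : Fin n → ℤ) (x : Fin n → V)
    (hx : ∀ i, x i ∈ V.gr (d i)) :
    Fam.insert f g h n x = ∑ π : OrderedFinpartition n, ∑ i : Fin π.length,
      (partSignAt π i (fun a => (d a : ZMod 2)) : ℤ) •
        f π.length (fun j => if j = i then h (π.partSize j) (fun a => x (π.emb j a))
          else g (π.partSize j) (fun a => x (π.emb j a))) := by
  simp only [Fam.insert, sum_apply]
  refine Finset.sum_congr rfl fun π _ => Finset.sum_congr rfl fun i _ => ?_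
  rw [V.signed_apply _ _ d x hx, blockComp_apply]
  congr 2
  funext j
  split_ifs <;> rfl

/-! ### Unital sL∞-algebras and their homotopy category -/

/-- A pointed graded vector space with a family of brackets. -/
structure Brackets (k : Type u) [Field k] extends PtGr.{u, v} k where
  br : Fam k carrier carrier

/-- The conditions on `(V, 1_V, ℓ)` to be a unital sL∞-algebra. -/
def Brackets.IsUnitalSL {k : Type u} [Field k] (X : Brackets.{u, v} k) : Prop :=
  IsSymFam X.toPtGr X.toPtGr 1 X.br ∧
  Fam.circ (V := X.toPtGr) X.br X.br = 0 ∧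
  ∀ (n : ℕ) (x : Fin n → X.toPtGr),
    X.br (n + 1) (Fin.snoc (α := fun _ => X.toPtGr.carrier) x X.one) = 0

/-- The pointed graded vector space `V` with the zero sL∞-structure, `(V, 1_V, 0)`. -/
def PtGr.trivialSL {k : Type u} [Field k] (V : PtGr.{u, v} k) : Brackets.{u, v} k where
  toPtGr := V
  br := 0

/-- Unital sL∞-morphisms. -/
structure SLHom {k : Type u} [Field k] (X : Brackets.{u, v} k) (Y : Brackets.{u, w} k) where
  fam : Fam k X.toPtGr Y.toPtGr
  sym : IsSymFam X.toPtGr Y.toPtGr 0 fam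
  map_br : Fam.bullet (V := X.toPtGr) Y.br fam = Fam.circ (V := X.toPtGr) fam X.br
  map_one : fam 1 (fun _ => X.one) = Y.one
  map_unit : ∀ (n : ℕ), 1 ≤ n → ∀ x : Fin n → X.toPtGr,
    fam (n + 1) (Fin.snoc (α := fun _ => X.toPtGr.carrier) x X.one) = 0

/-- The first component `φ_1` of a morphism as a linear map. -/
def SLHom.lin {k : Type u} [Field k] {X : Brackets.{u, v} k} {Y : Brackets.{u, w} k}
    (φ : SLHom X Y) : X.toPtGr →ₗ[k] Y.toPtGr :=
  (MultilinearMap.ofSubsingleton k X.toPtGr.carrier Y.toPtGr.carrier (0 : Fin 1)).symm (φ.fam 1)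

/-- The differential `d = ℓ_1`. -/
def Brackets.d {k : Type u} [Field k] (X : Brackets.{u, v} k) : X.toPtGr →ₗ[k] X.toPtGr :=
  (MultilinearMap.ofSubsingleton k X.toPtGr.carrier X.toPtGr.carrier (0 : Fin 1)).symm (X.br 1)

/-- A unital sL∞-morphism is a quasi-isomorphism if its first component induces a bijection
(first injectivity, then surjectivity) from the cohomology of `ℓ_1` to that of `ℓ'_1`. -/
def SLHom.IsQuasiIso {k : Type u} [Field k] {X : Brackets.{u, v} k} {Y : Brackets.{u, w} k}
    (φ : SLHom X Y) : Prop :=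
  (∀ x, X.d x = 0 → (∃ y, φ.lin x = Y.d y) → ∃ z, x = X.d z) ∧
  ∀ y, Y.d y = 0 → ∃ x, X.d x = 0 ∧ ∃ z, y = φ.lin x + Y.d z

/-- A one-parameter family of families of maps with polynomial dependence on the parameter; its
`n`-th member is given by its coefficients. -/
abbrev PolyFam (k : Type u) [Field k] (V : Type v) (W : Type w) [AddCommGroup V] [Module k V]
    [AddCommGroup W] [Module k W] : Type _ :=
  ∀ n : ℕ, ℕ →₀ MultilinearMap k (fun _ : Fin n => V) W

/-- The value at the parameter `t`. -/
def PolyFam.eval {k : Type u} [Field k] {V : Type v} {W : Type w} [AddCommGroup V] [Module k V]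
    [AddCommGroup W] [Module k W] (Φ : PolyFam k V W) (t : k) : Fam k V W :=
  fun n => (Φ n).sum fun j a => t ^ j • a

/-- The value of the derivative at the parameter `t`. -/
def PolyFam.deriv {k : Type u} [Field k] {V : Type v} {W : Type w} [AddCommGroup V] [Module k V]
    [AddCommGroup W] [Module k W] (Φ : PolyFam k V W) (t : k) : Fam k V W :=
  fun n => (Φ n).sum fun j a => ((j : k) * t ^ (j - 1)) • a

/-- A (time-independent) unital sL∞-homotopy. -/
def IsUnitalHomotopy {k : Type u} [Field k] (V : PtGr.{u, v} k) (W : PtGr.{u, w} k)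
    (l : Fam k V W) : Prop :=
  IsSymFam V W (-1) l ∧
  ∀ (n : ℕ) (x : Fin n → V), l (n + 1) (Fin.snoc (α := fun _ => V.carrier) x V.one) = 0

/-- Two unital sL∞-morphisms are homotopic if a solution of the homotopy flow equations, generated
by a polynomial family `η` of unital sL∞-homotopies, connects them. The summand `|π| = 1` of the
first term on the right is `ℓ'_1 η_n`. -/
def SLHom.Homotopic {k : Type u} [Field k] {X : Brackets.{u, v} k} {Y : Brackets.{u, w} k}
    (φ ψ : SLHom X Y) : Prop :=
  ∃ (Φ η : PolyFam k X.toPtGr Y.toPtGr),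
    (∀ t : k, IsUnitalHomotopy X.toPtGr Y.toPtGr (η.eval t)) ∧
    (∀ t : k, IsSymFam X.toPtGr Y.toPtGr 0 (Φ.eval t)) ∧
    Φ.eval 0 = φ.fam ∧ Φ.eval 1 = ψ.fam ∧
    ∀ t : k, Φ.deriv t =
      Fam.insert (V := X.toPtGr) Y.br (Φ.eval t) (η.eval t) +
        Fam.circ (V := X.toPtGr) (η.eval t) X.br

/-- Homotopy types of unital sL∞-morphisms: the morphisms of the homotopy category. -/
def SLHo {k : Type u} [Field k] (X : Brackets.{u, v} k) (Y : Brackets.{u, w} k) : Type _ :=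
  Quot (SLHom.Homotopic (X := X) (Y := Y))

/-- The homotopy type of a unital sL∞-morphism. -/
def SLHom.type {k : Type u} [Field k] {X : Brackets.{u, v} k} {Y : Brackets.{u, w} k}
    (φ : SLHom X Y) : SLHo X Y :=
  Quot.mk _ φ

/-- Transport of homotopy types along equalities of source and target. -/
def SLHo.cast {k : Type u} [Field k] {X X' : Brackets.{u, v} k} {Y Y' : Brackets.{u, w} k}
    (hX : X = X') (hY : Y = Y') (T : SLHo X Y) : SLHo X' Y' :=
  hX ▸ hY ▸ T

/-- `R = T' • T` in the homotopy category: the composites `ψ • φ` of representatives of `T'` and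
`T` are morphisms of homotopy type `R`. -/
def SLHo.IsComp {k : Type u} [Field k] {X : Brackets.{u, v} k} {Y : Brackets.{u, w} k}
    {Z : Brackets.{u, w'} k} (T' : SLHo Y Z) (T : SLHo X Y) (R : SLHo X Z) : Prop :=
  ∀ (φ : SLHom X Y) (ψ : SLHom Y Z), φ.type = T → ψ.type = T' →
    ∃ χ : SLHom X Z, χ.fam = Fam.bullet (V := X.toPtGr) ψ.fam φ.fam ∧ χ.type = R

/-! ### Homotopy probability algebras and their homotopy category -/

/-- `(V, M)` is a correlation algebra. -/
def IsCorrelation {k : Type u} [Field k] (V : PtGr.{u, v} k) (M : Fam k V V) : Prop :=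
  IsSymFam V V 0 M ∧
  (∀ x : Fin 1 → V, M 1 x = x 0) ∧
  ∀ (n : ℕ), 1 ≤ n → ∀ x : Fin n → V,
    M (n + 1) (Fin.snoc (α := fun _ => V.carrier) x V.one) = M n x

/-- `(V, 1_V, K)` is a pointed cochain complex. -/
def IsPointedComplex {k : Type u} [Field k] (V : PtGr.{u, v} k) (K : V →ₗ[k] V) : Prop :=
  HasDeg V V 1 K ∧ (∀ x, K (K x) = 0) ∧ K V.one = 0 ∧ ∀ x, K x ≠ V.one

/-- Homotopy probability algebras. -/
structure PAlg (k : Type u) [Field k] extends PtGr.{u, v} k where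
  M : Fam k carrier carrier
  K : carrier →ₗ[k] carrier
  isCorrelation : IsCorrelation toPtGr M
  isPointedComplex : IsPointedComplex toPtGr K

/-- Morphisms of homotopy probability algebras: pointed cochain maps. -/
@[ext]
structure PAlgHom {k : Type u} [Field k] (A : PAlg.{u, v} k) (B : PAlg.{u, w} k) where
  lin : A.toPtGr →ₗ[k] B.toPtGr
  deg : HasDeg A.toPtGr B.toPtGr 0 lin
  comm : ∀ x, lin (A.K x) = B.K (lin x)
  map_one : lin A.one = B.one

/-- `f - g = s K + K' s` for a pointed cochain homotopy `s`. -/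
def PAlgHom.Homotopic {k : Type u} [Field k] {A : PAlg.{u, v} k} {B : PAlg.{u, w} k}
    (f g : PAlgHom A B) : Prop :=
  ∃ s : A.toPtGr →ₗ[k] B.toPtGr, HasDeg A.toPtGr B.toPtGr (-1) s ∧ s A.one = 0 ∧
    ∀ x, f.lin x - g.lin x = s (A.K x) + B.K (s x)

def PAlgHom.comp {k : Type u} [Field k] {A : PAlg.{u, v} k} {B : PAlg.{u, w} k}
    {C : PAlg.{u, w'} k} (g : PAlgHom B C) (f : PAlgHom A B) : PAlgHom A C where
  lin := g.lin ∘ₗ f.lin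
  deg j x hx := by
    have h := g.deg _ _ (f.deg j x hx)
    simpa using h
  comm x := by simp [f.comm, g.comm]
  map_one := by simp [f.map_one, g.map_one]

instance PAlgHom.setoid {k : Type u} [Field k] (A : PAlg.{u, v} k) (B : PAlg.{u, w} k) :
    Setoid (PAlgHom A B) where
  r := PAlgHom.Homotopic
  iseqv := by
    refine ⟨fun f => ⟨0, fun j x _ => by simp, by simp, fun x => by simp⟩, ?_, ?_⟩
    · rintro f g ⟨s, h1, h2, h3⟩
      refine ⟨-s, fun j x hx => by simpa using h1 j x hx, by simp [h2], fun x => ?_⟩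
      have h := h3 x
      simp only [LinearMap.neg_apply, map_neg]
      rw [← neg_sub, h]
      abel
    · rintro f g h ⟨s, h1, h2, h3⟩ ⟨t, k1, k2, k3⟩
      refine ⟨s + t, fun j x hx => ?_, by simp [h2, k2], fun x => ?_⟩
      · exact Submodule.add_mem _ (h1 j x hx) (k1 j x hx)
      · have e : f.lin x - h.lin x = (f.lin x - g.lin x) + (g.lin x - h.lin x) := by abel
        rw [e, h3, k3]
        simp only [LinearMap.add_apply, map_add]
        abel

/-- Homotopy types of morphisms of homotopy probability algebras: the morphisms of the homotopy
category. -/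
def PAlgHo {k : Type u} [Field k] (A : PAlg.{u, v} k) (B : PAlg.{u, w} k) : Type _ :=
  Quotient (PAlgHom.setoid A B)

/-- The homotopy type of a morphism. -/
def PAlgHom.type {k : Type u} [Field k] {A : PAlg.{u, v} k} {B : PAlg.{u, w} k}
    (f : PAlgHom A B) : PAlgHo A B :=
  Quotient.mk (PAlgHom.setoid A B) f

/-- Composition in the homotopy category. -/
def PAlgHo.comp {k : Type u} [Field k] {A : PAlg.{u, v} k} {B : PAlg.{u, w} k}
    {C : PAlg.{u, w'} k} (G : PAlgHo B C) (F : PAlgHo A B) : PAlgHo A C :=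
  Quotient.map₂ (sa := PAlgHom.setoid B C) (sb := PAlgHom.setoid A B) (sc := PAlgHom.setoid A C)
    PAlgHom.comp (by
      rintro g g' ⟨t, k1, k2, k3⟩ f f' ⟨s, h1, h2, h3⟩
      refine ⟨g.lin ∘ₗ s + t ∘ₗ f'.lin, fun j x hx => ?_, ?_, fun x => ?_⟩
      · refine Submodule.add_mem _ ?_ ?_
        · simpa using g.deg _ _ (h1 j x hx)
        · simpa using k1 _ _ (f'.deg j x hx)
      · simp [h2, f'.map_one, k2]
      · have e : (g.comp f).lin x - (g'.comp f').lin x =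
            g.lin (f.lin x - f'.lin x) + (g.lin (f'.lin x) - g'.lin (f'.lin x)) := by
          simp [PAlgHom.comp]
        rw [e, h3, k3]
        simp only [LinearMap.add_apply, LinearMap.comp_apply, map_add, g.comm, f'.comm]
        abel) G F

/-- The ground field as a homotopy probability algebra: it is concentrated in degree zero, its unit
is `1`, its differential is zero, and `M_n(x_1, …, x_n) = x_1 ⋯ x_n` for `n ≥ 1`. -/
def groundPtGr (k : Type u) [Field k] : PtGr.{u, u} k where
  carrier := k
  gr j := if j = 0 then ⊤ else ⊥
  internal := by
    rw [DirectSum.isInternal_submodule_iff_iSupIndep_and_iSup_eq_top]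
    constructor
    · intro i
      by_cases hi : i = 0
      · have : (⨆ (j : ℤ) (_ : j ≠ i), (if j = 0 then (⊤ : Submodule k k) else ⊥)) = ⊥ := by
          simp only [iSup_eq_bot]
          intro j hj
          rw [if_neg (by rwa [← hi])]
        simp only [this]
        exact disjoint_bot_right
      · simp only [if_neg hi]
        exact disjoint_bot_left
    · exact eq_top_iff.mpr (le_iSup_of_le (0 : ℤ) (by simp))
  one := (1 : k)
  one_mem := by simp

/-- The iterated products `x_1 ⋯ x_n`, `n ≥ 1`, of the ground field. -/
def groundProd (k : Type u) [Field k] : Fam k k k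
  | 0 => 0
  | n + 1 => MultilinearMap.mkPiAlgebra k (Fin (n + 1)) k

theorem groundProd_sym (k : Type u) [Field k] (n : ℕ) (d : Fin n → ℤ) (x : Fin n → k)
    (hx : ∀ i, x i ∈ (if d i = 0 then ⊤ else ⊥ : Submodule k k)) :
    groundProd k n x ∈ (if (∑ i, d i) + 0 = 0 then ⊤ else ⊥ : Submodule k k) ∧
    ∀ σ : Equiv.Perm (Fin n), groundProd k n x =
      permSign σ (fun i => (d i : ZMod 2)) • groundProd k n (fun i => x (σ i)) := by
  cases n with
  | zero => simp [groundProd]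
  | succ n =>
    by_cases hd : ∀ i, d i = 0
    · refine ⟨by simp [hd], fun σ => ?_⟩
      have hs : permSign σ (fun i => (d i : ZMod 2)) = 1 := by simp [permSign, hd]
      rw [hs, one_smul]
      exact (Equiv.prod_comp σ x).symm
    · push Not at hd
      obtain ⟨i, hi⟩ := hd
      have hx0 : x i = 0 := by simpa [hi] using hx i
      have h1 : groundProd k (n + 1) x = 0 := (groundProd k (n + 1)).map_coord_zero i hx0
      refine ⟨by rw [h1]; exact Submodule.zero_mem _, fun σ => ?_⟩
      have h2 : groundProd k (n + 1) (fun i => x (σ i)) = 0 :=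
        (groundProd k (n + 1)).map_coord_zero (σ.symm i) (by simpa using hx0)
      rw [h1, h2, smul_zero]

theorem groundProd_snoc (k : Type u) [Field k] (n : ℕ) (hn : 1 ≤ n) (x : Fin n → k) :
    groundProd k (n + 1) (Fin.snoc (α := fun _ => k) x 1) = groundProd k n x := by
  obtain ⟨m, rfl⟩ := Nat.exists_eq_add_of_le' hn
  change ∏ i : Fin (m + 1 + 1), Fin.snoc (α := fun _ => k) x 1 i = ∏ i : Fin (m + 1), x i
  rw [Fin.prod_univ_castSucc]
  simp

theorem groundProd_isCorrelation (k : Type u) [Field k] :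
    IsCorrelation (groundPtGr k) (groundProd k) := by
  refine ⟨⟨rfl, fun n d x hx => groundProd_sym k n d x hx⟩, fun x => ?_, groundProd_snoc k⟩
  exact Fin.prod_univ_one (M := k) x

/-- A correlation algebra, with `1 ≠ 0`, as a homotopy probability algebra with zero
differential. -/
def PAlg.ofCorrelation {k : Type u} [Field k] (V : PtGr.{u, v} k) (M : Fam k V V)
    (hM : IsCorrelation V M) (h1 : V.one ≠ 0) : PAlg.{u, v} k where
  toPtGr := V
  M := M
  K := 0
  isCorrelation := hM
  isPointedComplex := ⟨fun _ _ _ => by simp, by simp, by simp, fun _ h => h1 (by simpa using h.symm)⟩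

/-- The ground field as a homotopy probability algebra. -/
def ground (k : Type u) [Field k] : PAlg.{u, u} k :=
  PAlg.ofCorrelation (groundPtGr k) (groundProd k) (groundProd_isCorrelation k)
    (one_ne_zero (α := k))

/-! ### Descendants -/

/-- The descendant brackets `ℓ^K`, by recursion on the arity: `ℓ^K_n` is `K M_n` minus the sum of the
terms with `|π| ≠ 1` of the expression in the defining relation
`K M_n = ∑_{π, |B_i| = n - |π| + 1} ε(π,i) M_{|π|}(x_{B_1}, …, ℓ^K(x_{B_i}), …)`. Replacing
`ℓ^K_m` by `0` for `m ≥ n` removes just the term with `|π| = 1`, which is `ℓ^K_n`. -/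
def PAlg.descBr {k : Type u} [Field k] (A : PAlg.{u, v} k) :
    (n : ℕ) → MultilinearMap k (fun _ : Fin n => A.toPtGr.carrier) A.toPtGr.carrier
  | n => A.K.compMultilinearMap (A.M n) -
      Fam.circ (V := A.toPtGr) A.M (fun m => if m < n then A.descBr m else 0) n
termination_by n => n

/-- The descendant algebra `(C, ℓ^K)`. -/
def PAlg.desc {k : Type u} [Field k] (A : PAlg.{u, v} k) : Brackets.{u, v} k where
  toPtGr := A.toPtGr
  br := A.descBr

/-- The families `Λ` up to which descendants of morphisms are formed. -/
def IsDescHomotopy {k : Type u} [Field k] (V : PtGr.{u, v} k) (W : PtGr.{u, w} k)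
    (L : Fam k V W) : Prop :=
  IsSymFam V W (-1) L ∧ L 1 (fun _ => V.one) = 0 ∧
  ∀ (n : ℕ), 1 ≤ n → ∀ x : Fin n → V,
    L (n + 1) (Fin.snoc (α := fun _ => V.carrier) x V.one) = L n x

/-- The descendant `φ^{f,Λ}` of `f` up to the homotopy `Λ`, by recursion on the arity: the relation
`f M_n = ∑_π ε(π) M'_{|π|}(φ(x_{B_1}), …, φ(x_{B_{|π|}})) + K' Λ_n + ∑ ε(π,i) Λ_{|π|}(…, ℓ^K(x_{B_i}), …)`
is solved for the term with `|π| = 1` of the first sum, which is `φ_n`. -/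
def PAlgHom.desc {k : Type u} [Field k] {A : PAlg.{u, v} k} {B : PAlg.{u, w} k}
    (f : PAlgHom A B) (L : Fam k A.toPtGr B.toPtGr) :
    (n : ℕ) → MultilinearMap k (fun _ : Fin n => A.toPtGr.carrier) B.toPtGr.carrier
  | n => f.lin.compMultilinearMap (A.M n) -
      Fam.bullet (V := A.toPtGr) B.M (fun m => if m < n then f.desc L m else 0) n -
      B.K.compMultilinearMap (L n) - Fam.circ (V := A.toPtGr) L A.descBr n
termination_by n => n

/-- `T = hoDes(F)`: the homotopy descendant functor sends `A` to `A.desc`, and a homotopy type `F`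
of morphisms to the homotopy type `T` of the descendants of the representatives of `F` up to
arbitrary homotopies `Λ`; these descendants are unital sL∞-morphisms. -/
def IsHoDes {k : Type u} [Field k] {A : PAlg.{u, v} k} {B : PAlg.{u, w} k}
    (F : PAlgHo A B) (T : SLHo A.desc B.desc) : Prop :=
  ∀ f : PAlgHom A B, f.type = F → ∀ L : Fam k A.toPtGr B.toPtGr,
    IsDescHomotopy A.toPtGr B.toPtGr L →
      ∃ χ : SLHom A.desc B.desc, χ.fam = f.desc L ∧ χ.type = T

/-! ### Complete spaces of homotopical random variables -/

/-- A complete space of homotopical random variables: a unital sL∞-algebra `(S, 1_S, 0)` with zero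
structure and the homotopy type of a unital sL∞-quasi-isomorphism into the descendant of `C`. -/
structure CompleteRVSpace {k : Type u} [Field k] (C : PAlg.{u, v} k) where
  space : PtGr.{u, w} k
  type : SLHo space.trivialSL C.desc
  quasiIso : ∃ φ : SLHom space.trivialSL C.desc, φ.type = type ∧ φ.IsQuasiIso

/-- `h` is a homotopy inverse of the cochain map `f : (S, 0) → (C, K)`. -/
def IsHomotopyInverse {k : Type u} [Field k] {S : PtGr.{u, w} k} {C : PAlg.{u, v} k}
    (f : S →ₗ[k] C.toPtGr) (h : C.toPtGr →ₗ[k] S) : Prop :=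
  HasDeg C.toPtGr S 0 h ∧ (∀ x, h (C.K x) = 0) ∧ (∀ s, h (f s) = s) ∧
  ∃ b : C.toPtGr →ₗ[k] C.toPtGr, HasDeg C.toPtGr C.toPtGr (-1) b ∧
    ∀ x, f (h x) = x + C.K (b x) + b (C.K x)

/-- The correlation densities
`Π_n(s_1, …, s_n) = ∑_π ε(π) M_{|π|}(φ(s_{B_1}), …, φ(s_{B_{|π|}}))`. -/
def density {k : Type u} [Field k] {S : PtGr.{u, w} k} {C : PAlg.{u, v} k}
    (φ : SLHom S.trivialSL C.desc) : Fam k S C.toPtGr :=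
  Fam.bullet (V := S) C.M φ.fam

/-- `M` is the family `M^S_n = h ∘ Π_n` of products on a complete space, formed with some
representative `φ` of its homotopy type and some homotopy inverse `h` of `φ_1`. -/
def CompleteRVSpace.IsProduct {k : Type u} [Field k] {C : PAlg.{u, v} k}
    (S : CompleteRVSpace.{u, v, w} C) (M : Fam k S.space S.space) : Prop :=
  ∃ φ : SLHom S.space.trivialSL C.desc, φ.type = S.type ∧
    ∃ h : C.toPtGr →ₗ[k] S.space, IsHomotopyInverse (S := S.space) (C := C) φ.lin h ∧
      ∀ n, M n = h.compMultilinearMap (density φ n)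

end

/-! Everything reduces to signed sums over partitions of words. Prepending a letter to a partitioned
word either creates a block, which has the smallest maximum and so comes first, or puts the letter
at the head of an existing block, whose maximum does not change. `partSum` is defined by this
recursion and `sum_partSign_smul` identifies it with the sums over `OrderedFinpartition`. Blocks can
serve as letters again, so `partSum_partSum` (partitioning the set of blocks is the same as
partitioning each block) follows by induction. It yields the composition laws `Fam.bullet_bullet`,
`Fam.insert_bullet`, `Fam.bullet_insert` and `Fam.ev_insert_insert`. In the last one the terms with
two odd operators in different blocks are antisymmetric (`markSumPair_antisymm`).

Since `M_1 = id`, the maps `χ ↦ M • χ` and `η ↦ M(φ; η)` (one `η`, otherwise `φ`) are unitriangular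
in the arity. They are therefore injective and recursively invertible, and identities between
families may be tested after applying `M`. In this way `ℓ ⋆ ℓ = 0` becomes `K² M = 0`, and `χ` is a
unital morphism of descendants as soon as its density `M' • χ` is unital and commutes with the
differentials (`PAlg.isDescHom_of_solution`). The descendant of `f` up to `Λ` has density `f M -
(K'Λ + Λ ⋆ ℓ)`. Changing `f` by a homotopy, or changing `Λ`, alters this density by a coboundary,
and morphisms whose densities differ by a coboundary are homotopic: interpolate the densities
linearly and solve for the flow (`PAlg.IsDescHom.exists_flow`).

Conversely, along a homotopy of morphisms out of a zero structure the density has derivative in the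
image of `K`, so its class modulo that image is constant in characteristic zero
(`density_of_type_eq`). As `f` is injective into cohomology, `f M^S = Π` modulo the image of `K`
determines `M^S`.

A splitting gives the exact relation `f M^S = Π + K b Π`. Hence the descendant of `f` and `φ` have
densities that differ by the coboundary of `b Π`, which is `hoDes([f]) = [S]`. The morphism `c`
kills the image of `K`, so `M • κ = c Π = c f M^S`: this says that `κ` is the descendant of `ι` for
`Λ = 0`. -/

set_option linter.unusedSectionVars false

/-! ### Signed sums over partitions of words -/

/-- The Koszul sign of a transposition of two letters of parities `a` and `b`. -/
def koszul (a b : ZMod 2) : ℤˣ := (-1) ^ (a * b)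

@[simp] theorem koszul_zero_left (b : ZMod 2) : koszul 0 b = 1 := by simp [koszul]
@[simp] theorem koszul_zero_right (a : ZMod 2) : koszul a 0 = 1 := by simp [koszul]

theorem koszul_add_left (a b c : ZMod 2) : koszul (a + b) c = koszul a c * koszul b c := by
  simp [koszul, add_mul, uzpow_add]

theorem koszul_add_right (a b c : ZMod 2) : koszul a (b + c) = koszul a b * koszul a c := by
  simp [koszul, mul_add, uzpow_add]

theorem koszul_comm (a b : ZMod 2) : koszul a b = koszul b a := by
  simp [koszul, mul_comm]

theorem koszul_one_left (a : ZMod 2) : koszul 1 a = (-1) ^ a := by simp [koszul]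

theorem koszul_one_one : koszul 1 1 = -1 := by simp [koszul]

theorem koszul_mul_self (a b : ZMod 2) : koszul a b * koszul a b = 1 :=
  Int.units_mul_self _

@[simp] theorem koszul_smul_smul_self {U : Type*} [AddCommGroup U] (a b : ZMod 2) (x : U) :
    koszul a b • koszul a b • x = x := by
  rw [smul_smul, koszul_mul_self, one_smul]

section Words

variable {Y Y' Z Z' U U' : Type*} [AddCommGroup U] [AddCommGroup U']

/-- The parity of a word. -/
def wordParity (p : Z → ZMod 2) (X : List Z) : ZMod 2 := (X.map p).sum

@[simp] theorem wordParity_nil (p : Z → ZMod 2) : wordParity p [] = 0 := rfl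

@[simp] theorem wordParity_cons (p : Z → ZMod 2) (x : Z) (X : List Z) :
    wordParity p (x :: X) = p x + wordParity p X := by simp [wordParity]

@[simp] theorem wordParity_append (p : Z → ZMod 2) (X X' : List Z) :
    wordParity p (X ++ X') = wordParity p X + wordParity p X' := by simp [wordParity]

theorem wordParity_map (p : Z' → ZMod 2) (m : Z → Z') (X : List Z) :
    wordParity p (X.map m) = wordParity (p ∘ m) X := by simp [wordParity]

/-- The signed sum over the positions of a word of the values of `F` at the words in which the
letter at that position is replaced by its image under `h`, the others by their images under
`g`; an operator of parity `e` passes the letters in front of the position. -/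
def markSum (q : Y → ZMod 2) (e : ZMod 2) (g h : Y → Y') (F : List Y' → U) : List Y → U
  | [] => 0
  | y :: ys => F (h y :: ys.map g) + koszul e (q y) • markSum q e g h (fun l => F (g y :: l)) ys

@[simp] theorem markSum_nil (q : Y → ZMod 2) (e : ZMod 2) (g h : Y → Y') (F : List Y' → U) :
    markSum q e g h F [] = 0 := rfl

theorem markSum_cons (q : Y → ZMod 2) (e : ZMod 2) (g h : Y → Y') (F : List Y' → U) (y : Y)
    (ys : List Y) : markSum q e g h F (y :: ys) = F (h y :: ys.map g) +
      koszul e (q y) • markSum q e g h (fun l => F (g y :: l)) ys := rfl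

theorem markSum_add (q : Y → ZMod 2) (e : ZMod 2) (g h : Y → Y') (F F' : List Y' → U)
    (ys : List Y) : markSum q e g h (fun l => F l + F' l) ys =
      markSum q e g h F ys + markSum q e g h F' ys := by
  induction ys generalizing F F' with
  | nil => simp
  | cons y ys ih =>
    simp only [markSum_cons, ih, smul_add]
    abel

/-- The signs are units of `ℤ`, so additive maps pass through. With an evaluation map or another
signed sum as `φ`, this and `partSum_comp` provide the interchanges of summations below. -/
theorem markSum_comp (φ : U →+ U') (q : Y → ZMod 2) (e : ZMod 2) (g h : Y → Y')
    (F : List Y' → U) (ys : List Y) :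
    markSum q e g h (fun l => φ (F l)) ys = φ (markSum q e g h F ys) := by
  induction ys generalizing F with
  | nil => simp
  | cons y ys ih =>
    simp only [markSum_cons, ih, map_add, Units.smul_def, map_zsmul]

theorem markSum_smul (c : ℤˣ) (q : Y → ZMod 2) (e : ZMod 2) (g h : Y → Y')
    (F : List Y' → U) (ys : List Y) :
    markSum q e g h (fun l => c • F l) ys = c • markSum q e g h F ys :=
  markSum_comp (DistribSMul.toAddMonoidHom U c) q e g h F ys

@[simp] theorem markSum_zero (q : Y → ZMod 2) (e : ZMod 2) (g h : Y → Y') (ys : List Y) :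
    markSum q e g h (fun _ => (0 : U)) ys = 0 :=
  markSum_comp (0 : U →+ U) q e g h (fun _ => 0) ys

/-- The operator `markSum` as an additive map in the functional. -/
def markSumHom (q : Y → ZMod 2) (e : ZMod 2) (g h : Y → Y') (ys : List Y) :
    (List Y' → U) →+ U where
  toFun F := markSum q e g h F ys
  map_zero' := markSum_zero q e g h ys
  map_add' F F' := markSum_add q e g h F F' ys

theorem markSum_map {Y₀ : Type*} (m : Y₀ → Y) (q : Y → ZMod 2) (e : ZMod 2) (g h : Y → Y')
    (F : List Y' → U) (ys : List Y₀) :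
    markSum q e g h F (ys.map m) = markSum (q ∘ m) e (g ∘ m) (h ∘ m) F ys := by
  induction ys generalizing F with
  | nil => rfl
  | cons y ys ih => simp [markSum_cons, ih]

theorem markSum_comp_map {Y'' : Type*} (m : Y' → Y'') (q : Y → ZMod 2) (e : ZMod 2)
    (g h : Y → Y') (F : List Y'' → U) (ys : List Y) :
    markSum q e g h (fun l => F (l.map m)) ys = markSum q e (m ∘ g) (m ∘ h) F ys := by
  induction ys generalizing F with
  | nil => rfl
  | cons y ys ih =>
    simp only [markSum_cons, List.map_cons, List.map_map, Function.comp_apply]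
    rw [ih (fun l => F (m (g y) :: l))]

/-- The signed sum over all partitions of a word `X` into blocks, the blocks being ordered by their
last elements. A new first letter either forms a block or enters one of the blocks. -/
def partSum (p : Z → ZMod 2) (F : List (List Z) → U) : List Z → U
  | [] => F []
  | x :: X => partSum p (fun Bs => F ([x] :: Bs) +
      markSum (wordParity p) (p x) id (List.cons x) F Bs) X

@[simp] theorem partSum_nil (p : Z → ZMod 2) (F : List (List Z) → U) : partSum p F [] = F [] := rfl

theorem partSum_cons (p : Z → ZMod 2) (F : List (List Z) → U) (x : Z) (X : List Z) :
    partSum p F (x :: X) = partSum p (fun Bs => F ([x] :: Bs) +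
      markSum (wordParity p) (p x) id (List.cons x) F Bs) X := rfl

@[simp] theorem partSum_singleton (p : Z → ZMod 2) (F : List (List Z) → U) (x : Z) :
    partSum p F [x] = F [[x]] := by simp [partSum_cons]

theorem partSum_comp (φ : U →+ U') (p : Z → ZMod 2) (F : List (List Z) → U) (X : List Z) :
    partSum p (fun Bs => φ (F Bs)) X = φ (partSum p F X) := by
  induction X generalizing F with
  | nil => rfl
  | cons x X ih =>
    simp only [partSum_cons, markSum_comp, ← map_add]
    exact ih _

theorem partSum_smul (c : ℤˣ) (p : Z → ZMod 2) (F : List (List Z) → U) (X : List Z) :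
    partSum p (fun Bs => c • F Bs) X = c • partSum p F X :=
  partSum_comp (DistribSMul.toAddMonoidHom U c) p F X

@[simp] theorem partSum_zero (p : Z → ZMod 2) (X : List Z) :
    partSum p (fun _ => (0 : U)) X = 0 :=
  partSum_comp (0 : U →+ U) p (fun _ => 0) X

theorem partSum_add (p : Z → ZMod 2) (F F' : List (List Z) → U) (X : List Z) :
    partSum p (fun Bs => F Bs + F' Bs) X = partSum p F X + partSum p F' X := by
  induction X generalizing F F' with
  | nil => rfl
  | cons x X ih =>
    simp only [partSum_cons, markSum_add, ← ih]
    congr 1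
    funext Bs
    abel

theorem partSum_neg (p : Z → ZMod 2) (F : List (List Z) → U) (X : List Z) :
    partSum p (fun Bs => -F Bs) X = -partSum p F X :=
  partSum_comp (-AddMonoidHom.id U) p F X

theorem partSum_sub (p : Z → ZMod 2) (F F' : List (List Z) → U) (X : List Z) :
    partSum p (fun Bs => F Bs - F' Bs) X = partSum p F X - partSum p F' X := by
  simp only [sub_eq_add_neg, partSum_add, partSum_neg]

theorem markSum_map_map (m : Z → Z') (p : Z' → ZMod 2) (x : Z) (F : List (List Z') → U)
    (Bs : List (List Z)) :
    markSum (wordParity p) (p (m x)) id (List.cons (m x)) F (Bs.map (List.map m)) =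
      markSum (wordParity (p ∘ m)) (p (m x)) id (List.cons x)
        (fun Bs => F (Bs.map (List.map m))) Bs := by
  induction Bs generalizing F with
  | nil => rfl
  | cons B Bs ih => simp [markSum_cons, ih, wordParity_map]

theorem partSum_map (m : Z → Z') (p : Z' → ZMod 2) (F : List (List Z') → U) (X : List Z) :
    partSum p F (X.map m) = partSum (p ∘ m) (fun Bs => F (Bs.map (List.map m))) X := by
  induction X generalizing F with
  | nil => rfl
  | cons x X ih =>
    simp only [List.map_cons, partSum_cons, ih, markSum_map_map, Function.comp_apply, List.map_nil]

/-- The partitions of a word. -/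
inductive IsPartition : List Z → List (List Z) → Prop
  | nil : IsPartition [] []
  | single (x : Z) {X : List Z} {Bs : List (List Z)} (h : IsPartition X Bs) :
      IsPartition (x :: X) ([x] :: Bs)
  | enter (x : Z) {X : List Z} (Bs : List (List Z)) (B : List Z) (Cs : List (List Z))
      (h : IsPartition X (Bs ++ B :: Cs)) : IsPartition (x :: X) (Bs ++ (x :: B) :: Cs)

theorem markSum_congr_append (q : Y → ZMod 2) (e : ZMod 2) (m : Y → Y) (F F' : List Y → U)
    (ys : List Y) (h : ∀ as y bs, ys = as ++ y :: bs → F (as ++ m y :: bs) =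
      F' (as ++ m y :: bs)) : markSum q e id m F ys = markSum q e id m F' ys := by
  induction ys generalizing F F' with
  | nil => rfl
  | cons y ys ih =>
    simp only [markSum_cons, id_eq, List.map_id_fun]
    rw [show F (m y :: ys) = F' (m y :: ys) from h [] y ys rfl]
    rw [ih (fun l => F (y :: l)) (fun l => F' (y :: l))]
    rintro as z bs rfl
    exact h (y :: as) z bs rfl

/-- Makes available inside a sum whatever holds for the blocks of genuine partitions: nonemptiness,
lengths, total parity and degree. -/
theorem partSum_congr (p : Z → ZMod 2) (F F' : List (List Z) → U) (X : List Z)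
    (h : ∀ Bs, IsPartition X Bs → F Bs = F' Bs) : partSum p F X = partSum p F' X := by
  induction X generalizing F F' with
  | nil => exact h [] .nil
  | cons x X ih =>
    simp only [partSum_cons]
    refine ih _ _ fun Bs hBs => ?_
    rw [h _ (.single x hBs), markSum_congr_append _ _ _ F F']
    rintro as y bs rfl
    exact h _ (.enter x as y bs hBs)

theorem IsPartition.flatten_perm {X : List Z} {Bs : List (List Z)} (h : IsPartition X Bs) :
    Bs.flatten.Perm X := by
  induction h with
  | nil => rfl
  | single x h ih => simpa using ih
  | enter x Bs B Cs h ih =>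
    simp only [List.flatten_append, List.flatten_cons, List.cons_append] at ih ⊢
    exact List.perm_middle.trans (ih.cons x)

theorem IsPartition.ne_nil {X : List Z} {Bs : List (List Z)} (h : IsPartition X Bs) :
    ∀ B ∈ Bs, B ≠ [] := by
  induction h with
  | nil => simp
  | single x h ih => simpa using ih
  | enter x Bs B Cs h ih =>
    intro A hA
    simp only [List.mem_append, List.mem_cons] at hA ih
    rcases hA with hA | rfl | hA
    · exact ih A (.inl hA)
    · simp
    · exact ih A (.inr (.inr hA))

theorem IsPartition.eq_nil {X : List Z} (h : IsPartition X []) : X = [] := by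
  simpa using h.flatten_perm.symm

theorem wordParity_perm (p : Z → ZMod 2) {X X' : List Z} (h : X.Perm X') :
    wordParity p X = wordParity p X' := (h.map p).sum_eq

theorem wordParity_flatten (p : Z → ZMod 2) (Bs : List (List Z)) :
    wordParity p Bs.flatten = wordParity (wordParity p) Bs := by
  induction Bs with
  | nil => rfl
  | cons B Bs ih => simp [ih]

theorem IsPartition.wordParity_eq (p : Z → ZMod 2) {X : List Z} {Bs : List (List Z)}
    (h : IsPartition X Bs) : wordParity (wordParity p) Bs = wordParity p X := by
  rw [← wordParity_flatten, wordParity_perm p h.flatten_perm]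

/-! ### Partitions of partitions -/

/-- The sum over families of partitions of the members of a list of words. -/
def multiPartSum (p : Z → ZMod 2) (F : List (List (List Z)) → U) : List (List Z) → U
  | [] => F []
  | B :: Bs => partSum p (fun Cs => multiPartSum p (fun Css => F (Cs :: Css)) Bs) B

theorem multiPartSum_cons (p : Z → ZMod 2) (F : List (List (List Z)) → U) (B : List Z)
    (Bs : List (List Z)) : multiPartSum p F (B :: Bs) =
      partSum p (fun Cs => multiPartSum p (fun Css => F (Cs :: Css)) Bs) B := rfl

theorem multiPartSum_comp (φ : U →+ U') (p : Z → ZMod 2) (F : List (List (List Z)) → U)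
    (Bs : List (List Z)) :
    multiPartSum p (fun Css => φ (F Css)) Bs = φ (multiPartSum p F Bs) := by
  induction Bs generalizing F with
  | nil => rfl
  | cons B Bs ih => simp only [multiPartSum_cons, ih, partSum_comp]

theorem multiPartSum_add (p : Z → ZMod 2) (F F' : List (List (List Z)) → U)
    (Bs : List (List Z)) : multiPartSum p (fun Css => F Css + F' Css) Bs =
      multiPartSum p F Bs + multiPartSum p F' Bs := by
  induction Bs generalizing F F' with
  | nil => rfl
  | cons B Bs ih => simp only [multiPartSum_cons, ih, partSum_add]

theorem multiPartSum_smul (c : ℤˣ) (p : Z → ZMod 2) (F : List (List (List Z)) → U)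
    (Bs : List (List Z)) :
    multiPartSum p (fun Css => c • F Css) Bs = c • multiPartSum p F Bs :=
  multiPartSum_comp (DistribSMul.toAddMonoidHom U c) p F Bs

/-- The derivation of words of words induced by the derivation of words that replaces one letter
by its image under `m`. -/
def markSum₂ (q : Y → ZMod 2) (e : ZMod 2) (m : Y → Y) (F : List (List Y) → U) :
    List (List Y) → U
  | [] => 0
  | B :: Bs => markSum q e id m (fun B' => F (B' :: Bs)) B +
      koszul e (wordParity q B) • markSum₂ q e m (fun l => F (B :: l)) Bs

theorem markSum₂_cons (q : Y → ZMod 2) (e : ZMod 2) (m : Y → Y) (F : List (List Y) → U)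
    (B : List Y) (Bs : List (List Y)) : markSum₂ q e m F (B :: Bs) =
      markSum q e id m (fun B' => F (B' :: Bs)) B +
      koszul e (wordParity q B) • markSum₂ q e m (fun l => F (B :: l)) Bs := rfl

theorem markSum₂_add (q : Y → ZMod 2) (e : ZMod 2) (m : Y → Y) (F F' : List (List Y) → U)
    (Bs : List (List Y)) : markSum₂ q e m (fun l => F l + F' l) Bs =
      markSum₂ q e m F Bs + markSum₂ q e m F' Bs := by
  induction Bs generalizing F F' with
  | nil => simp [markSum₂]
  | cons y ys ih =>
    simp only [markSum₂_cons, ih, smul_add, markSum_add]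
    abel

theorem markSum₂_comp (φ : U →+ U') (q : Y → ZMod 2) (e : ZMod 2) (m : Y → Y)
    (F : List (List Y) → U) (Bs : List (List Y)) :
    markSum₂ q e m (fun l => φ (F l)) Bs = φ (markSum₂ q e m F Bs) := by
  induction Bs generalizing F with
  | nil => simp [markSum₂]
  | cons y ys ih =>
    simp only [markSum₂_cons, ih, map_add, Units.smul_def, map_zsmul, markSum_comp]

theorem markSum₂_smul (c : ℤˣ) (q : Y → ZMod 2) (e : ZMod 2) (m : Y → Y)
    (F : List (List Y) → U) (Bs : List (List Y)) :
    markSum₂ q e m (fun l => c • F l) Bs = c • markSum₂ q e m F Bs :=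
  markSum₂_comp (DistribSMul.toAddMonoidHom U c) q e m F Bs

/-- All words that occur in the sum have the parity of `B` shifted by `e`, so a sign depending on
that parity is constant. -/
theorem wordParity_map_mark (q : Y → ZMod 2) (e : ZMod 2) (m : Y → Y)
    (hm : ∀ y, q (m y) = e + q y) (f : ZMod 2) (F : List Y → U) (B : List Y) :
    markSum q e id m (fun B' => koszul f (wordParity q B') • F B') B =
      koszul f (e + wordParity q B) • markSum q e id m F B := by
  rw [← markSum_smul]
  refine markSum_congr_append _ _ _ _ _ _ ?_
  rintro as y bs rfl
  simp only [wordParity_append, wordParity_cons, hm]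
  congr 2
  ring

/-- The commutator of the entrance of a letter with a derivation. -/
theorem markSum_markSum₂ (q : Y → ZMod 2) (e : ZMod 2) (m : Y → Y)
    (hm : ∀ y, q (m y) = e + q y) (y : Y) (F : List (List Y) → U) (Bs : List (List Y)) :
    markSum (wordParity q) (q y) id (List.cons y) (markSum₂ q e m F) Bs =
      markSum (wordParity q) (e + q y) id (List.cons (m y)) F Bs +
      koszul e (q y) • markSum₂ q e m
        (markSum (wordParity q) (q y) id (List.cons y) F) Bs := by
  induction Bs generalizing F with
  | nil => simp [markSum₂]
  | cons B Bs ih =>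
    simp only [markSum_cons, markSum₂_cons, id_eq, List.map_id_fun, wordParity_cons,
      markSum₂_add, markSum₂_smul, markSum_add, markSum_smul, ih, wordParity_map_mark q e m hm]
    -- The derivation acts on the first block and the letter enters one of the others, so the two
    -- sums are independent. They are interchanged by reading `F` as a functional whose values are
    -- functions of the remaining blocks.
    have h1 : markSum q e id m (fun B' => markSum (wordParity q) (q y) id (List.cons y)
        (fun l => F (B' :: l)) Bs) B = markSum (wordParity q) (q y) id (List.cons y)
        (fun l => markSum q e id m (fun B' => F (B' :: l)) B) Bs := by
      have := markSum_comp (markSumHom (U := U) (wordParity q) (q y) id (List.cons y) Bs) q e id m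
        (fun B' l => F (B' :: l)) B
      refine this.trans ?_
      change markSum _ _ _ _ _ _ = _
      congr 1
      funext l
      exact (markSum_comp (Pi.evalAddMonoidHom (fun _ : List (List Y) => U) l) q e id m
        (fun B' l => F (B' :: l)) B).symm
    rw [h1]
    simp only [smul_add, smul_smul, koszul_add_left, koszul_add_right]
    rw [koszul_comm (q y) e]
    rcases Int.units_eq_one_or (koszul e (q y)) with h | h <;> simp only [h, one_mul, mul_one,
      neg_mul, mul_neg, neg_neg, mul_comm (koszul (q y) (wordParity q B))] <;> abel

/-- A derivation commutes with the sum over partitions. -/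
theorem markSum_partSum (q : Y → ZMod 2) (e : ZMod 2) (m : Y → Y)
    (hm : ∀ y, q (m y) = e + q y) (F : List (List Y) → U) (ys : List Y) :
    markSum q e id m (partSum q F) ys = partSum q (markSum₂ q e m F) ys := by
  induction ys generalizing F with
  | nil => simp [markSum₂]
  | cons y ys ih =>
    simp only [markSum_cons, partSum_cons, id_eq, List.map_id_fun, ih, ← partSum_smul, ← partSum_add]
    congr 1
    funext Bs
    -- The commutator term, in which `m y` enters a block, matches the contribution of the
    -- derivation hitting the first letter `y`.
    rw [markSum_markSum₂ q e m hm]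
    simp only [markSum₂_cons, markSum_cons, markSum_nil, smul_zero, add_zero, wordParity_cons,
      wordParity_nil, markSum₂_add, smul_add, hm, List.map_nil]
    abel

/-- A letter put at the head of a block is, in a partition of that block, either the new first part
`[x]` or a member of an existing part. These are the two summands. -/
theorem markSum_multiPartSum (p : Z → ZMod 2) (x : Z) (F : List (List (List Z)) → U)
    (Bs : List (List Z)) :
    markSum (wordParity p) (p x) id (List.cons x) (multiPartSum p F) Bs =
      multiPartSum p (fun Css =>
        markSum (wordParity (wordParity p)) (p x) id (List.cons [x]) F Css +
        markSum₂ (wordParity p) (p x) (List.cons x) F Css) Bs := by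
  induction Bs generalizing F with
  | nil => simp [multiPartSum, markSum₂]
  | cons B Bs ih =>
    simp only [markSum_cons, multiPartSum_cons, partSum_cons, id_eq, List.map_id_fun,
      markSum₂_cons]
    have h1 : markSum (wordParity p) (p x) id (List.cons x) (fun l => partSum p
        (fun Cs => multiPartSum p (fun Css => F (Cs :: Css)) l) B) Bs =
        partSum p (fun Cs => markSum (wordParity p) (p x) id (List.cons x)
          (multiPartSum p (fun Css => F (Cs :: Css))) Bs) B := by
      have := partSum_comp (markSumHom (U := U) (wordParity p) (p x) id (List.cons x) Bs) p
        (fun Cs l => multiPartSum p (fun Css => F (Cs :: Css)) l) B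
      refine Eq.trans ?_ this.symm
      change _ = markSum _ _ _ _ _ _
      congr 1
      funext l
      exact partSum_comp (Pi.evalAddMonoidHom (fun _ : List (List Z) => U) l) p
        (fun Cs l => multiPartSum p (fun Css => F (Cs :: Css)) l) B
    rw [h1, ← partSum_smul, ← partSum_add]
    refine partSum_congr _ _ _ _ fun Cs hCs => ?_
    have h2 : markSum (wordParity p) (p x) id (List.cons x)
        (fun Cs => multiPartSum p (fun Css => F (Cs :: Css)) Bs) Cs =
        multiPartSum p (fun Css => markSum (wordParity p) (p x) id (List.cons x)
          (fun Cs => F (Cs :: Css)) Cs) Bs := by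
      have := markSum_comp (U := List (List (List Z)) → U) (U' := U)
        ⟨⟨fun F => multiPartSum p F Bs, multiPartSum_comp (0 : U →+ U) p (fun _ => 0) Bs⟩,
          fun F F' => multiPartSum_add p F F' Bs⟩
        (wordParity p) (p x) id (List.cons x) (fun Cs Css => F (Cs :: Css)) Cs
      refine this.trans ?_
      change multiPartSum p _ Bs = _
      congr 1
      funext l
      exact (markSum_comp (Pi.evalAddMonoidHom (fun _ : List (List (List Z)) => U) l) _ _ _ _
        (fun B' l => F (B' :: l)) Cs).symm
    rw [h2, ih, ← multiPartSum_smul]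
    simp only [hCs.wordParity_eq, ← multiPartSum_add]
    congr 1
    funext Css
    simp only [smul_add]
    abel

/-- Partitioning the set of blocks of a partition amounts to partitioning the blocks. -/
theorem partSum_partSum (p : Z → ZMod 2) (F : List (List (List Z)) → U) (X : List Z) :
    partSum p (partSum (wordParity p) F) X = partSum p (multiPartSum p F) X := by
  induction X generalizing F with
  | nil => rfl
  | cons x X ih =>
    simp only [partSum_cons]
    have hx : ∀ y, wordParity p (x :: y) = p x + wordParity p y := wordParity_cons p x
    -- The entrance of `x` into a block is itself a derivation on words whose letters are blocks, as
    -- it raises the parity of a block by `p x`. So it commutes with partitioning the set of blocks.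
    have h1 : ∀ Bs, markSum (wordParity p) (p x) id (List.cons x) (partSum (wordParity p) F) Bs =
        partSum (wordParity p) (markSum₂ (wordParity p) (p x) (List.cons x) F) Bs :=
      markSum_partSum (wordParity p) (p x) (List.cons x) hx F
    simp only [h1, ← partSum_add, markSum_multiPartSum]
    rw [ih]
    congr 1
    funext Bs
    simp only [multiPartSum_cons, partSum_singleton, ← multiPartSum_add, wordParity_cons,
      wordParity_nil, add_zero]
    congr 1
    funext Css
    abel

end Words

/-! ### Multiadditive functions of words and sums with one or two operators inserted. -/

section Multiadditive

variable {Y Z W U : Type*} [AddCommGroup W] [AddCommGroup U]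

/-- A function of words that is additive in each letter. -/
def IsMultiadditive (F : List W → U) : Prop :=
  ∀ (as : List W) (a b : W) (bs : List W), F (as ++ (a + b) :: bs) =
    F (as ++ a :: bs) + F (as ++ b :: bs)

theorem IsMultiadditive.cons {F : List W → U} (hF : IsMultiadditive F) (w : W) :
    IsMultiadditive (fun l => F (w :: l)) := fun as a b bs => hF (w :: as) a b bs

/-- The additive map given by the first letter. -/
def IsMultiadditive.head {F : List W → U} (hF : IsMultiadditive F) (ws : List W) : W →+ U :=
  AddMonoidHom.mk' (fun w => F (w :: ws)) fun a b => hF [] a b ws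

theorem IsMultiadditive.eq_zero {F : List W → U} (hF : IsMultiadditive F) {ws : List W}
    (h : (0 : W) ∈ ws) : F ws = 0 := by
  obtain ⟨as, bs, rfl⟩ := List.append_of_mem h
  simpa using hF as 0 0 bs

theorem IsMultiadditive.markSum_head {F : List W → U} (hF : IsMultiadditive F) (ws : List W)
    (q : Y → ZMod 2) (e : ZMod 2) {Y' : Type*} (g h : Y → Y') (γ : List Y' → W) (ys : List Y) :
    markSum q e g h (fun l => F (γ l :: ws)) ys = F (markSum q e g h γ ys :: ws) :=
  markSum_comp (hF.head ws) q e g h γ ys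

theorem IsMultiadditive.partSum_head {F : List W → U} (hF : IsMultiadditive F) (ws : List W)
    (p : Z → ZMod 2) (γ : List (List Z) → W) (X : List Z) :
    partSum p (fun l => F (γ l :: ws)) X = F (partSum p γ X :: ws) :=
  partSum_comp (hF.head ws) p γ X

/-- The signed sum over two different positions of a word at which the letters are replaced by
their images under `a` and `b`, for two odd operators. -/
def markSumPair (q : Y → ZMod 2) (g a b : Y → W) (F : List W → U) : List Y → U
  | [] => 0
  | y :: ys => koszul 1 (1 + q y) • markSum q 1 g b (fun l => F (a y :: l)) ys +
      koszul 1 (q y) • markSum q 1 g a (fun l => F (b y :: l)) ys +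
      markSumPair q g a b (fun l => F (g y :: l)) ys

theorem markSumPair_cons (q : Y → ZMod 2) (g a b : Y → W) (F : List W → U) (y : Y)
    (ys : List Y) : markSumPair q g a b F (y :: ys) =
      koszul 1 (1 + q y) • markSum q 1 g b (fun l => F (a y :: l)) ys +
      koszul 1 (q y) • markSum q 1 g a (fun l => F (b y :: l)) ys +
      markSumPair q g a b (fun l => F (g y :: l)) ys := rfl

/-- Exchanging `a` and `b` changes which odd operator passes the other, and `koszul 1 1 = -1`. This
cancellation is behind both `ℓ ⋆ ℓ = 0` and the flow equation. -/
theorem markSumPair_antisymm (q : Y → ZMod 2) (g a b : Y → W) (F : List W → U) (ys : List Y) :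
    markSumPair q g a b F ys + markSumPair q g b a F ys = 0 := by
  induction ys generalizing F with
  | nil => simp [markSumPair]
  | cons y ys ih =>
    simp only [markSumPair_cons]
    have h := ih (fun l => F (g y :: l))
    rw [eq_neg_of_add_eq_zero_left h]
    simp only [koszul_add_right, koszul_one_one, neg_mul, one_mul, Units.neg_smul]
    abel

theorem markSum_congr (q : Y → ZMod 2) (e : ZMod 2) {g h g' h' : Y → W} (F : List W → U)
    {ys : List Y} (hg : ∀ y ∈ ys, g y = g' y) (hh : ∀ y ∈ ys, h y = h' y) :
    markSum q e g h F ys = markSum q e g' h' F ys := by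
  induction ys generalizing F with
  | nil => rfl
  | cons y ys ih =>
    simp only [List.mem_cons, forall_eq_or_imp] at hg hh
    simp only [markSum_cons, hg.1, hh.1, ih _ hg.2 hh.2, List.map_congr_left hg.2]

theorem markSum_eq_zero (q : Y → ZMod 2) (e : ZMod 2) (g h : Y → W) {F : List W → U}
    (hF : IsMultiadditive F) {ys : List Y} (hh : ∀ y ∈ ys, h y = 0) :
    markSum q e g h F ys = 0 := by
  induction ys generalizing F with
  | nil => rfl
  | cons y ys ih =>
    simp only [List.mem_cons, forall_eq_or_imp] at hh
    rw [markSum_cons, ih (hF.cons _) hh.2, hF.eq_zero (by simp [hh.1]), smul_zero, add_zero]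

theorem markSumPair_eq_zero (q : Y → ZMod 2) (g a b : Y → W) {F : List W → U}
    (hF : IsMultiadditive F) {ys : List Y} (hb : ∀ y ∈ ys, b y = 0) :
    markSumPair q g a b F ys = 0 := by
  induction ys generalizing F with
  | nil => rfl
  | cons y ys ih =>
    simp only [List.mem_cons, forall_eq_or_imp] at hb
    rw [markSumPair_cons, ih (hF.cons _) hb.2, markSum_eq_zero _ _ _ _ (hF.cons _) hb.2,
      (by funext l; exact hF.eq_zero (by simp [hb.1]) : (fun l => F (b y :: l)) = fun _ => 0)]
    simp

theorem markSum_add_right (q : Y → ZMod 2) (e : ZMod 2) (g h h' : Y → W) {F : List W → U}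
    (hF : IsMultiadditive F) (ys : List Y) :
    markSum q e g (fun y => h y + h' y) F ys = markSum q e g h F ys + markSum q e g h' F ys := by
  induction ys generalizing F with
  | nil => simp
  | cons y ys ih =>
    have h0 : F ((h y + h' y) :: ys.map g) = F (h y :: ys.map g) + F (h' y :: ys.map g) :=
      hF [] _ _ _
    simp only [markSum_cons, ih (hF.cons _), smul_add, h0]
    abel

/-! ### Evaluation of sums over partitions of partitions -/

/-- The partitions of the blocks are chosen independently, so a multiadditive `F` lets the sum be
taken slot by slot. -/
theorem multiPartSum_map (p : Z → ZMod 2) (γ : List (List Z) → W) {F : List W → U}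
    (hF : IsMultiadditive F) (Bs : List (List Z)) :
    multiPartSum p (fun Css => F (Css.map γ)) Bs = F (Bs.map (partSum p γ)) := by
  induction Bs generalizing F with
  | nil => rfl
  | cons B Bs ih =>
    simp only [multiPartSum_cons, List.map_cons]
    rw [← hF.partSum_head]
    congr 1
    funext Cs
    exact ih (hF.cons _)

theorem multiPartSum_markSum (p : Z → ZMod 2) (e : ZMod 2) (γ ε : List (List Z) → W)
    {F : List W → U} (hF : IsMultiadditive F) (Bs : List (List Z)) :
    multiPartSum p (markSum (wordParity (wordParity p)) e γ ε F) Bs =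
      markSum (wordParity p) e (partSum p γ) (partSum p ε) F Bs := by
  induction Bs generalizing F with
  | nil => rfl
  | cons B Bs ih =>
    simp only [multiPartSum_cons, markSum_cons, multiPartSum_add, multiPartSum_smul,
      multiPartSum_map p γ (hF.cons _), ih (hF.cons _), partSum_add, hF.partSum_head]
    have h := partSum_comp (AddMonoidHom.mk' (fun w => markSum (wordParity p) e (partSum p γ)
      (partSum p ε) (fun l => F (w :: l)) Bs) fun a b => by
        rw [← markSum_add]; congr 1; funext l; exact hF [] a b l) p γ B
    simp only [AddMonoidHom.mk'_apply] at h
    rw [← h, ← partSum_smul]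
    congr 1
    -- The sign for passing the first block depends on its parity only, and a partition of the block
    -- has the same parity.
    exact partSum_congr _ _ _ _ fun Cs hCs => by rw [hCs.wordParity_eq]

/-- The value of a signed sum depends additively on the first letter. -/
def IsMultiadditive.markSumHead {F : List W → U} (hF : IsMultiadditive F) (q : Y → ZMod 2)
    (e : ZMod 2) (g h : Y → W) (ys : List Y) : W →+ U :=
  AddMonoidHom.mk' (fun w => markSum q e g h (fun l => F (w :: l)) ys) fun a b => by
    rw [← markSum_add]; congr 1; funext l; exact hF [] a b l

theorem markSumPair_add (q : Y → ZMod 2) (g a b : Y → W) (F F' : List W → U) (ys : List Y) :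
    markSumPair q g a b (fun l => F l + F' l) ys =
      markSumPair q g a b F ys + markSumPair q g a b F' ys := by
  induction ys generalizing F F' with
  | nil => simp [markSumPair]
  | cons y ys ih =>
    simp only [markSumPair_cons, markSum_add, ih, smul_add]
    abel

theorem multiPartSum_markSumPair (p : Z → ZMod 2) (γ α β : List (List Z) → W)
    {F : List W → U} (hF : IsMultiadditive F) (Bs : List (List Z)) :
    multiPartSum p (markSumPair (wordParity (wordParity p)) γ α β F) Bs =
      markSumPair (wordParity p) (partSum p γ) (partSum p α) (partSum p β) F Bs := by
  induction Bs generalizing F with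
  | nil => rfl
  | cons B Bs ih =>
    simp only [multiPartSum_cons, markSumPair_cons, multiPartSum_add, multiPartSum_smul,
      multiPartSum_markSum p _ _ _ (hF.cons _), ih (hF.cons _), partSum_add]
    have h1 := partSum_comp (hF.markSumHead (wordParity p) 1 (partSum p γ) (partSum p β) Bs) p α B
    have h2 := partSum_comp (hF.markSumHead (wordParity p) 1 (partSum p γ) (partSum p α) Bs) p β B
    have h3 := partSum_comp (AddMonoidHom.mk' (fun w => markSumPair (wordParity p) (partSum p γ)
      (partSum p α) (partSum p β) (fun l => F (w :: l)) Bs) fun a b => by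
        rw [← markSumPair_add]; congr 1; funext l; exact hF [] a b l) p γ B
    simp only [AddMonoidHom.mk'_apply, IsMultiadditive.markSumHead] at h1 h2 h3
    rw [← h1, ← h2, ← h3, ← partSum_smul, ← partSum_smul]
    congr 2 <;> exact partSum_congr _ _ _ _ fun Cs hCs => by rw [hCs.wordParity_eq]

/-! ### Letters that may be acted upon by an odd operator -/

/-- The parity of a letter with an odd operator applied `a` times. -/
def markedParity (q : Y → ZMod 2) (y : Y × ZMod 2) : ZMod 2 := q y.1 + y.2

/-- `markSum_partSum` needs a derivation that sends letters to letters of the same type. Recording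
the operator as a mark achieves this: on unmarked words, toggling the mark sets it. -/
theorem markSum_marked (q : Y → ZMod 2) (F : List (Y × ZMod 2) → U) (ys : List Y) :
    markSum (markedParity q) 1 id (fun y => (y.1, y.2 + 1)) F (ys.map fun y => (y, 0)) =
      markSum q 1 (fun y => (y, 0)) (fun y => (y, 1)) F ys := by
  rw [markSum_map]
  congr 1
  funext y
  simp [markedParity]

theorem markSum_partSum_marked (q : Y → ZMod 2) (F : List (List (Y × ZMod 2)) → U)
    (ys : List Y) :
    markSum q 1 (fun y => (y, 0)) (fun y => (y, 1)) (partSum (markedParity q) F) ys =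
      partSum q (fun Bs => markSum₂ (markedParity q) 1 (fun y => (y.1, y.2 + 1)) F
        (Bs.map (List.map fun y => (y, 0)))) ys := by
  rw [← markSum_marked, markSum_partSum _ _ _ _ F, partSum_map]
  · congr 1
    funext y
    simp [markedParity]
  · intro y
    simp only [markedParity]
    ring

theorem wordParity_marked (q : Y → ZMod 2) (ys : List Y) :
    wordParity (markedParity q) (ys.map fun y => (y, 0)) = wordParity q ys := by
  rw [wordParity_map]
  congr 1
  funext y
  simp [markedParity]

theorem markSum₂_map_marked (q : Y → ZMod 2) (γ : List (Y × ZMod 2) → W) {F : List W → U}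
    (hF : IsMultiadditive F) (Css : List (List Y)) :
    markSum₂ (markedParity q) 1 (fun y => (y.1, y.2 + 1)) (fun Cs => F (Cs.map γ))
        (Css.map (List.map fun y => (y, 0))) =
      markSum (wordParity q) 1 (fun C => γ (C.map fun y => (y, 0)))
        (markSum q 1 (fun y => (y, 0)) (fun y => (y, 1)) γ) F Css := by
  induction Css generalizing F with
  | nil => rfl
  | cons C Css ih =>
    simp only [List.map_cons, markSum₂_cons, markSum_cons, hF.markSum_head, markSum_marked,
      wordParity_marked, ih (hF.cons _), List.map_map]
    rfl

/-- Either the mark lies in the block that carries `ε`; then two odd operators pass the earlier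
blocks together and their signs cancel, whence the parity `0`. Or it lies in another block, which
gives the pairs. -/
theorem markSum₂_markSum_marked (q : Y → ZMod 2) (γ ε : List (Y × ZMod 2) → W) {F : List W → U}
    (hF : IsMultiadditive F) (Css : List (List Y)) :
    markSum₂ (markedParity q) 1 (fun y => (y.1, y.2 + 1))
        (markSum (wordParity (markedParity q)) 1 γ ε F) (Css.map (List.map fun y => (y, 0))) =
      markSum (wordParity q) 0 (fun C => γ (C.map fun y => (y, 0)))
        (markSum q 1 (fun y => (y, 0)) (fun y => (y, 1)) ε) F Css +
      markSumPair (wordParity q) (fun C => γ (C.map fun y => (y, 0)))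
        (markSum q 1 (fun y => (y, 0)) (fun y => (y, 1)) γ)
        (fun C => ε (C.map fun y => (y, 0))) F Css := by
  induction Css generalizing F with
  | nil => simp [markSum₂, markSumPair]
  | cons C Css ih =>
    have h := markSum_comp (hF.markSumHead (wordParity (markedParity q)) 1 γ ε
      (Css.map (List.map fun y => (y, 0)))) (markedParity q) 1 id (fun y => (y.1, y.2 + 1)) γ
      (C.map fun y => (y, 0))
    simp only [AddMonoidHom.mk'_apply, IsMultiadditive.markSumHead] at h
    simp only [List.map_cons, markSum₂_cons, markSum_cons, markSumPair_cons, markSum_add,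
      hF.markSum_head, markSum₂_add, markSum₂_smul, smul_add,
      wordParity_marked, ih (hF.cons _), List.map_map, markSum₂_map_marked q γ (hF.cons _),
      koszul_smul_smul_self, koszul_zero_left, one_smul]
    rw [wordParity_map_mark (markedParity q) 1 _ (fun y => by simp only [markedParity]; ring), h,
      markSum_marked, markSum_marked, wordParity_marked, markSum_map]
    have h1 : (wordParity (markedParity q) ∘ List.map fun y => (y, (0 : ZMod 2))) =
        wordParity q := funext fun ys => wordParity_marked q ys
    rw [h1]
    simp only [Function.comp_def]
    abel

/-! ### Associativity of substitution -/

theorem partSum_partSum_map (p : Z → ZMod 2) (γ : List (List Z) → W) {F : List W → U}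
    (hF : IsMultiadditive F) (X : List Z) :
    partSum p (partSum (wordParity p) fun Cs => F (Cs.map γ)) X =
      partSum p (fun Bs => F (Bs.map (partSum p γ))) X := by
  rw [partSum_partSum]
  congr 1
  funext Bs
  exact multiPartSum_map p γ hF Bs

theorem partSum_partSum_markSum (p : Z → ZMod 2) (e : ZMod 2) (γ ε : List (List Z) → W)
    {F : List W → U} (hF : IsMultiadditive F) (X : List Z) :
    partSum p (partSum (wordParity p) (markSum (wordParity (wordParity p)) e γ ε F)) X =
      partSum p (markSum (wordParity p) e (partSum p γ) (partSum p ε) F) X := by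
  rw [partSum_partSum]
  congr 1
  funext Bs
  exact multiPartSum_markSum p e γ ε hF Bs

theorem partSum_markSum_partSum_map (p : Z → ZMod 2) (γ : List (List Z × ZMod 2) → W)
    {F : List W → U} (hF : IsMultiadditive F) (X : List Z) :
    partSum p (markSum (wordParity p) 1 (fun y => (y, 0)) (fun y => (y, 1))
        (partSum (markedParity (wordParity p)) fun Cs => F (Cs.map γ))) X =
      partSum p (markSum (wordParity p) 1 (partSum p fun C => γ (C.map fun y => (y, 0)))
        (partSum p (markSum (wordParity p) 1 (fun y => (y, 0)) (fun y => (y, 1)) γ)) F) X := by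
  rw [← partSum_partSum_markSum p 1 _ _ hF]
  congr 1
  funext Bs
  rw [markSum_partSum_marked]
  congr 1
  funext Css
  exact markSum₂_map_marked (wordParity p) γ hF Css

theorem partSum_markSum_partSum_markSum (p : Z → ZMod 2) (γ ε : List (List Z × ZMod 2) → W)
    {F : List W → U} (hF : IsMultiadditive F) (X : List Z) :
    partSum p (markSum (wordParity p) 1 (fun y => (y, 0)) (fun y => (y, 1))
        (partSum (markedParity (wordParity p))
          (markSum (wordParity (markedParity (wordParity p))) 1 γ ε F))) X =
      partSum p (markSum (wordParity p) 0 (partSum p fun C => γ (C.map fun y => (y, 0)))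
        (partSum p (markSum (wordParity p) 1 (fun y => (y, 0)) (fun y => (y, 1)) ε)) F) X +
      partSum p (markSumPair (wordParity p) (partSum p fun C => γ (C.map fun y => (y, 0)))
        (partSum p (markSum (wordParity p) 1 (fun y => (y, 0)) (fun y => (y, 1)) γ))
        (partSum p fun C => ε (C.map fun y => (y, 0))) F) X := by
  rw [← partSum_partSum_markSum p 0 _ _ hF, ← partSum_add]
  have h : (markSumPair (wordParity p) (partSum p fun C => γ (C.map fun y => (y, 0)))
        (partSum p (markSum (wordParity p) 1 (fun y => (y, 0)) (fun y => (y, 1)) γ))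
        (partSum p fun C => ε (C.map fun y => (y, 0))) F) = _ :=
    funext fun Bs => (multiPartSum_markSumPair p _ _ _ hF Bs).symm
  rw [h, partSum_add, ← partSum_partSum, ← partSum_add]
  congr 1
  funext Bs
  rw [markSum_partSum_marked, ← partSum_add]
  congr 1
  funext Css
  exact markSum₂_markSum_marked (wordParity p) γ ε hF Css

end Multiadditive

section Words

variable {Y Y' Z W U : Type*} [AddCommGroup W] [AddCommGroup U]

/-! ### Isolating single partitions -/

/-- The partition with one block has sign `1`. Together with `IsPartition.length_lt` this isolates
the top member of a family. -/
theorem partSum_eq_single (p : Z → ZMod 2) (F : List (List Z) → U) {X : List Z} (hX : X ≠ [])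
    (hF : ∀ Bs, IsPartition X Bs → Bs ≠ [X] → F Bs = 0) : partSum p F X = F [X] := by
  induction X generalizing F with
  | nil => exact absurd rfl hX
  | cons x X ih =>
    rcases eq_or_ne X [] with rfl | h0
    · simp
    rw [partSum_cons, ih _ h0]
    · rw [hF _ (.single x _) (by simp), zero_add]
      · simp [markSum_cons]
      · obtain ⟨z, X, rfl⟩ := List.exists_cons_of_ne_nil h0
        clear ih hF h0 hX
        induction X generalizing z with
        | nil => exact .single z .nil
        | cons y X ih => exact .enter z [] _ [] (ih y)
    · intro Bs hBs hne
      rw [hF _ (.single x hBs) (by simp [h0]), zero_add]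
      rw [markSum_congr_append _ _ _ F (fun _ => 0), markSum_zero]
      rintro as y bs rfl
      refine hF _ (.enter x as y bs hBs) fun h => hne ?_
      cases as <;> simp_all

theorem partSum_eq_discrete (p : Z → ZMod 2) (F : List (List Z) → U) (X : List Z)
    (hF : ∀ Bs, IsPartition X Bs → (∃ B ∈ Bs, B.length ≠ 1) → F Bs = 0) :
    partSum p F X = F (X.map fun x => [x]) := by
  induction X generalizing F with
  | nil => rfl
  | cons x X ih =>
    have key : ∀ Bs, IsPartition X Bs →
        markSum (wordParity p) (p x) id (List.cons x) F Bs = 0 := by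
      intro Bs hBs
      rw [markSum_congr_append _ _ _ F (fun _ => 0), markSum_zero]
      rintro as y bs rfl
      refine hF _ (.enter x as y bs hBs) ⟨x :: y, by simp, ?_⟩
      simpa using hBs.ne_nil y (by simp)
    rw [partSum_cons, partSum_congr p _ (fun Bs => F ([x] :: Bs)) X
      (fun Bs hBs => by rw [key Bs hBs, add_zero]), ih]
    · simp
    · rintro Bs hBs ⟨B, hB, h⟩
      exact hF _ (.single x hBs) ⟨B, by simp [hB], h⟩

theorem markSum_append_singleton (q : Y → ZMod 2) (e : ZMod 2) (g h : Y → Y') (F : List Y' → U)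
    (ys : List Y) (y : Y) : markSum q e g h F (ys ++ [y]) =
      markSum q e g h (fun l => F (l ++ [g y])) ys +
      koszul e (wordParity q ys) • F (ys.map g ++ [h y]) := by
  induction ys generalizing F with
  | nil => simp [markSum_cons]
  | cons z ys ih =>
    simp only [List.cons_append, markSum_cons, ih, smul_add, List.map_append, List.map_cons,
      List.map_nil, wordParity_cons, koszul_add_right, smul_smul]
    abel

/-- If `F` vanishes unless the last letter forms a block, then the sum over the partitions of a word
is a sum over the partitions of the word without its last letter. -/
theorem partSum_append_singleton (p : Z → ZMod 2) (u : Z) (F : List (List Z) → U) (X : List Z)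
    (hF : ∀ As B Bs, B ≠ [] → F (As ++ (B ++ [u]) :: Bs) = 0) :
    partSum p F (X ++ [u]) = partSum p (fun Bs => F (Bs ++ [[u]])) X := by
  induction X generalizing F with
  | nil => simp
  | cons x X ih =>
    rw [List.cons_append, partSum_cons, partSum_cons, ih]
    · congr 1
      funext Bs
      rw [markSum_append_singleton]
      have h := hF Bs [x] [] (by simp)
      simp only [List.singleton_append] at h
      simp [h]
    · intro As B Bs hB
      have h := hF ([x] :: As) B Bs hB
      rw [List.cons_append] at h
      rw [h, zero_add, markSum_congr_append _ _ _ F (fun _ => 0), markSum_zero]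
      intro as y bs he
      -- The letter `x` enters a block before, equal to or after the one that ends with `u`. In each
      -- case `u` still shares its block with another letter.
      rw [List.append_eq_append_iff] at he
      rcases he with ⟨l, rfl, h2⟩ | ⟨l, rfl, h2⟩
      · cases l with
        | nil =>
          simp only [List.nil_append, List.cons.injEq] at h2
          obtain ⟨rfl, rfl⟩ := h2
          simpa using hF As (x :: B) Bs (by simp)
        | cons c l =>
          simp only [List.cons_append, List.cons.injEq] at h2
          obtain ⟨rfl, rfl⟩ := h2
          simpa using hF As B (l ++ (x :: y) :: bs) hB
      · cases l with
        | nil =>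
          simp only [List.nil_append, List.cons.injEq] at h2
          obtain ⟨rfl, rfl⟩ := h2
          simpa using hF as (x :: B) bs (by simp)
        | cons c l =>
          simp only [List.cons_append, List.cons.injEq] at h2
          obtain ⟨rfl, rfl⟩ := h2
          simpa using hF (as ++ (x :: y) :: l) B Bs hB

/-! ### Graded symmetry -/

/-- Exchanging two neighbouring letters multiplies the value by the Koszul sign. -/
def IsGradedSymm (p : Z → ZMod 2) (F : List Z → U) : Prop :=
  ∀ as x y bs, F (as ++ x :: y :: bs) = koszul (p x) (p y) • F (as ++ y :: x :: bs)

/-- Exchanging two neighbouring letters of a block multiplies the value by the Koszul sign. -/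
def IsBlockSymm (p : Z → ZMod 2) (F : List (List Z) → U) : Prop :=
  ∀ As as x y bs Bs, F (As ++ (as ++ x :: y :: bs) :: Bs) =
    koszul (p x) (p y) • F (As ++ (as ++ y :: x :: bs) :: Bs)

theorem IsGradedSymm.cons {p : Z → ZMod 2} {F : List Z → U} (hF : IsGradedSymm p F) (z : Z) :
    IsGradedSymm p (fun l => F (z :: l)) := fun as x y bs => hF (z :: as) x y bs

theorem IsBlockSymm.cons {p : Z → ZMod 2} {F : List (List Z) → U} (hF : IsBlockSymm p F)
    (B : List Z) : IsBlockSymm p (fun l => F (B :: l)) :=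
  fun As as x y bs Bs => hF (B :: As) as x y bs Bs

theorem IsGradedSymm.add {p : Z → ZMod 2} {F F' : List Z → U} (hF : IsGradedSymm p F)
    (hF' : IsGradedSymm p F') : IsGradedSymm p (fun l => F l + F' l) := fun as x y bs => by
  simp only [hF as x y bs, hF' as x y bs, smul_add]

theorem IsBlockSymm.add {p : Z → ZMod 2} {F F' : List (List Z) → U} (hF : IsBlockSymm p F)
    (hF' : IsBlockSymm p F') : IsBlockSymm p (fun l => F l + F' l) := fun As as x y bs Bs => by
  simp only [hF As as x y bs Bs, hF' As as x y bs Bs, smul_add]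

/-- When the operator hits one of the two letters, the exchange sign gains a factor `koszul e` of
the other letter's parity. It compensates for the operator passing that letter in one order but not
in the other. -/
theorem IsGradedSymm.markSum {q : Y → ZMod 2} {e : ZMod 2} {m : Y → Y}
    (hm : ∀ y, q (m y) = e + q y) {F : List Y → U} (hF : IsGradedSymm q F) :
    IsGradedSymm q (markSum q e id m F) := by
  intro as x y bs
  induction as generalizing F with
  | nil =>
    have h1 := hF [] (m x) y bs
    have h2 := hF [] x (m y) bs
    have h3 : (fun l => F (x :: y :: l)) = fun l => koszul (q x) (q y) • F (y :: x :: l) :=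
      funext fun l => hF [] x y l
    simp only [List.nil_append, hm] at h1 h2
    simp only [List.nil_append, markSum_cons, List.map_cons, id_eq, List.map_id_fun, h1, h2, h3,
      smul_add, markSum_smul, smul_smul, koszul_add_left, koszul_add_right]
    rw [koszul_comm (q x) e]
    rcases Int.units_eq_one_or (koszul e (q x)) with h | h <;>
    rcases Int.units_eq_one_or (koszul e (q y)) with h' | h' <;>
    rcases Int.units_eq_one_or (koszul (q x) (q y)) with h'' | h'' <;>
      simp only [h, h', h'', mul_one, mul_neg, neg_neg, Units.neg_smul, one_smul] <;> abel
  | cons a as ih =>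
    have h1 := hF (m a :: as) x y bs
    simp only [List.cons_append] at h1
    simp only [List.cons_append, markSum_cons, id_eq, List.map_id_fun, ih (hF.cons a), h1, smul_add]
    rw [smul_comm]

theorem IsBlockSymm.markSum {p : Z → ZMod 2} (z : Z) {F : List (List Z) → U}
    (hF : IsBlockSymm p F) :
    IsBlockSymm p (markSum (wordParity p) (p z) id (List.cons z) F) := by
  intro As as x y bs Bs
  induction As generalizing F with
  | nil =>
    have h1 := hF [] (z :: as) x y bs Bs
    have h2 : (fun l => F ((as ++ x :: y :: bs) :: l)) =
      fun l => koszul (p x) (p y) • F ((as ++ y :: x :: bs) :: l) :=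
      funext fun l => hF [] as x y bs l
    simp only [List.nil_append, List.cons_append] at h1
    simp only [List.nil_append, markSum_cons, id_eq, List.map_id_fun, h1, h2, markSum_smul,
      smul_add]
    rw [smul_comm]
    congr 4
    simp only [wordParity_append, wordParity_cons]
    ring
  | cons A As ih =>
    have h1 := hF ((z :: A) :: As) as x y bs Bs
    simp only [List.cons_append] at h1
    simp only [List.cons_append, markSum_cons, id_eq, List.map_id_fun, ih (hF.cons A), h1, smul_add]
    rw [smul_comm]

/-- Letters entering different blocks may do so in either order, up to the Koszul sign. Letters
entering the same block stand at its head as `x, y` or `y, x`, and `hF` exchanges them. -/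
theorem IsBlockSymm.markSum_markSum {p : Z → ZMod 2} (x y : Z) {F : List (List Z) → U}
    (hF : IsBlockSymm p F) (Bs : List (List Z)) :
    _root_.markSum (wordParity p) (p y) id (List.cons y)
      (_root_.markSum (wordParity p) (p x) id (List.cons x) F) Bs =
    koszul (p x) (p y) • _root_.markSum (wordParity p) (p x) id (List.cons x)
      (_root_.markSum (wordParity p) (p y) id (List.cons y) F) Bs := by
  induction Bs generalizing F with
  | nil => simp
  | cons B Bs ih =>
    have h := hF [] [] x y B Bs
    simp only [List.nil_append] at h
    simp only [markSum_cons, id_eq, List.map_id_fun, wordParity_cons, markSum_add, markSum_smul,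
      ih (hF.cons B), smul_add, h, smul_smul, koszul_add_right]
    rw [koszul_comm (p y) (p x)]
    rcases Int.units_eq_one_or (koszul (p x) (p y)) with h | h <;>
      simp only [h, one_mul, neg_mul, mul_neg, neg_neg, Units.neg_smul, one_smul,
        mul_comm (koszul (p x) (wordParity p B))] <;> abel

/-- Only an exchange of the first two letters needs an argument. Two new singleton blocks are
exchanged by `hF`, the two orders of a common new block by `hB`, a singleton and an entering letter
trade roles, and two entering letters are covered by `IsBlockSymm.markSum_markSum`. -/
theorem partSum_isGradedSymm {p : Z → ZMod 2} {F : List (List Z) → U} (hB : IsBlockSymm p F)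
    (hF : IsGradedSymm (wordParity p) F) : IsGradedSymm p (partSum p F) := by
  intro as x y bs
  induction as generalizing F with
  | nil =>
    simp only [List.nil_append, partSum_cons, ← partSum_smul]
    congr 1
    funext Bs
    have h1 := hF [] [x] [y] Bs
    have h2 := hB [] [] x y [] Bs
    simp only [List.nil_append, wordParity_cons, wordParity_nil, add_zero] at h1 h2
    simp only [markSum_add, markSum_cons, hB.markSum_markSum x y, id_eq, List.map_id_fun, h1, h2,
      wordParity_cons, wordParity_nil, add_zero, smul_add]
    rw [koszul_comm (p y) (p x)]
    simp only [koszul_smul_smul_self]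
    abel
  | cons a as ih =>
    simp only [List.cons_append, partSum_cons]
    refine ih ((hB.cons [a]).add (hB.markSum a)) ((hF.cons [a]).add (hF.markSum ?_))
    intro B
    simp

theorem IsGradedSymm.comp_map {q : Y → ZMod 2} {F : List Y → U} (hF : IsGradedSymm q F)
    (m : Z → Y) : IsGradedSymm (q ∘ m) (fun l => F (l.map m)) := fun as x y bs => by
  simpa using hF (as.map m) (m x) (m y) (bs.map m)

theorem IsGradedSymm.markSum_marked {q : Y → ZMod 2} {F : List (Y × ZMod 2) → U}
    (hF : IsGradedSymm (markedParity q) F) :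
    IsGradedSymm q (_root_.markSum q 1 (fun y => (y, 0)) (fun y => (y, 1)) F) := by
  have h1 : IsGradedSymm (markedParity q)
      (_root_.markSum (markedParity q) 1 id (fun y => (y.1, y.2 + 1)) F) :=
    hF.markSum fun y => by simp only [markedParity]; ring
  have h2 := h1.comp_map (fun y => (y, 0))
  simp only [_root_.markSum_marked] at h2
  convert h2 using 1
  funext y
  simp [markedParity]

theorem IsMultiadditive.units_smul {F : List W → U} (hF : IsMultiadditive F) (as : List W)
    (c : ℤˣ) (w : W) (bs : List W) : F (as ++ (c • w) :: bs) = c • F (as ++ w :: bs) := by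
  simp only [Units.smul_def]
  exact map_zsmul (AddMonoidHom.mk' (fun w => F (as ++ w :: bs)) fun a b => hF as a b bs) _ _

/-- Gives the block symmetry of insertions: exchanging two letters of a block multiplies the values
of both inner families at that block by the same sign. -/
theorem IsMultiadditive.markSum_units_smul {F : List W → U} (hF : IsMultiadditive F)
    (q : Y → ZMod 2) (e : ZMod 2) (g h : Y → W) (c : ℤˣ) {y y' : Y} (hg : g y = c • g y')
    (hh : h y = c • h y') (hq : q y = q y') (as bs : List Y) :
    markSum q e g h F (as ++ y :: bs) = c • markSum q e g h F (as ++ y' :: bs) := by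
  induction as generalizing F with
  | nil =>
    have h1 := hF.units_smul [] c (h y') (bs.map g)
    have h2 : (fun l => F (g y :: l)) = fun l => c • F (g y' :: l) := funext fun l => by
      rw [hg]; exact hF.units_smul [] c (g y') l
    simp only [List.nil_append] at h1
    simp only [List.nil_append, markSum_cons, hh, h1, h2, hq, markSum_smul, smul_add]
    rw [smul_comm]
  | cons a as ih =>
    have h1 := hF.units_smul (h a :: as.map g) c (g y') (bs.map g)
    simp only [List.cons_append] at h1
    simp only [List.cons_append, markSum_cons, List.map_append, List.map_cons, hg, h1,
      ih (hF.cons _), smul_add]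
    rw [smul_comm]

end Words

/-! ### Ordered partitions of positions and partitions of words. -/

section Words

variable {Y Y' Z W U : Type*} [AddCommGroup W] [AddCommGroup U]

theorem markSum_ofFn (q : Y → ZMod 2) (e : ZMod 2) (g h : Y → Y') (F : List Y' → U) {n : ℕ}
    (y : Fin n → Y) : markSum q e g h F (List.ofFn y) =
      ∑ i, (∏ j, if j < i then koszul e (q (y j)) else 1) •
        F (List.ofFn fun j => if j = i then h (y j) else g (y j)) := by
  induction n generalizing F with
  | zero => simp
  | succ n ih =>
    rw [List.ofFn_succ, markSum_cons, ih, Fin.sum_univ_succ]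
    congr 1
    · simp only [Fin.not_lt_zero, if_false, Finset.prod_const_one, one_smul, List.ofFn_succ, if_true,
        Fin.succ_ne_zero, List.map_ofFn]
      rfl
    · rw [Finset.smul_sum]
      refine Finset.sum_congr rfl fun i _ => ?_
      rw [smul_smul]
      congr 1
      · rw [Fin.prod_univ_succ]
        simp
      · simp [List.ofFn_succ, Fin.succ_inj, (Fin.succ_ne_zero _).symm]

/-- The blocks of a word along an ordered partition of its positions. -/
def blockWords {n : ℕ} (π : OrderedFinpartition n) (X : Fin n → Z) : List (List Z) :=
  List.ofFn fun i => List.ofFn fun a => X (π.emb i a)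

/-- The recursion for `OrderedFinpartition` is that of `partSum`: `extendLeft` turns the new first
position into a block, `extendMiddle i` puts it at the head of block `i`. -/
theorem blockWords_extendLeft {n : ℕ} (c : OrderedFinpartition n) (X : Fin (n + 1) → Z) :
    blockWords c.extendLeft X = [X 0] :: blockWords c (fun i => X i.succ) := by
  exact List.ofFn_succ (n := c.length)

theorem ofFn_emb_extendMiddle {n : ℕ} (c : OrderedFinpartition n) (i j : Fin c.length)
    (X : Fin (n + 1) → Z) :
    (List.ofFn fun a => X ((c.extendMiddle i).emb j a)) =
      if j = i then X 0 :: List.ofFn (fun a => X (c.emb j a).succ)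
      else List.ofFn (fun a => X (c.emb j a).succ) := by
  split_ifs with h
  · subst h
    have e : (c.extendMiddle j).partSize j = c.partSize j + 1 := by simp
    rw [List.ofFn_congr e, List.ofFn_succ]
    simp [OrderedFinpartition.extendMiddle]
    exact ⟨rfl, rfl⟩
  · have e : (c.extendMiddle i).partSize j = c.partSize j := by simp [h]
    rw [List.ofFn_congr e]
    simp [OrderedFinpartition.extendMiddle, h]
    rfl

theorem blockWords_extendMiddle {n : ℕ} (c : OrderedFinpartition n) (i : Fin c.length)
    (X : Fin (n + 1) → Z) :
    blockWords (c.extendMiddle i) X = List.ofFn fun j =>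
      if j = i then X 0 :: List.ofFn (fun a => X (c.emb j a).succ)
      else List.ofFn (fun a => X (c.emb j a).succ) := by
  unfold blockWords
  congr 1
  funext j
  exact ofFn_emb_extendMiddle c i j X

theorem OrderedFinpartition.index_eq {n : ℕ} (c : OrderedFinpartition n) {x : Fin n}
    {i : Fin c.length} (h : ∃ a, c.emb i a = x) : c.index x = i := by
  obtain ⟨a, rfl⟩ := h
  by_contra hne
  exact c.emb_ne_emb_of_ne hne (c.emb_invEmbedding (c.emb i a))

theorem OrderedFinpartition.val_index_extendLeft_zero {n : ℕ} (c : OrderedFinpartition n) :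
    (c.extendLeft.index 0).val = 0 :=
  congrArg Fin.val (c.extendLeft.index_eq (i := (0 : Fin (c.length + 1))) ⟨(0 : Fin 1), rfl⟩)

theorem OrderedFinpartition.val_index_extendLeft_succ {n : ℕ} (c : OrderedFinpartition n)
    (x : Fin n) : (c.extendLeft.index x.succ).val = (c.index x).val + 1 :=
  congrArg Fin.val (c.extendLeft.index_eq (i := (c.index x).succ)
    ⟨c.invEmbedding x, congrArg Fin.succ (c.emb_invEmbedding x)⟩)

theorem OrderedFinpartition.index_extendMiddle_succ {n : ℕ} (c : OrderedFinpartition n)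
    (i : Fin c.length) (x : Fin n) : (c.extendMiddle i).index x.succ = c.index x := by
  refine (c.extendMiddle i).index_eq (i := c.index x) ?_
  -- Membership is read off from the word of the block, because the block sizes of `extendMiddle`
  -- agree with the old ones only up to a cast.
  have h := ofFn_emb_extendMiddle c i (c.index x) id
  have h1 : x.succ ∈ List.ofFn fun a => id ((c.extendMiddle i).emb (c.index x) a) := by
    rw [h]
    have h2 : x.succ ∈ List.ofFn (fun a => id (c.emb (c.index x) a).succ) := by
      rw [List.mem_ofFn]
      exact ⟨c.invEmbedding x, congrArg Fin.succ (c.emb_invEmbedding x)⟩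
    split_ifs
    · exact List.mem_cons_of_mem _ h2
    · exact h2
  exact List.mem_ofFn.mp h1

theorem partSign_extendLeft {n : ℕ} (c : OrderedFinpartition n) (p : Fin (n + 1) → ZMod 2) :
    partSign c.extendLeft p = partSign c fun i => p i.succ := by
  unfold partSign
  rw [Fin.prod_univ_succ]
  have h0 : ∀ b : Fin (n + 1), ¬ (c.extendLeft.index b < c.extendLeft.index 0) := fun b => by
    rw [Fin.lt_def, c.val_index_extendLeft_zero]
    exact Nat.not_lt_zero _
  simp only [h0, and_false, if_false, Finset.prod_const_one, one_mul]
  refine Finset.prod_congr rfl fun a _ => ?_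
  rw [Fin.prod_univ_succ]
  simp only [Fin.not_lt_zero, false_and, if_false, one_mul, Fin.succ_lt_succ_iff]
  refine Finset.prod_congr rfl fun b _ => ?_
  simp only [Fin.lt_def, c.val_index_extendLeft_succ, Nat.add_lt_add_iff_right]

/-- The letters passed are grouped by blocks, since `koszul e` turns sums of parities into products.
-/
theorem prod_index_lt {n : ℕ} (c : OrderedFinpartition n) (e : ZMod 2) (p : Fin n → ZMod 2)
    (i : Fin c.length) : (∏ b, if c.index b < i then koszul e (p b) else 1) =
      ∏ j, if j < i then koszul e (wordParity id (List.ofFn fun a => p (c.emb j a))) else 1 := by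
  rw [← c.prod_sigma_eq_prod]
  refine Finset.prod_congr rfl fun j _ => ?_
  have h : ∀ a, c.index (c.emb j a) = j := fun a => c.index_eq ⟨a, rfl⟩
  simp only [h]
  split_ifs
  · simp only [wordParity, List.map_id, List.sum_ofFn]
    induction (Finset.univ : Finset (Fin (c.partSize j))) using Finset.induction_on with
    | empty => simp
    | insert a s ha ih => rw [Finset.prod_insert ha, Finset.sum_insert ha, koszul_add_right, ih]
  · simp

/-- The only new inversions are the pairs of the new first position with the positions in blocks
before block `i`. -/
theorem partSign_extendMiddle {n : ℕ} (c : OrderedFinpartition n) (i : Fin c.length)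
    (p : Fin (n + 1) → ZMod 2) : partSign (c.extendMiddle i) p =
      (partSign c fun i => p i.succ) *
        ∏ b, if c.index b < i then koszul (p 0) (p b.succ) else 1 := by
  unfold partSign
  rw [Fin.prod_univ_succ, mul_comm]
  congr 1
  · refine Finset.prod_congr rfl fun a _ => ?_
    rw [Fin.prod_univ_succ]
    simp only [Fin.not_lt_zero, false_and, if_false, one_mul, Fin.succ_lt_succ_iff,
      c.index_extendMiddle_succ]
    rfl
  · rw [Fin.prod_univ_succ]
    simp only [lt_self_iff_false, false_and, if_false, one_mul, Fin.succ_pos, true_and,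
      c.index_extendMiddle_succ, c.index_extendMiddle_zero]
    rfl

/-- The sum over ordered partitions of the positions of a word as a sum over partitions of the
word. -/
theorem sum_partSign_smul (p : Z → ZMod 2) (F : List (List Z) → U) {n : ℕ} (X : Fin n → Z) :
    ∑ π : OrderedFinpartition n, partSign π (fun i => p (X i)) • F (blockWords π X) =
      partSum p F (List.ofFn X) := by
  induction n generalizing F with
  | zero =>
    rw [Fintype.sum_unique]
    have h : (default : OrderedFinpartition 0).length = 0 := rfl
    simp [partSign, blockWords]
  | succ n ih =>
    rw [← (OrderedFinpartition.extendEquiv n).sum_comp, Fintype.sum_sigma, List.ofFn_succ,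
      partSum_cons, ← ih]
    refine Finset.sum_congr rfl fun c _ => ?_
    rw [Fintype.sum_option]
    simp only [OrderedFinpartition.extendEquiv_apply, OrderedFinpartition.extend_none,
      OrderedFinpartition.extend_some, partSign_extendLeft, blockWords_extendLeft, smul_add,
      partSign_extendMiddle, mul_smul, ← Finset.smul_sum]
    congr 2
    rw [blockWords, markSum_ofFn]
    refine Finset.sum_congr rfl fun i _ => ?_
    rw [prod_index_lt, blockWords_extendMiddle]
    congr 1
    refine Finset.prod_congr rfl fun j _ => ?_
    simp [wordParity, List.map_ofFn, Function.comp_def]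

end Words

/-! ### Evaluation of families at words -/

section Evaluation

variable {k : Type u} [Field k] {Z : Type*}

/-- The value of a family at a word. -/
def Fam.ev {V : Type*} {W : Type*} [AddCommGroup V] [Module k V] [AddCommGroup W] [Module k W]
    (f : Fam k V W) (l : List V) : W := f l.length l.get

theorem Fam.ev_eq {V : Type*} {W : Type*} [AddCommGroup V] [Module k V] [AddCommGroup W]
    [Module k W] (f : Fam k V W) {n : ℕ} (x : Fin n → V) (l : List V) (h : List.ofFn x = l) :
    f.ev l = f n x := by
  have hl : l.length = n := by rw [← h, List.length_ofFn]
  subst hl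
  unfold Fam.ev
  congr 1
  apply List.ofFn_injective
  rw [List.ofFn_get, h]

theorem Fam.ev_ofFn {V : Type*} {W : Type*} [AddCommGroup V] [Module k V] [AddCommGroup W]
    [Module k W] (f : Fam k V W) {n : ℕ} (x : Fin n → V) : f.ev (List.ofFn x) = f n x :=
  f.ev_eq x _ rfl

theorem Fam.ev_map_ofFn {V : Type*} {W : Type*} [AddCommGroup V] [Module k V] [AddCommGroup W]
    [Module k W] (f : Fam k V W) {n : ℕ} (x : Fin n → Z) (v : Z → V) :
    f.ev ((List.ofFn x).map v) = f n (fun i => v (x i)) :=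
  f.ev_eq _ _ (by rw [List.map_ofFn]; rfl)

theorem Fam.ev_isMultiadditive {V : Type*} {W : Type*} [AddCommGroup V] [Module k V]
    [AddCommGroup W] [Module k W] (f : Fam k V W) : IsMultiadditive f.ev := by
  intro as a b bs
  -- Words that differ in one letter are written as updates of one and the same tuple, so that their
  -- lengths agree definitionally.
  have key : ∀ c, f.ev (as ++ c :: bs) = f (as ++ a :: bs).length
      (Function.update (as ++ a :: bs).get ⟨as.length, by simp⟩ c) := by
    intro c
    refine f.ev_eq _ _ ?_
    apply List.ext_get
    · simp only [List.length_ofFn, List.length_append, List.length_cons]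
    · intro i h1 h2
      simp only [List.get_eq_getElem, List.getElem_ofFn, Function.update_apply, Fin.ext_iff]
      rcases lt_trichotomy i as.length with h | h | h
      · simp [h, h.ne, List.getElem_append_left]
      · subst h
        simp
      · rw [if_neg h.ne', List.getElem_append_right h.le, List.getElem_append_right h.le]
        obtain ⟨m, hm⟩ := Nat.exists_eq_add_of_lt h
        have : i - as.length = m + 1 := by omega
        simp [this]
  rw [key, key a, key b, MultilinearMap.map_update_add]

/-- Homogeneous elements with a chosen degree. -/
structure PtGr.Letter (V : PtGr.{u, v} k) where
  deg : ℤ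
  val : V
  mem : val ∈ V.gr deg

/-- The parity of a letter of given degree. -/
def parityOf (d : Z → ℤ) (z : Z) : ZMod 2 := (d z : ZMod 2)

/-- The degree of a word. -/
def wordDeg (d : Z → ℤ) (X : List Z) : ℤ := (X.map d).sum

@[simp] theorem wordDeg_nil (d : Z → ℤ) : wordDeg d [] = 0 := rfl

@[simp] theorem wordDeg_cons (d : Z → ℤ) (x : Z) (X : List Z) :
    wordDeg d (x :: X) = d x + wordDeg d X := by simp [wordDeg]

theorem parityOf_wordDeg (d : Z → ℤ) : parityOf (wordDeg d) = wordParity (parityOf d) := by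
  funext X
  induction X with
  | nil => simp [parityOf]
  | cons x X ih =>
    simp only [parityOf] at ih
    simp [parityOf, ih]

theorem wordDeg_perm (d : Z → ℤ) {X X' : List Z} (h : X.Perm X') : wordDeg d X = wordDeg d X' :=
  (h.map d).sum_eq

theorem wordDeg_flatten (d : Z → ℤ) (Bs : List (List Z)) :
    wordDeg d Bs.flatten = wordDeg (wordDeg d) Bs := by
  induction Bs with
  | nil => rfl
  | cons B Bs ih =>
    rw [List.flatten_cons, wordDeg_cons, ← ih]
    simp [wordDeg]

theorem IsPartition.wordDeg_eq (d : Z → ℤ) {X : List Z} {Bs : List (List Z)}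
    (h : IsPartition X Bs) : wordDeg (wordDeg d) Bs = wordDeg d X := by
  rw [← wordDeg_flatten, wordDeg_perm d h.flatten_perm]

/-- Koszul signs make sense for homogeneous arguments only. Since these span, identities between
families can be checked on letters. -/
theorem Fam.multilinear_ext {V : PtGr.{u, v} k} {W : Type*} [AddCommGroup W] [Module k W] {n : ℕ}
    {f g : MultilinearMap k (fun _ : Fin n => V.carrier) W}
    (h : ∀ x : Fin n → V.Letter, f (fun i => (x i).val) = g (fun i => (x i).val)) : f = g := by
  classical
  let _ := V.internal.chooseDecomposition
  ext x
  have hx : x = fun i => ∑ j ∈ (DirectSum.decompose V.gr (x i)).support,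
      (DirectSum.decompose V.gr (x i) j : V) := by
    funext i
    exact (DirectSum.sum_support_decompose V.gr (x i)).symm
  rw [hx, MultilinearMap.map_sum_finset, MultilinearMap.map_sum_finset]
  refine Finset.sum_congr rfl fun r _ => ?_
  exact h fun i => ⟨r i, _, (DirectSum.decompose V.gr (x i) (r i)).2⟩

theorem Fam.apply_ext {V : PtGr.{u, v} k} {W : Type*} [AddCommGroup W] [Module k W]
    {f g : Fam k V W} {n : ℕ} (h : ∀ X : List V.Letter, X.length = n →
      f.ev (X.map PtGr.Letter.val) = g.ev (X.map PtGr.Letter.val)) : f n = g n := by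
  refine Fam.multilinear_ext fun x => ?_
  have := h (List.ofFn x) (by simp)
  rwa [Fam.ev_map_ofFn, Fam.ev_map_ofFn] at this

theorem Fam.ext_ev {V : PtGr.{u, v} k} {W : Type*} [AddCommGroup W] [Module k W]
    {f g : Fam k V W} (h : ∀ X : List V.Letter,
      f.ev (X.map PtGr.Letter.val) = g.ev (X.map PtGr.Letter.val)) : f = g :=
  funext fun _ => Fam.apply_ext fun X _ => h X

variable {V : PtGr.{u, v} k} {W : Type w} [AddCommGroup W] [Module k W] {U : Type w'}
  [AddCommGroup U] [Module k U]

/-- The variant of `Fam.insert` without the additional signs, for a family of even degree. -/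
noncomputable def Fam.insertEven (f : Fam k W U) (g h : Fam k V W) : Fam k V U := fun n =>
  ∑ π : OrderedFinpartition n, ∑ i : Fin π.length,
    V.signed (partSign π) (blockComp π (f π.length)
      (fun j => if j = i then h (π.partSize j) else g (π.partSize j)))

theorem map_blockWords {Y : Type*} {n : ℕ} (π : OrderedFinpartition n) (X : Fin n → Z)
    (γ : List Z → Y) :
    (blockWords π X).map γ = List.ofFn fun i => γ (List.ofFn fun a => X (π.emb i a)) := by
  rw [blockWords, List.map_ofFn]
  rfl

/-- The letters form an arbitrary type with degrees and values, so that the blocks of another word,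
possibly marked, can be used as letters when compositions are iterated. -/
theorem Fam.ev_bullet (f : Fam k W U) (g : Fam k V W) (d : Z → ℤ) (v : Z → V)
    (hv : ∀ z, v z ∈ V.gr (d z)) (X : List Z) :
    (Fam.bullet f g).ev (X.map v) =
      partSum (parityOf d) (fun Bs => f.ev (Bs.map fun B => g.ev (B.map v))) X := by
  obtain ⟨n, x, rfl⟩ : ∃ (n : ℕ) (x : Fin n → Z), X = List.ofFn x :=
    ⟨_, _, (List.ofFn_get X).symm⟩
  rw [Fam.ev_map_ofFn, Fam.bullet_apply f g n (fun i => d (x i)) _ fun i => hv _,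
    ← sum_partSign_smul]
  refine Finset.sum_congr rfl fun π _ => ?_
  rw [map_blockWords, Fam.ev_ofFn, Units.smul_def]
  simp only [Fam.ev_map_ofFn]
  rfl

/-- The factor by which `ε(π,i)` differs from `ε(π)` is the sign of an odd operator passing the
blocks in front of the `i`-th one. -/
theorem partSignAt_smul_sum (p : Z → ZMod 2) (g h : List Z → W) (F : List W → U) {n : ℕ}
    (x : Fin n → Z) (π : OrderedFinpartition n) :
    ∑ i, partSignAt π i (fun a => p (x a)) • F (List.ofFn fun j =>
      if j = i then h (List.ofFn fun a => x (π.emb j a)) else g (List.ofFn fun a => x (π.emb j a)))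
    = partSign π (fun a => p (x a)) • markSum (wordParity p) 1 g h F (blockWords π x) := by
  rw [blockWords, markSum_ofFn, Finset.smul_sum]
  refine Finset.sum_congr rfl fun i _ => ?_
  rw [smul_smul, partSignAt]
  congr 2
  have := prod_index_lt π 1 (fun a => p (x a)) i
  simp only [koszul_one_left] at this ⊢
  rw [this]
  refine Finset.prod_congr rfl fun j _ => ?_
  simp [wordParity, List.map_ofFn, Function.comp_def]

theorem Fam.ev_insert (f : Fam k W U) (g h : Fam k V W) (d : Z → ℤ) (v : Z → V)
    (hv : ∀ z, v z ∈ V.gr (d z)) (X : List Z) :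
    (Fam.insert f g h).ev (X.map v) = partSum (parityOf d)
      (markSum (wordParity (parityOf d)) 1 (fun B => g.ev (B.map v)) (fun B => h.ev (B.map v))
        f.ev) X := by
  obtain ⟨n, x, rfl⟩ : ∃ (n : ℕ) (x : Fin n → Z), X = List.ofFn x :=
    ⟨_, _, (List.ofFn_get X).symm⟩
  rw [Fam.ev_map_ofFn, Fam.insert_apply f g h n (fun i => d (x i)) _ fun i => hv _,
    ← sum_partSign_smul]
  refine Finset.sum_congr rfl fun π _ => ?_
  rw [← partSignAt_smul_sum]
  refine Finset.sum_congr rfl fun i _ => ?_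
  rw [Fam.ev_ofFn, Units.smul_def]
  simp only [Fam.ev_map_ofFn]
  rfl

theorem Fam.insertEven_apply (f : Fam k W U) (g h : Fam k V W) (n : ℕ) (d : Fin n → ℤ)
    (x : Fin n → V) (hx : ∀ i, x i ∈ V.gr (d i)) :
    Fam.insertEven f g h n x = ∑ π : OrderedFinpartition n, ∑ i : Fin π.length,
      (partSign π (fun a => (d a : ZMod 2)) : ℤ) •
        f π.length (fun j => if j = i then h (π.partSize j) (fun a => x (π.emb j a))
          else g (π.partSize j) (fun a => x (π.emb j a))) := by
  simp only [Fam.insertEven, sum_apply]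
  refine Finset.sum_congr rfl fun π _ => Finset.sum_congr rfl fun i _ => ?_
  rw [V.signed_apply _ _ d x hx, blockComp_apply]
  congr 2
  funext j
  split_ifs <;> rfl

theorem Fam.ev_insertEven (f : Fam k W U) (g h : Fam k V W) (d : Z → ℤ) (v : Z → V)
    (hv : ∀ z, v z ∈ V.gr (d z)) (X : List Z) :
    (Fam.insertEven f g h).ev (X.map v) = partSum (parityOf d)
      (markSum (wordParity (parityOf d)) 0 (fun B => g.ev (B.map v)) (fun B => h.ev (B.map v))
        f.ev) X := by
  obtain ⟨n, x, rfl⟩ : ∃ (n : ℕ) (x : Fin n → Z), X = List.ofFn x :=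
    ⟨_, _, (List.ofFn_get X).symm⟩
  rw [Fam.ev_map_ofFn, Fam.insertEven_apply f g h n (fun i => d (x i)) _ fun i => hv _,
    ← sum_partSign_smul]
  refine Finset.sum_congr rfl fun π _ => ?_
  rw [blockWords, markSum_ofFn, Finset.smul_sum]
  refine Finset.sum_congr rfl fun i _ => ?_
  simp only [koszul_zero_left, ite_self, Finset.prod_const_one, one_smul]
  rw [Fam.ev_ofFn, Units.smul_def]
  simp only [Fam.ev_map_ofFn]
  rfl

end Evaluation

/-! ### Permutations and neighbouring transpositions -/

section Permutations

variable {Z U : Type*} [AddCommGroup U]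

theorem permSign_one {n : ℕ} (p : Fin n → ZMod 2) : permSign 1 p = 1 := by
  unfold permSign
  refine Finset.prod_eq_one fun i _ => Finset.prod_eq_one fun j _ => if_neg ?_
  rintro ⟨h1, h2⟩
  exact lt_asymm h1 h2

/-- After reindexing by the transposition of neighbours, only the pair of these two positions
changes its order. In the product of the two signs every other factor is squared. -/
theorem permSign_mul_swap {n : ℕ} (σ : Equiv.Perm (Fin (n + 1))) (i : Fin n)
    (p : Fin (n + 1) → ZMod 2) : permSign (σ * Equiv.swap i.castSucc i.succ) p =
      permSign σ p * koszul (p (σ i.castSucc)) (p (σ i.succ)) := by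
  set τ := Equiv.swap i.castSucc i.succ with hτ
  have hττ : ∀ a, τ (τ a) = a := fun a => Equiv.swap_apply_self _ _ _
  have h1 : permSign (σ * τ) p = ∏ x : Fin (n + 1) × Fin (n + 1),
      if τ x.1 < τ x.2 ∧ σ x.2 < σ x.1 then koszul (p (σ x.1)) (p (σ x.2)) else 1 := by
    unfold permSign
    rw [← Fintype.prod_prod_type',
      ← (Equiv.prodCongr τ τ).prod_comp]
    refine Finset.prod_congr rfl fun x _ => ?_
    simp only [Equiv.prodCongr_apply, Prod.map_fst, Prod.map_snd, Equiv.Perm.mul_apply, hττ]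
    rfl
  have h2 : permSign σ p = ∏ x : Fin (n + 1) × Fin (n + 1),
      if x.1 < x.2 ∧ σ x.2 < σ x.1 then koszul (p (σ x.1)) (p (σ x.2)) else 1 := by
    unfold permSign
    rw [← Fintype.prod_prod_type']
    rfl
  have hlt : i.castSucc < i.succ := Fin.castSucc_lt_succ
  have hne : i.castSucc ≠ i.succ := hlt.ne
  have key : permSign σ p * permSign (σ * τ) p =
      koszul (p (σ i.castSucc)) (p (σ i.succ)) := by
    rw [h1, h2, ← Finset.prod_mul_distrib,
      Fintype.prod_eq_mul (i.castSucc, i.succ) (i.succ, i.castSucc)]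
    · have hs : σ i.castSucc ≠ σ i.succ := σ.injective.ne hne
      simp only [hτ, Equiv.swap_apply_left, Equiv.swap_apply_right, hlt, hlt.not_gt, false_and,
        true_and, if_false, one_mul, mul_one]
      rcases lt_or_gt_of_ne hs with h | h
      · simp [h, h.not_gt, koszul_comm]
      · simp [h, h.not_gt]
    · simp [hne]
    · rintro ⟨a, b⟩ ⟨hab, hba⟩
      have hiff : τ a < τ b ↔ a < b := by
        simp only [ne_eq, Prod.mk.injEq, not_and] at hab hba
        simp only [hτ, Equiv.swap_apply_def]
        simp only [Fin.ext_iff, Fin.lt_def, Fin.val_castSucc, Fin.val_succ] at hab hba ⊢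
        split_ifs <;> simp_all <;> omega
      simp only [hiff]
      split_ifs
      · exact Int.units_mul_self _
      · simp
  rw [← key, ← mul_assoc, Int.units_mul_self, one_mul]

theorem ofFn_comp_swap {n : ℕ} (x : Fin (n + 1) → Z) (i : Fin n) :
    ∃ as bs : List Z, as.length = i ∧ List.ofFn x = as ++ x i.castSucc :: x i.succ :: bs ∧
      List.ofFn (fun j => x (Equiv.swap i.castSucc i.succ j)) =
        as ++ x i.succ :: x i.castSucc :: bs := by
  induction n with
  | zero => exact i.elim0
  | succ n ih =>
    refine Fin.cases ?_ (fun i => ?_) i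
    · refine ⟨[], List.ofFn fun j : Fin n => x j.succ.succ, rfl, ?_, ?_⟩
      · simp [List.ofFn_succ]
      · have h : ∀ j : Fin n, Equiv.swap (0 : Fin (n + 2)) 1 j.succ.succ = j.succ.succ := fun j =>
          Equiv.swap_apply_of_ne_of_ne (Fin.succ_ne_zero _) (by
            rw [← Fin.succ_zero_eq_one]
            exact fun h => Fin.succ_ne_zero _ (Fin.succ_injective _ h))
        simp [List.ofFn_succ, h]
    · obtain ⟨as, bs, h1, h2, h3⟩ := ih (fun j => x j.succ) i
      have h0 : Equiv.swap i.succ.castSucc i.succ.succ 0 = 0 :=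
        Equiv.swap_apply_of_ne_of_ne (by simp [Fin.ext_iff]) (Fin.succ_ne_zero _).symm
      have hs : ∀ j : Fin (n + 1), Equiv.swap i.succ.castSucc i.succ.succ j.succ =
          (Equiv.swap i.castSucc i.succ j).succ := fun j => by
        rw [← Fin.succ_castSucc, (Fin.succ_injective _).swap_apply]
      refine ⟨x 0 :: as, bs, by simp [h1], ?_, ?_⟩
      · rw [List.ofFn_succ, h2]
        simp [-Fin.castSucc_succ, Fin.succ_castSucc]
      · rw [List.ofFn_succ, h0]
        simp only [hs]
        rw [h3]
        simp [-Fin.castSucc_succ, Fin.succ_castSucc]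

theorem IsGradedSymm.perm {p : Z → ZMod 2} {F : List Z → U} (hF : IsGradedSymm p F) {n : ℕ}
    (x : Fin n → Z) (σ : Equiv.Perm (Fin n)) :
    F (List.ofFn x) = permSign σ (fun i => p (x i)) • F (List.ofFn fun i => x (σ i)) := by
  cases n with
  | zero => simp [permSign]
  | succ n =>
    have hσ : σ ∈ Submonoid.closure
        (Set.range fun i : Fin n => Equiv.swap i.castSucc i.succ) := by
      rw [Equiv.Perm.mclosure_swap_castSucc_succ]
      trivial
    induction hσ using Submonoid.closure_induction_right with
    | one => simp [permSign_one]
    | mul_right σ _ τ hτ ih =>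
      obtain ⟨i, rfl⟩ := hτ
      obtain ⟨as, bs, -, h2, h3⟩ := ofFn_comp_swap (fun j => x (σ j)) i
      rw [ih, permSign_mul_swap, h2, hF, mul_smul]
      simp only [Equiv.Perm.mul_apply]
      rw [h3]

theorem isGradedSymm_of_perm {p : Z → ZMod 2} {F : List Z → U}
    (h : ∀ (n : ℕ) (x : Fin n → Z) (σ : Equiv.Perm (Fin n)),
      F (List.ofFn x) = permSign σ (fun i => p (x i)) • F (List.ofFn fun i => x (σ i))) :
    IsGradedSymm p F := by
  intro as x y bs
  have hl : (as ++ x :: y :: bs).length = as.length + bs.length + 1 + 1 := by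
    simp only [List.length_append, List.length_cons]
    omega
  obtain ⟨X, hX⟩ : ∃ X : Fin (as.length + bs.length + 1 + 1) → Z,
      List.ofFn X = as ++ x :: y :: bs := by
    rw [← hl]
    exact ⟨_, List.ofFn_get _⟩
  let i : Fin (as.length + bs.length + 1) := ⟨as.length, by omega⟩
  obtain ⟨as', bs', h1, h2, h3⟩ := ofFn_comp_swap X i
  have h4 := h _ X (1 * Equiv.swap i.castSucc i.succ)
  rw [permSign_mul_swap, permSign_one, one_mul] at h4
  simp only [one_mul] at h4
  rw [h3, hX] at h4
  rw [hX] at h2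
  obtain ⟨rfl, h5⟩ := List.append_inj h2 h1.symm
  simp only [List.cons.injEq] at h5
  obtain ⟨e1, e2, rfl⟩ := h5
  rw [← e1, ← e2] at h4
  rw [h4, Equiv.Perm.one_apply, Equiv.Perm.one_apply, ← e1, ← e2]

end Permutations

/-! ### Degree and symmetry of composed families. -/

section SymmetricFamilies

variable {k : Type u} [Field k] {Z : Type*} {V : PtGr.{u, v} k} {W : PtGr.{u, w} k}
  {U : PtGr.{u, w'} k}

/-- The degree and symmetry conditions on the `n`-ary member of a family. -/
def IsSymAt (V : PtGr.{u, v} k) (W : PtGr.{u, w} k) (p : ℤ) (n : ℕ)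
    (f : MultilinearMap k (fun _ : Fin n => V.carrier) W.carrier) : Prop :=
  ∀ (d : Fin n → ℤ) (x : Fin n → V), (∀ i, x i ∈ V.gr (d i)) →
    f x ∈ W.gr ((∑ i, d i) + p) ∧
    ∀ σ : Equiv.Perm (Fin n),
      f x = permSign σ (fun i => (d i : ZMod 2)) • f (fun i => x (σ i))

theorem IsSymAt.add {p : ℤ} {n : ℕ} {f g : MultilinearMap k (fun _ : Fin n => V.carrier) W.carrier}
    (hf : IsSymAt V W p n f) (hg : IsSymAt V W p n g) : IsSymAt V W p n (f + g) := by
  intro d x hx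
  refine ⟨Submodule.add_mem _ (hf d x hx).1 (hg d x hx).1, fun σ => ?_⟩
  simp only [add_apply, smul_add]
  rw [(hf d x hx).2 σ, (hg d x hx).2 σ]

theorem IsSymAt.smul {p : ℤ} {n : ℕ} {f : MultilinearMap k (fun _ : Fin n => V.carrier) W.carrier}
    (c : k) (hf : IsSymAt V W p n f) : IsSymAt V W p n (c • f) := by
  intro d x hx
  refine ⟨Submodule.smul_mem _ _ (hf d x hx).1, fun σ => ?_⟩
  simp only [smul_apply]
  rw [(hf d x hx).2 σ, smul_comm]

theorem IsSymAt.zero {p : ℤ} {n : ℕ} : IsSymAt V W p n 0 := fun d x _ =>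
  ⟨Submodule.zero_mem _, fun σ => by simp⟩

theorem IsSymAt.sub {p : ℤ} {n : ℕ} {f g : MultilinearMap k (fun _ : Fin n => V.carrier) W.carrier}
    (hf : IsSymAt V W p n f) (hg : IsSymAt V W p n g) : IsSymAt V W p n (f - g) := by
  rw [sub_eq_add_neg, ← neg_one_smul k g]
  exact hf.add (hg.smul _)

theorem IsSymAt.comp {p q : ℤ} {n : ℕ}
    {f : MultilinearMap k (fun _ : Fin n => V.carrier) W.carrier} (hf : IsSymAt V W p n f)
    {K : W →ₗ[k] U} (hK : HasDeg W U q K) : IsSymAt V U (p + q) n (K.compMultilinearMap f) := by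
  intro d x hx
  refine ⟨by rw [← add_assoc]; exact hK _ _ (hf d x hx).1, fun σ => ?_⟩
  simp only [LinearMap.compMultilinearMap_apply]
  rw [(hf d x hx).2 σ, Units.smul_def, Units.smul_def, map_zsmul]

theorem IsSymFam.ev_mem {p : ℤ} {f : Fam k V W} (hf : IsSymFam V W p f) {d : Z → ℤ} {v : Z → V}
    (hv : ∀ z, v z ∈ V.gr (d z)) (X : List Z) : f.ev (X.map v) ∈ W.gr (wordDeg d X + p) := by
  obtain ⟨n, x, rfl⟩ : ∃ (n : ℕ) (x : Fin n → Z), X = List.ofFn x :=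
    ⟨_, _, (List.ofFn_get X).symm⟩
  rw [Fam.ev_map_ofFn]
  have := (hf.2 n (fun i => d (x i)) _ fun i => hv (x i)).1
  rwa [wordDeg, List.map_ofFn, List.sum_ofFn]

theorem IsSymFam.isGradedSymm {p : ℤ} {f : Fam k V W} (hf : IsSymFam V W p f) {d : Z → ℤ}
    {v : Z → V} (hv : ∀ z, v z ∈ V.gr (d z)) :
    IsGradedSymm (parityOf d) (fun X => f.ev (X.map v)) := by
  refine isGradedSymm_of_perm fun n x σ => ?_
  rw [Fam.ev_map_ofFn, Fam.ev_map_ofFn]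
  exact (hf.2 n (fun i => d (x i)) _ fun i => hv (x i)).2 σ

theorem IsSymFam.ev_nil {p : ℤ} {f : Fam k V W} (hf : IsSymFam V W p f) : f.ev [] = 0 := by
  simp [Fam.ev, hf.1]

theorem isSymFam_of_ev {p : ℤ} {f : Fam k V W} (h0 : f.ev [] = 0)
    (hd : ∀ X : List V.Letter, f.ev (X.map PtGr.Letter.val) ∈ W.gr (wordDeg PtGr.Letter.deg X + p))
    (hs : IsGradedSymm (parityOf PtGr.Letter.deg)
      (fun X : List V.Letter => f.ev (X.map PtGr.Letter.val))) : IsSymFam V W p f := by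
  refine ⟨?_, fun n d x hx => ?_⟩
  · ext x
    rw [← f.ev_ofFn, List.ofFn_zero, h0]
    rfl
  · let y : Fin n → V.Letter := fun i => ⟨d i, x i, hx i⟩
    constructor
    · have := hd (List.ofFn y)
      rwa [Fam.ev_map_ofFn, wordDeg, List.map_ofFn, List.sum_ofFn] at this
    · intro σ
      have := hs.perm y σ
      rwa [Fam.ev_map_ofFn, Fam.ev_map_ofFn] at this

theorem partSum_mem {U : Type*} [AddCommGroup U] {S : Type*} [SetLike S U] [AddSubgroupClass S U]
    (s : S) (p : Z → ZMod 2) (F : List (List Z) → U) (X : List Z)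
    (h : ∀ Bs, IsPartition X Bs → F Bs ∈ s) : partSum p F X ∈ s := by
  classical
  -- Off the partitions of `X` the values of `F` need not lie in `s`. They are replaced by zero
  -- there, and then the inclusion of `s` is pulled out of the sum.
  let F' : List (List Z) → s := fun Bs => if h : F Bs ∈ s then ⟨F Bs, h⟩ else 0
  have h1 : partSum p F X = partSum p (fun Bs => (AddSubgroupClass.subtype s) (F' Bs)) X :=
    partSum_congr _ _ _ _ fun Bs hBs => by simp [F', h Bs hBs]
  rw [h1, partSum_comp]
  exact (partSum p F' X).2

theorem IsSymFam.bullet {p : ℤ} {f : Fam k W U} {g : Fam k V W} (hf : IsSymFam W U p f)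
    (hg : IsSymFam V W 0 g) : IsSymFam V U p (Fam.bullet f g) := by
  have hg' : ∀ B : List V.Letter, g.ev (B.map PtGr.Letter.val) ∈
      W.gr (wordDeg PtGr.Letter.deg B) := fun B => by
    simpa using hg.ev_mem PtGr.Letter.mem B
  refine isSymFam_of_ev ?_ ?_ ?_
  · exact (Fam.ev_bullet f g PtGr.Letter.deg PtGr.Letter.val PtGr.Letter.mem []).trans hf.ev_nil
  · intro X
    rw [Fam.ev_bullet f g PtGr.Letter.deg PtGr.Letter.val PtGr.Letter.mem]
    refine partSum_mem _ _ _ _ fun Bs hBs => ?_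
    rw [← hBs.wordDeg_eq]
    exact hf.ev_mem hg' Bs
  · simp only [Fam.ev_bullet f g PtGr.Letter.deg PtGr.Letter.val PtGr.Letter.mem]
    refine partSum_isGradedSymm ?_ ?_
    · intro As as x y bs Bs
      simp only [List.map_append, List.map_cons]
      rw [← f.ev_isMultiadditive.units_smul]
      have := hg.isGradedSymm PtGr.Letter.mem as x y bs
      simp only [List.map_append, List.map_cons] at this
      rw [this]
    · rw [← parityOf_wordDeg]
      exact hf.isGradedSymm hg'

/-- The degree of a letter with an operator of degree `q` applied. -/
def markedDeg (q : ℤ) (d : Z → ℤ) (y : Z × ZMod 2) : ℤ := d y.1 + if y.2 = 0 then 0 else q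

theorem parityOf_markedDeg {q : ℤ} (hq : Odd q) (d : Z → ℤ) :
    parityOf (markedDeg q d) = markedParity (parityOf d) := by
  have h1 : (q : ZMod 2) = 1 := (ZMod.intCast_eq_one_iff_odd).mpr hq
  funext ⟨z, a⟩
  simp only [parityOf, markedDeg, markedParity]
  obtain rfl | rfl : a = 0 ∨ a = 1 := by revert a; decide
  · simp
  · simp [h1]

theorem ev_map_marked_mem {q : ℤ} {g h : Fam k V W} (hg : IsSymFam V W 0 g)
    (hh : IsSymFam V W q h) {d : Z → ℤ} {v : Z → V} (hv : ∀ z, v z ∈ V.gr (d z))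
    (y : List Z × ZMod 2) :
    (if y.2 = 0 then g.ev (y.1.map v) else h.ev (y.1.map v)) ∈
      W.gr (markedDeg q (wordDeg d) y) := by
  unfold markedDeg
  split_ifs
  · exact hg.ev_mem hv y.1
  · exact hh.ev_mem hv y.1

theorem markSum_mem {Y Y' : Type*} {U : Type*} [AddCommGroup U] {S : Type*} [SetLike S U]
    [AddSubgroupClass S U] (s : S) (q : Y → ZMod 2) (e : ZMod 2) (g h : Y → Y')
    (F : List Y' → U) (ys : List Y)
    (hs : ∀ as y bs, ys = as ++ y :: bs → F (as.map g ++ h y :: bs.map g) ∈ s) :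
    markSum q e g h F ys ∈ s := by
  induction ys generalizing F with
  | nil => exact zero_mem s
  | cons y ys ih =>
    rw [markSum_cons, Units.smul_def]
    refine add_mem (hs [] y ys rfl) (zsmul_mem (ih _ ?_) _)
    rintro as z bs rfl
    exact hs (y :: as) z bs rfl

/-- On marked blocks `g` and `h` become a single assignment of values to letters, and the insertion
becomes a sum over the position of the mark. Oddness of `q` makes the mark contribute the correct
parity. -/
theorem IsSymFam.insert {p q : ℤ} (hq : Odd q) {f : Fam k W U} {g h : Fam k V W}
    (hf : IsSymFam W U p f) (hg : IsSymFam V W 0 g) (hh : IsSymFam V W q h) :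
    IsSymFam V U (p + q) (Fam.insert f g h) := by
  have hm := ev_map_marked_mem hg hh (PtGr.Letter.mem (V := V))
  have key : ∀ Bs : List (List V.Letter), markSum (wordParity (parityOf PtGr.Letter.deg)) 1
      (fun B => g.ev (B.map PtGr.Letter.val)) (fun B => h.ev (B.map PtGr.Letter.val)) f.ev Bs =
      markSum (wordParity (parityOf PtGr.Letter.deg)) 1
        (fun y => (y, (0 : ZMod 2))) (fun y => (y, 1)) (fun l => f.ev (l.map fun y => if y.2 = 0 then g.ev (y.1.map PtGr.Letter.val)
          else h.ev (y.1.map PtGr.Letter.val))) Bs := fun Bs => by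
    rw [markSum_comp_map]
    rfl
  refine isSymFam_of_ev ?_ ?_ ?_
  · exact Fam.ev_insert f g h PtGr.Letter.deg PtGr.Letter.val PtGr.Letter.mem []
  · intro X
    rw [Fam.ev_insert f g h PtGr.Letter.deg PtGr.Letter.val PtGr.Letter.mem]
    refine partSum_mem _ _ _ _ fun Bs hBs => ?_
    rw [← hBs.wordDeg_eq, key]
    refine markSum_mem _ _ _ _ _ _ _ ?_
    rintro as y bs rfl
    have := hf.ev_mem hm (as.map (fun y => (y, 0)) ++ (y, 1) :: bs.map (fun y => (y, 0)))
    convert this using 2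
    rw [wordDeg, wordDeg]
    simp only [List.map_append, List.map_map, List.map_cons, List.sum_append, List.sum_cons,
      Function.comp_def, markedDeg, if_true, one_ne_zero, if_false, add_zero]
    ring
  · simp only [Fam.ev_insert f g h PtGr.Letter.deg PtGr.Letter.val PtGr.Letter.mem]
    refine partSum_isGradedSymm ?_ ?_
    · intro As as x y bs Bs
      refine f.ev_isMultiadditive.markSum_units_smul _ _ _ _ _ ?_ ?_ ?_ _ _
      · simpa only [List.map_append, List.map_cons] using
          hg.isGradedSymm PtGr.Letter.mem as x y bs
      · simpa only [List.map_append, List.map_cons] using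
          hh.isGradedSymm PtGr.Letter.mem as x y bs
      · simp only [wordParity_append, wordParity_cons]
        ring
    · have h1 := hf.isGradedSymm hm
      rw [parityOf_markedDeg hq, parityOf_wordDeg] at h1
      simpa only [funext key] using h1.markSum_marked

end SymmetricFamilies

/-! ### Composition laws for families. -/

section Composition

variable {k : Type u} [Field k] {V : PtGr.{u, v} k} {W : PtGr.{u, w} k}
  {W' U : Type*} [AddCommGroup W'] [Module k W'] [AddCommGroup U] [Module k U]

theorem IsSymFam.ev_letters_mem {χ : Fam k V W} (hχ : IsSymFam V W 0 χ) (B : List V.Letter) :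
    χ.ev (B.map PtGr.Letter.val) ∈ W.gr (wordDeg PtGr.Letter.deg B) := by
  simpa using hχ.ev_mem PtGr.Letter.mem B

theorem Fam.ev_bullet_letters (f : Fam k W' U) (g : Fam k V W') (X : List V.Letter) :
    (Fam.bullet f g).ev (X.map PtGr.Letter.val) = partSum (parityOf PtGr.Letter.deg)
      (fun Bs => f.ev (Bs.map fun B => g.ev (B.map PtGr.Letter.val))) X :=
  Fam.ev_bullet f g _ _ PtGr.Letter.mem X

theorem Fam.ev_insert_letters (f : Fam k W' U) (g h : Fam k V W') (X : List V.Letter) :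
    (Fam.insert f g h).ev (X.map PtGr.Letter.val) = partSum (parityOf PtGr.Letter.deg)
      (markSum (wordParity (parityOf PtGr.Letter.deg)) 1 (fun B => g.ev (B.map PtGr.Letter.val))
        (fun B => h.ev (B.map PtGr.Letter.val)) f.ev) X :=
  Fam.ev_insert f g h _ _ PtGr.Letter.mem X

theorem Fam.ev_insertEven_letters (f : Fam k W' U) (g h : Fam k V W') (X : List V.Letter) :
    (Fam.insertEven f g h).ev (X.map PtGr.Letter.val) = partSum (parityOf PtGr.Letter.deg)
      (markSum (wordParity (parityOf PtGr.Letter.deg)) 0 (fun B => g.ev (B.map PtGr.Letter.val))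
        (fun B => h.ev (B.map PtGr.Letter.val)) f.ev) X :=
  Fam.ev_insertEven f g h _ _ PtGr.Letter.mem X

theorem Fam.bullet_bullet (f : Fam k W' U) (φ : Fam k W W') {χ : Fam k V W}
    (hχ : IsSymFam V W 0 χ) :
    Fam.bullet (Fam.bullet f φ) χ = Fam.bullet f (Fam.bullet φ χ) := by
  refine Fam.ext_ev fun X => ?_
  rw [Fam.ev_bullet_letters]
  simp only [Fam.ev_bullet _ _ _ _ hχ.ev_letters_mem, parityOf_wordDeg]
  refine (partSum_partSum_map _ _ f.ev_isMultiadditive X).trans ?_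
  have h := Fam.ev_bullet_letters f (Fam.bullet φ χ) X
  refine Eq.trans ?_ h.symm
  simp only [Fam.ev_bullet_letters]

/-- Partitions of partitions again. The operator passes whole blocks, whose parities `χ` preserves,
having degree zero. -/
theorem Fam.insert_bullet (f : Fam k W' U) (φ η : Fam k W W') {χ : Fam k V W}
    (hχ : IsSymFam V W 0 χ) :
    Fam.bullet (Fam.insert f φ η) χ = Fam.insert f (Fam.bullet φ χ) (Fam.bullet η χ) := by
  refine Fam.ext_ev fun X => ?_
  rw [Fam.ev_bullet_letters]
  simp only [Fam.ev_insert _ _ _ _ _ hχ.ev_letters_mem, parityOf_wordDeg]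
  refine (partSum_partSum_markSum _ 1 _ _ f.ev_isMultiadditive X).trans ?_
  have h := Fam.ev_insert_letters f (Fam.bullet φ χ) (Fam.bullet η χ) X
  refine Eq.trans ?_ h.symm
  simp only [Fam.ev_bullet_letters]

variable {q : ℤ} {g h : Fam k V W}

theorem markSum_ev_marked (G : List W → U) (Bs : List (List V.Letter)) :
    markSum (wordParity (parityOf PtGr.Letter.deg)) 1 (fun B => g.ev (B.map PtGr.Letter.val))
        (fun B => h.ev (B.map PtGr.Letter.val)) G Bs =
      markSum (wordParity (parityOf PtGr.Letter.deg)) 1 (fun y => (y, (0 : ZMod 2)))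
        (fun y => (y, 1)) (fun l => G (l.map fun y => if y.2 = 0 then
          g.ev (y.1.map PtGr.Letter.val) else h.ev (y.1.map PtGr.Letter.val))) Bs := by
  rw [markSum_comp_map]
  rfl

/-- Chain rule: the block that carries `h` lies in exactly one block of the outer partition. There
`φ` is applied with `h` inserted, elsewhere it is composed with `g`. -/
theorem Fam.bullet_insert (hq : Odd q) (f : Fam k W' U) (φ : Fam k W W')
    (hg : IsSymFam V W 0 g) (hh : IsSymFam V W q h) :
    Fam.insert (Fam.bullet f φ) g h = Fam.insert f (Fam.bullet φ g) (Fam.insert φ g h) := by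
  have hm := ev_map_marked_mem hg hh (PtGr.Letter.mem (V := V))
  refine Fam.ext_ev fun X => ?_
  rw [Fam.ev_insert_letters]
  have h1 := partSum_markSum_partSum_map (parityOf PtGr.Letter.deg)
    (fun C => φ.ev (C.map fun y => if y.2 = 0 then g.ev (y.1.map PtGr.Letter.val)
      else h.ev (y.1.map PtGr.Letter.val))) f.ev_isMultiadditive X
  simp only [funext (markSum_ev_marked (g := g) (h := h) _), Fam.ev_bullet f φ _ _ hm,
    parityOf_markedDeg hq, parityOf_wordDeg]
  refine h1.trans ?_
  have h2 := Fam.ev_insert_letters f (Fam.bullet φ g) (Fam.insert φ g h) X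
  refine Eq.trans ?_ h2.symm
  simp only [Fam.ev_bullet_letters, Fam.ev_insert_letters,
    funext (markSum_ev_marked (g := g) (h := h) _), List.map_map]
  rfl

/-- Chain rule for a family that already carries an odd `η`: the block of `h` is nested in that of
`η`, giving an insertion without passing signs, or it lies in a block with `φ`, giving a sum over
pairs of distinct blocks. -/
theorem Fam.ev_insert_insert (hq : Odd q) (f : Fam k W' U) (φ η : Fam k W W')
    (hg : IsSymFam V W 0 g) (hh : IsSymFam V W q h) (X : List V.Letter) :
    (Fam.insert (Fam.insert f φ η) g h).ev (X.map PtGr.Letter.val) =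
      (Fam.insertEven f (Fam.bullet φ g) (Fam.insert η g h)).ev (X.map PtGr.Letter.val) +
      partSum (parityOf PtGr.Letter.deg) (markSumPair (wordParity (parityOf PtGr.Letter.deg))
        (fun B => (Fam.bullet φ g).ev (B.map PtGr.Letter.val))
        (fun B => (Fam.insert φ g h).ev (B.map PtGr.Letter.val))
        (fun B => (Fam.bullet η g).ev (B.map PtGr.Letter.val)) f.ev) X := by
  have hm := ev_map_marked_mem hg hh (PtGr.Letter.mem (V := V))
  rw [Fam.ev_insert_letters]
  have h1 := partSum_markSum_partSum_markSum (parityOf PtGr.Letter.deg)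
    (fun C => φ.ev (C.map fun y => if y.2 = 0 then g.ev (y.1.map PtGr.Letter.val)
      else h.ev (y.1.map PtGr.Letter.val)))
    (fun C => η.ev (C.map fun y => if y.2 = 0 then g.ev (y.1.map PtGr.Letter.val)
      else h.ev (y.1.map PtGr.Letter.val))) f.ev_isMultiadditive X
  have h3 : (Fam.insert f φ η).ev ∘ (List.map fun y : List V.Letter × ZMod 2 => if y.2 = 0 then
      g.ev (y.1.map PtGr.Letter.val) else h.ev (y.1.map PtGr.Letter.val)) = _ :=
    funext fun l => Fam.ev_insert f φ η _ _ hm l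
  simp only [parityOf_markedDeg hq, parityOf_wordDeg] at h3
  rw [funext (markSum_ev_marked (g := g) (h := h) _)]
  simp only [Function.comp_def] at h3
  rw [h3]
  refine h1.trans ?_
  have h2 := Fam.ev_insertEven_letters f (Fam.bullet φ g) (Fam.insert η g h) X
  rw [h2]
  simp only [Fam.ev_bullet_letters, Fam.ev_insert_letters,
    funext (markSum_ev_marked (g := g) (h := h) _), List.map_map]
  rfl

end Composition

section Families

variable {k : Type u} [Field k] {V : PtGr.{u, v} k} {W : PtGr.{u, w} k}
  {W' U U' : Type*} [AddCommGroup W'] [Module k W'] [AddCommGroup U] [Module k U]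
  [AddCommGroup U'] [Module k U']

/-! ### The identity family -/

theorem Fam.ev_nil {V : Type*} [AddCommGroup V] [Module k V] {f : Fam k V U} (h : f 0 = 0) :
    f.ev [] = 0 := DFunLike.congr_fun h _

theorem Fam.ev_id_singleton (x : W') : (Fam.id k W').ev [x] = x := rfl

theorem Fam.ev_id_of_length_ne {l : List W'} (h : l.length ≠ 1) : (Fam.id k W').ev l = 0 := by
  match l, h with
  | [], _ => rfl
  | [_], h => exact absurd rfl h
  | _ :: _ :: _, _ => rfl

theorem Fam.id_isSymFam : IsSymFam V V 0 (Fam.id k V) := by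
  refine ⟨rfl, fun n d x hx => ?_⟩
  match n, d, x, hx with
  | 0, _, _, _ => exact ⟨Submodule.zero_mem _, fun σ => (smul_zero _).symm⟩
  | 1, d, x, hx =>
    refine ⟨by simpa [Fam.id] using hx 0, fun σ => ?_⟩
    rw [Subsingleton.elim σ 1, permSign_one, one_smul]
    rfl
  | _ + 2, _, _, _ => exact ⟨Submodule.zero_mem _, fun σ => (smul_zero _).symm⟩

theorem IsPartition.length_ne_one {Z : Type*} {X : List Z} {Bs : List (List Z)}
    (h : IsPartition X Bs) (hne : Bs ≠ [X]) : Bs.length ≠ 1 := by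
  intro h1
  obtain ⟨B, rfl⟩ := List.length_eq_one_iff.mp h1
  apply hne
  clear hne h1
  generalize hBs : [B] = Bs at h
  induction h generalizing B with
  | nil => simp at hBs
  | single x h ih =>
    simp only [List.cons.injEq] at hBs
    obtain ⟨rfl, rfl⟩ := hBs
    rw [h.eq_nil]
  | enter x Bs C Cs h ih =>
    cases Bs with
    | cons A As => simp at hBs
    | nil =>
      simp only [List.nil_append, List.cons.injEq] at hBs
      obtain ⟨rfl, rfl⟩ := hBs
      have := ih C rfl
      simp_all

/-- There is another block, and being nonempty it uses up at least one letter. -/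
theorem IsPartition.length_lt {Z : Type*} {X : List Z} {Bs : List (List Z)}
    (h : IsPartition X Bs) (hne : Bs ≠ [X]) {B : List Z} (hB : B ∈ Bs) :
    B.length < X.length := by
  obtain ⟨as, bs, rfl⟩ := List.append_of_mem hB
  have h1 := h.flatten_perm.length_eq
  have h2 := h.length_ne_one hne
  simp only [List.flatten_append, List.flatten_cons, List.length_append] at h1
  have h3 : ∀ C ∈ as ++ bs, 0 < C.length := fun C hC =>
    List.length_pos_iff.mpr (h.ne_nil C (by simp at hC ⊢; tauto))
  have h4 : as ++ bs ≠ [] := by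
    rintro h5
    simp only [List.append_eq_nil_iff] at h5
    simp [h5] at h2
  obtain ⟨C, hC⟩ := List.exists_mem_of_ne_nil _ h4
  have h5 := h3 C hC
  rw [List.mem_append] at hC
  rcases hC with hC | hC
  · have := (List.sublist_flatten_of_mem hC).length_le
    omega
  · have := (List.sublist_flatten_of_mem hC).length_le
    omega

theorem IsPartition.length_le {Z : Type*} {X : List Z} {Bs : List (List Z)}
    (h : IsPartition X Bs) {B : List Z} (hB : B ∈ Bs) : B.length ≤ X.length := by
  rw [← h.flatten_perm.length_eq]
  exact (List.sublist_flatten_of_mem hB).length_le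

theorem Fam.id_bullet {χ : Fam k V W'} (h0 : χ 0 = 0) : Fam.bullet (Fam.id k W') χ = χ := by
  refine Fam.ext_ev fun X => ?_
  rw [Fam.ev_bullet_letters]
  rcases eq_or_ne X [] with rfl | hX
  · rw [partSum_nil, List.map_nil, List.map_nil, Fam.ev_nil h0, Fam.ev_nil rfl]
  · rw [partSum_eq_single _ _ hX]
    · simp [Fam.ev_id_singleton]
    · intro Bs hBs hne
      exact Fam.ev_id_of_length_ne (by simpa using hBs.length_ne_one hne)

theorem Fam.bullet_id (φ : Fam k V U) : Fam.bullet φ (Fam.id k V) = φ := by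
  refine Fam.ext_ev fun X => ?_
  rw [Fam.ev_bullet_letters, partSum_eq_discrete]
  · congr 1
    simp [Function.comp_def, Fam.ev_id_singleton]
  · rintro Bs hBs ⟨B, hB, hl⟩
    refine φ.ev_isMultiadditive.eq_zero ?_
    exact List.mem_map.mpr ⟨B, hB, Fam.ev_id_of_length_ne (by simpa using hl)⟩

theorem markSum_ev_id_of_length_ne {Y : Type*} (q : Y → ZMod 2) (e : ZMod 2) (g h : Y → W')
    {ys : List Y} (hl : ys.length ≠ 1) : markSum q e g h (Fam.id k W').ev ys = 0 := by
  have key : ∀ (F : List W' → W') (ys : List Y),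
      (∀ l : List W', l.length = ys.length → F l = 0) → markSum q e g h F ys = 0 := by
    intro F ys hF
    induction ys generalizing F with
    | nil => rfl
    | cons y ys ih =>
      rw [markSum_cons, hF _ (by simp), ih, smul_zero, add_zero]
      intro l hl
      exact hF _ (by simp [hl])
  exact key _ ys fun l h => Fam.ev_id_of_length_ne (by rwa [h])

theorem Fam.insert_id {g h : Fam k V W'} (h0 : h 0 = 0) : Fam.insert (Fam.id k W') g h = h := by
  refine Fam.ext_ev fun X => ?_
  rw [Fam.ev_insert_letters]
  rcases eq_or_ne X [] with rfl | hX
  · rw [partSum_nil, List.map_nil, Fam.ev_nil h0, markSum_nil]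
  · rw [partSum_eq_single _ _ hX]
    · simp [markSum_cons, Fam.ev_id_singleton]
    · intro Bs hBs hne
      exact markSum_ev_id_of_length_ne _ _ _ _ (hBs.length_ne_one hne)

/-! ### Linearity -/

/-- The composition of a family with a linear map. -/
def Fam.post (K : U →ₗ[k] U') {V : Type*} [AddCommGroup V] [Module k V] (f : Fam k V U) :
    Fam k V U' := fun n => K.compMultilinearMap (f n)

theorem Fam.ev_post (K : U →ₗ[k] U') {V : Type*} [AddCommGroup V] [Module k V] (f : Fam k V U)
    (l : List V) : (Fam.post K f).ev l = K (f.ev l) := rfl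

theorem Fam.ev_add {V : Type*} [AddCommGroup V] [Module k V] (f g : Fam k V U)
    (l : List V) : (f + g).ev l = f.ev l + g.ev l := rfl

theorem Fam.ev_sub {V : Type*} [AddCommGroup V] [Module k V] (f g : Fam k V U)
    (l : List V) : (f - g).ev l = f.ev l - g.ev l := rfl

theorem Fam.ev_smul {V : Type*} [AddCommGroup V] [Module k V] (c : k) (f : Fam k V U)
    (l : List V) : (c • f).ev l = c • f.ev l := rfl

theorem Fam.post_bullet (K : U →ₗ[k] U') (f : Fam k W' U) (g : Fam k V W') :
    Fam.bullet (Fam.post K f) g = Fam.post K (Fam.bullet f g) := by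
  refine Fam.ext_ev fun X => ?_
  rw [Fam.ev_post, Fam.ev_bullet_letters, Fam.ev_bullet_letters]
  exact partSum_comp K.toAddMonoidHom _ _ _

theorem Fam.post_insert (K : U →ₗ[k] U') (f : Fam k W' U) (g h : Fam k V W') :
    Fam.insert (Fam.post K f) g h = Fam.post K (Fam.insert f g h) := by
  refine Fam.ext_ev fun X => ?_
  rw [Fam.ev_post, Fam.ev_insert_letters, Fam.ev_insert_letters]
  refine Eq.trans ?_ (partSum_comp K.toAddMonoidHom _ _ _)
  congr 1
  funext Bs
  exact markSum_comp K.toAddMonoidHom _ _ _ _ _ _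

theorem Fam.add_bullet (f f' : Fam k W' U) (g : Fam k V W') :
    Fam.bullet (f + f') g = Fam.bullet f g + Fam.bullet f' g := by
  refine Fam.ext_ev fun X => ?_
  rw [Fam.ev_add]
  simp only [Fam.ev_bullet_letters, Fam.ev_add, partSum_add]

theorem Fam.add_insert (f f' : Fam k W' U) (g h : Fam k V W') :
    Fam.insert (f + f') g h = Fam.insert f g h + Fam.insert f' g h := by
  refine Fam.ext_ev fun X => ?_
  rw [Fam.ev_add]
  simp only [Fam.ev_insert_letters, ← partSum_add]
  congr 1
  funext Bs
  exact markSum_add _ _ _ _ _ _ _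

theorem Fam.zero_insert (g h : Fam k V W') : Fam.insert (0 : Fam k W' U) g h = 0 := by
  have := Fam.add_insert (0 : Fam k W' U) 0 g h
  simpa using this

theorem Fam.zero_bullet (g : Fam k V W') : Fam.bullet (0 : Fam k W' U) g = 0 := by
  have := Fam.add_bullet (0 : Fam k W' U) 0 g
  simpa using this

theorem Fam.smul_insert (c : k) (f : Fam k W' U) (g h : Fam k V W') :
    Fam.insert (c • f) g h = c • Fam.insert f g h :=
  Fam.post_insert (LinearMap.lsmul k U c) f g h

theorem Fam.sub_insert (f f' : Fam k W' U) (g h : Fam k V W') :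
    Fam.insert (f - f') g h = Fam.insert f g h - Fam.insert f' g h := by
  rw [eq_sub_iff_add_eq, ← Fam.add_insert, sub_add_cancel]

theorem Fam.sub_bullet (f f' : Fam k W' U) (g : Fam k V W') :
    Fam.bullet (f - f') g = Fam.bullet f g - Fam.bullet f' g := by
  rw [eq_sub_iff_add_eq, ← Fam.add_bullet, sub_add_cancel]

theorem Fam.insert_add (f : Fam k W' U) (g h h' : Fam k V W') :
    Fam.insert f g (h + h') = Fam.insert f g h + Fam.insert f g h' := by
  refine Fam.ext_ev fun X => ?_
  rw [Fam.ev_add]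
  simp only [Fam.ev_insert_letters, ← partSum_add]
  congr 1
  funext Bs
  exact markSum_add_right _ _ _ _ _ f.ev_isMultiadditive _

theorem Fam.insertEven_add (f : Fam k W' U) (g h h' : Fam k V W') :
    Fam.insertEven f g (h + h') = Fam.insertEven f g h + Fam.insertEven f g h' := by
  refine Fam.ext_ev fun X => ?_
  rw [Fam.ev_add]
  simp only [Fam.ev_insertEven_letters, ← partSum_add]
  congr 1
  funext Bs
  exact markSum_add_right _ _ _ _ _ f.ev_isMultiadditive _

theorem Fam.insert_zero (f : Fam k W' U) (g : Fam k V W') : Fam.insert f g 0 = 0 := by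
  have := Fam.insert_add f g 0 0
  simpa using this

theorem Fam.insertEven_zero (f : Fam k W' U) (g : Fam k V W') : Fam.insertEven f g 0 = 0 := by
  have := Fam.insertEven_add f g 0 0
  simpa using this

/-! ### Triangular systems -/

/-- The members of a family of arity less than `n`. -/
def Fam.trunc {V : Type*} [AddCommGroup V] [Module k V] (n : ℕ) (f : Fam k V U) : Fam k V U :=
  fun m => if m < n then f m else 0

theorem Fam.ev_trunc {V : Type*} [AddCommGroup V] [Module k V] (n : ℕ) (f : Fam k V U)
    (l : List V) : (f.trunc n).ev l = if l.length < n then f.ev l else 0 := by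
  unfold Fam.trunc Fam.ev
  split_ifs with h <;> simp [h]

theorem Fam.trunc_congr {V : Type*} [AddCommGroup V] [Module k V] {n : ℕ} {f g : Fam k V U}
    (h : ∀ m < n, f m = g m) : f.trunc n = g.trunc n := by
  funext m
  unfold Fam.trunc
  split_ifs with hm
  · exact h m hm
  · rfl

variable {M : Fam k W' W'}

theorem Fam.ev_singleton_of_apply_one (hM : ∀ x : Fin 1 → W', M 1 x = x 0) (x : W') :
    M.ev [x] = x := hM _

/-- As `M_1 = id`, the one-block partition contributes `χ n`. All other partitions have blocks of
size less than `n` and see only the truncation. The same argument applies to the two kinds of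
insertion. -/
theorem Fam.bullet_triangular (hM : ∀ x : Fin 1 → W', M 1 x = x 0) (χ : Fam k V W') {n : ℕ}
    (hn : n ≠ 0) : Fam.bullet M χ n = χ n + Fam.bullet M (χ.trunc n) n := by
  refine Fam.apply_ext (g := χ + Fam.bullet M (χ.trunc n)) fun X hX => ?_
  have hX0 : X ≠ [] := by rintro rfl; exact hn hX.symm
  rw [Fam.ev_add, ← sub_eq_iff_eq_add, Fam.ev_bullet_letters, Fam.ev_bullet_letters,
    ← partSum_sub, partSum_eq_single _ _ hX0]
  · simp [Fam.ev_trunc, hX, Fam.ev_singleton_of_apply_one hM]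
  · intro Bs hBs hne
    rw [sub_eq_zero]
    congr 1
    refine List.map_congr_left fun B hB => ?_
    rw [Fam.ev_trunc, if_pos]
    simpa [hX] using hBs.length_lt hne hB

theorem Fam.markSum_triangular (hM : ∀ x : Fin 1 → W', M 1 x = x 0) (e : ZMod 2)
    (g h : Fam k V W') {X : List V.Letter} (hX : X ≠ []) :
    partSum (parityOf PtGr.Letter.deg) (markSum (wordParity (parityOf PtGr.Letter.deg)) e
        (fun B => g.ev (B.map PtGr.Letter.val)) (fun B => h.ev (B.map PtGr.Letter.val)) M.ev) X =
      h.ev (X.map PtGr.Letter.val) +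
      partSum (parityOf PtGr.Letter.deg) (markSum (wordParity (parityOf PtGr.Letter.deg)) e
        (fun B => g.ev (B.map PtGr.Letter.val))
        (fun B => (h.trunc X.length).ev (B.map PtGr.Letter.val)) M.ev) X := by
  rw [← sub_eq_iff_eq_add, ← partSum_sub, partSum_eq_single _ _ hX]
  · simp [markSum_cons, Fam.ev_trunc, Fam.ev_singleton_of_apply_one hM]
  · intro Bs hBs hne
    rw [sub_eq_zero]
    refine markSum_congr _ _ _ (fun _ _ => rfl) fun B hB => ?_
    rw [Fam.ev_trunc, if_pos]
    simpa using hBs.length_lt hne hB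

theorem Fam.insert_triangular (hM : ∀ x : Fin 1 → W', M 1 x = x 0) (g h : Fam k V W') {n : ℕ}
    (hn : n ≠ 0) : Fam.insert M g h n = h n + Fam.insert M g (h.trunc n) n := by
  refine Fam.apply_ext (g := h + Fam.insert M g (h.trunc n)) fun X hX => ?_
  have hX0 : X ≠ [] := by rintro rfl; exact hn hX.symm
  rw [Fam.ev_add, Fam.ev_insert_letters, Fam.ev_insert_letters, Fam.markSum_triangular hM _ _ _ hX0,
    hX]

theorem Fam.insertEven_triangular (hM : ∀ x : Fin 1 → W', M 1 x = x 0) (g h : Fam k V W') {n : ℕ}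
    (hn : n ≠ 0) : Fam.insertEven M g h n = h n + Fam.insertEven M g (h.trunc n) n := by
  refine Fam.apply_ext (g := h + Fam.insertEven M g (h.trunc n)) fun X hX => ?_
  have hX0 : X ≠ [] := by rintro rfl; exact hn hX.symm
  rw [Fam.ev_add, Fam.ev_insertEven_letters, Fam.ev_insertEven_letters,
    Fam.markSum_triangular hM _ _ _ hX0, hX]

theorem Fam.bullet_zero_arity (f : Fam k W' U) (g : Fam k V W') (hf : f 0 = 0) :
    Fam.bullet f g 0 = 0 := by
  refine Fam.apply_ext (g := (0 : Fam k V U)) fun X hX => ?_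
  rw [List.length_eq_zero_iff.mp hX, Fam.ev_bullet_letters]
  rw [partSum_nil, List.map_nil, Fam.ev_nil hf, List.map_nil, Fam.ev_nil rfl]

theorem Fam.insert_zero_arity (f : Fam k W' U) (g h : Fam k V W') : Fam.insert f g h 0 = 0 := by
  refine Fam.apply_ext (g := (0 : Fam k V U)) fun X hX => ?_
  rw [List.length_eq_zero_iff.mp hX, Fam.ev_insert_letters]
  rfl

theorem Fam.bullet_injective (hM : ∀ x : Fin 1 → W', M 1 x = x 0) {χ χ' : Fam k V W'}
    (h0 : χ 0 = χ' 0) (h : Fam.bullet M χ = Fam.bullet M χ') : χ = χ' := by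
  funext n
  induction n using Nat.strong_induction_on with
  | _ n ih =>
    rcases eq_or_ne n 0 with rfl | hn
    · exact h0
    have h1 := congrFun h n
    rw [Fam.bullet_triangular hM χ hn, Fam.bullet_triangular hM χ' hn, Fam.trunc_congr ih] at h1
    exact add_right_cancel h1

theorem Fam.insert_injective (hM : ∀ x : Fin 1 → W', M 1 x = x 0) {g h h' : Fam k V W'}
    (h0 : h 0 = h' 0) (he : Fam.insert M g h = Fam.insert M g h') : h = h' := by
  funext n
  induction n using Nat.strong_induction_on with
  | _ n ih =>
    rcases eq_or_ne n 0 with rfl | hn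
    · exact h0
    have h1 := congrFun he n
    rw [Fam.insert_triangular hM g h hn, Fam.insert_triangular hM g h' hn,
      Fam.trunc_congr ih] at h1
    exact add_right_cancel h1

theorem Fam.insertEven_injective (hM : ∀ x : Fin 1 → W', M 1 x = x 0) {g h h' : Fam k V W'}
    (h0 : h 0 = h' 0) (he : Fam.insertEven M g h = Fam.insertEven M g h') : h = h' := by
  funext n
  induction n using Nat.strong_induction_on with
  | _ n ih =>
    rcases eq_or_ne n 0 with rfl | hn
    · exact h0
    have h1 := congrFun he n
    rw [Fam.insertEven_triangular hM g h hn, Fam.insertEven_triangular hM g h' hn,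
      Fam.trunc_congr ih] at h1
    exact add_right_cancel h1

/-- `χ` solves the equation `M • χ = F` recursively. -/
def Fam.IsBulletSolution (M : Fam k W' W') (F χ : Fam k V W') : Prop :=
  ∀ n, χ n = F n - Fam.bullet M (χ.trunc n) n

/-- `η` solves the equation `insert M g η = F` recursively. -/
def Fam.IsInsertSolution (M : Fam k W' W') (g F η : Fam k V W') : Prop :=
  ∀ n, η n = F n - Fam.insert M g (η.trunc n) n

theorem Fam.IsBulletSolution.zero {F χ : Fam k V W'} (h : Fam.IsBulletSolution M F χ)
    (hM0 : M 0 = 0) (hF : F 0 = 0) : χ 0 = 0 := by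
  rw [h 0, hF, Fam.bullet_zero_arity _ _ hM0, sub_zero]

theorem Fam.IsInsertSolution.zero {g F η : Fam k V W'} (h : Fam.IsInsertSolution M g F η)
    (hF : F 0 = 0) : η 0 = 0 := by
  rw [h 0, hF, Fam.insert_zero_arity, sub_zero]

theorem Fam.IsBulletSolution.bullet_eq {F χ : Fam k V W'} (h : Fam.IsBulletSolution M F χ)
    (hM0 : M 0 = 0) (hM : ∀ x : Fin 1 → W', M 1 x = x 0) (hF : F 0 = 0) :
    Fam.bullet M χ = F := by
  funext n
  rcases eq_or_ne n 0 with rfl | hn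
  · rw [Fam.bullet_zero_arity _ _ hM0, hF]
  · rw [Fam.bullet_triangular hM χ hn, h n, sub_add_cancel]

theorem Fam.IsInsertSolution.insert_eq {g F η : Fam k V W'} (h : Fam.IsInsertSolution M g F η)
    (hM : ∀ x : Fin 1 → W', M 1 x = x 0) (hF : F 0 = 0) : Fam.insert M g η = F := by
  funext n
  rcases eq_or_ne n 0 with rfl | hn
  · rw [Fam.insert_zero_arity, hF]
  · rw [Fam.insert_triangular hM g η hn, h n, sub_add_cancel]

/-- The solution of `M • χ = F`. -/
noncomputable def Fam.solveBullet (M : Fam k W' W') (F : Fam k V W') :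
    (n : ℕ) → MultilinearMap k (fun _ : Fin n => V.carrier) W'
  | n => F n - Fam.bullet M (fun m => if m < n then Fam.solveBullet M F m else 0) n
termination_by n => n

/-- The solution of `insert M g η = F`. -/
noncomputable def Fam.solveInsert (M : Fam k W' W') (g F : Fam k V W') :
    (n : ℕ) → MultilinearMap k (fun _ : Fin n => V.carrier) W'
  | n => F n - Fam.insert M g (fun m => if m < n then Fam.solveInsert M g F m else 0) n
termination_by n => n

theorem Fam.solveBullet_isBulletSolution (M : Fam k W' W') (F : Fam k V W') :
    Fam.IsBulletSolution M F (Fam.solveBullet M F) := fun n => by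
  conv_lhs => rw [Fam.solveBullet]
  rfl

theorem Fam.solveInsert_isInsertSolution (M : Fam k W' W') (g F : Fam k V W') :
    Fam.IsInsertSolution M g F (Fam.solveInsert M g F) := fun n => by
  conv_lhs => rw [Fam.solveInsert]
  rfl

theorem IsSymFam.trunc {p : ℤ} {n : ℕ} {f : Fam k V W}
    (h : ∀ m < n, IsSymAt V W p m (f m)) (h0 : f 0 = 0) : IsSymFam V W p (f.trunc n) := by
  refine ⟨?_, fun m => ?_⟩
  · unfold Fam.trunc
    split_ifs
    · exact h0
    · rfl
  · change IsSymAt V W p m (f.trunc n m)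
    unfold Fam.trunc
    split_ifs with hm
    · exact h m hm
    · exact IsSymAt.zero

theorem Fam.IsBulletSolution.isSymFam {M : Fam k W W} {F χ : Fam k V W}
    (h : Fam.IsBulletSolution M F χ) (hM : IsSymFam W W 0 M) (hF : IsSymFam V W 0 F) :
    IsSymFam V W 0 χ := by
  refine ⟨h.zero hM.1 hF.1, fun n => ?_⟩
  change IsSymAt V W 0 n (χ n)
  induction n using Nat.strong_induction_on with
  | _ n ih =>
    rw [h n]
    exact IsSymAt.sub (hF.2 n)
      ((hM.bullet (IsSymFam.trunc ih (h.zero hM.1 hF.1))).2 n)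

theorem Fam.IsInsertSolution.isSymFam {q : ℤ} (hq : Odd q) {M : Fam k W W} {g F η : Fam k V W}
    (h : Fam.IsInsertSolution M g F η) (hM : IsSymFam W W 0 M) (hg : IsSymFam V W 0 g)
    (hF : IsSymFam V W q F) : IsSymFam V W q η := by
  refine ⟨h.zero hF.1, fun n => ?_⟩
  change IsSymAt V W q n (η n)
  induction n using Nat.strong_induction_on with
  | _ n ih =>
    rw [h n]
    have h1 := hM.insert hq hg (IsSymFam.trunc ih (h.zero hF.1))
    rw [zero_add] at h1
    exact IsSymAt.sub (hF.2 n) (h1.2 n)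

end Families

/-! ### Behaviour of families at the unit. -/

section Units

variable {k : Type u} [Field k] {V : PtGr.{u, v} k} {W : PtGr.{u, w} k}
  {U : Type*} [AddCommGroup U] [Module k U]

theorem List.ofFn_snoc_eq {α : Type*} {n : ℕ} (x : Fin n → α) (a : α) :
    List.ofFn (Fin.snoc (α := fun _ => α) x a) = List.ofFn x ++ [a] := by
  rw [List.ofFn_succ', List.concat_eq_append]
  simp

/-- The unit as a letter. -/
def PtGr.oneLetter (V : PtGr.{u, v} k) : V.Letter := ⟨0, V.one, V.one_mem⟩

theorem Fam.ev_append_one_of_snoc {P : ℕ → Prop} {F G : Fam k V U}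
    (h : ∀ n, P n → ∀ x : Fin n → V, F (n + 1) (Fin.snoc (α := fun _ => V.carrier) x V.one) =
      G n x) (l : List V) (hl : P l.length) : F.ev (l ++ [V.one]) = G.ev l := by
  obtain ⟨n, x, rfl⟩ : ∃ (n : ℕ) (x : Fin n → V), l = List.ofFn x :=
    ⟨_, _, (List.ofFn_get l).symm⟩
  rw [List.length_ofFn] at hl
  rw [← List.ofFn_snoc_eq, Fam.ev_ofFn, Fam.ev_ofFn, h n hl]

theorem Fam.snoc_of_ev_append_one {P : ℕ → Prop} {F G : Fam k V U}
    (h : ∀ X : List V.Letter, P X.length →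
      F.ev (X.map PtGr.Letter.val ++ [V.one]) = G.ev (X.map PtGr.Letter.val)) (n : ℕ) (hn : P n)
    (x : Fin n → V) : F (n + 1) (Fin.snoc (α := fun _ => V.carrier) x V.one) = G n x := by
  -- With the unit fixed in the last slot both sides are multilinear in the other arguments, so
  -- homogeneous arguments suffice.
  have key : (LinearMap.applyₗ V.one).compMultilinearMap (F (n + 1)).curryRight = G n := by
    refine Fam.multilinear_ext fun x => ?_
    have := h (List.ofFn x) (by simpa using hn)
    rw [Fam.ev_map_ofFn, List.map_ofFn, ← List.ofFn_snoc_eq, Fam.ev_ofFn] at this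
    exact this
  exact DFunLike.congr_fun key x

/-- Appending the unit to a nonempty word does not change the value. -/
def Fam.AbsorbsUnit (f : Fam k V U) : Prop :=
  ∀ l : List V, l ≠ [] → f.ev (l ++ [V.one]) = f.ev l

/-- The value vanishes at words of at least two letters that end with the unit. -/
def Fam.KillsUnit (f : Fam k V U) : Prop :=
  ∀ l : List V, l ≠ [] → f.ev (l ++ [V.one]) = 0

theorem Fam.absorbsUnit_of_letters {f : Fam k V U} (h : ∀ X : List V.Letter, X ≠ [] →
    f.ev (X.map PtGr.Letter.val ++ [V.one]) = f.ev (X.map PtGr.Letter.val)) : f.AbsorbsUnit :=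
  fun l hl => Fam.ev_append_one_of_snoc (P := fun n => n ≠ 0)
    (Fam.snoc_of_ev_append_one fun X hX => h X fun h0 => hX (by simp [h0])) l
    fun h0 => hl (List.length_eq_zero_iff.mp h0)

theorem Fam.killsUnit_of_letters {f : Fam k V U} (h : ∀ X : List V.Letter, X ≠ [] →
    f.ev (X.map PtGr.Letter.val ++ [V.one]) = 0) : f.KillsUnit :=
  fun l hl => Fam.ev_append_one_of_snoc (P := fun n => n ≠ 0) (G := 0)
    (Fam.snoc_of_ev_append_one (G := 0) fun X hX => h X fun h0 => hX (by simp [h0])) l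
    fun h0 => hl (List.length_eq_zero_iff.mp h0)

theorem Fam.absorbsUnit_iff {f : Fam k V U} : f.AbsorbsUnit ↔ ∀ n, 1 ≤ n → ∀ x : Fin n → V,
    f (n + 1) (Fin.snoc (α := fun _ => V.carrier) x V.one) = f n x := by
  constructor
  · intro h n hn x
    rw [← Fam.ev_ofFn, List.ofFn_snoc_eq, h _ (by simp; omega), Fam.ev_ofFn]
  · exact fun h l hl => Fam.ev_append_one_of_snoc h l (List.length_pos_iff.mpr hl)

theorem Fam.killsUnit_iff {f : Fam k V U} : f.KillsUnit ↔ ∀ n, 1 ≤ n → ∀ x : Fin n → V,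
    f (n + 1) (Fin.snoc (α := fun _ => V.carrier) x V.one) = 0 := by
  constructor
  · intro h n hn x
    rw [← Fam.ev_ofFn, List.ofFn_snoc_eq, h _ (by simp; omega)]
  · exact fun h l hl => Fam.ev_append_one_of_snoc (G := 0) h l (List.length_pos_iff.mpr hl)

theorem Fam.killsUnit_and_iff {f : Fam k V U} : (f.KillsUnit ∧ f.ev [V.one] = 0) ↔
    ∀ n, ∀ x : Fin n → V, f (n + 1) (Fin.snoc (α := fun _ => V.carrier) x V.one) = 0 := by
  rw [Fam.killsUnit_iff]
  constructor
  · rintro ⟨h1, h2⟩ n x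
    rcases Nat.eq_zero_or_pos n with rfl | hn
    · rw [← Fam.ev_ofFn, List.ofFn_snoc_eq, List.ofFn_zero, List.nil_append, h2]
    · exact h1 n hn x
  · intro h
    refine ⟨fun n _ x => h n x, ?_⟩
    have := h 0 Fin.elim0
    rwa [← Fam.ev_ofFn, List.ofFn_snoc_eq, List.ofFn_zero, List.nil_append] at this

theorem Fam.ev_one_singleton (f : Fam k V U) (x : V) : f.ev [x] = f 1 (fun _ => x) :=
  f.ev_eq _ _ (by simp)

theorem Fam.id_killsUnit : (Fam.id k V).KillsUnit := fun l hl =>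
  Fam.ev_id_of_length_ne (by simpa using hl)

theorem map_val_append_one (X : List V.Letter) :
    X.map PtGr.Letter.val ++ [V.one] = (X ++ [V.oneLetter]).map PtGr.Letter.val := by
  simp [PtGr.oneLetter]

/-- Since `g` kills the unit, only partitions in which the unit is a block by itself survive. That
last block contributes `g(1) = 1`, which `f` absorbs. -/
theorem Fam.ev_bullet_append_one {f : Fam k W U} {g : Fam k V W} (hf : f.AbsorbsUnit)
    (hg1 : g.ev [V.one] = W.one) (hg : g.KillsUnit) {X : List V.Letter} (hX : X ≠ []) :
    (Fam.bullet f g).ev (X.map PtGr.Letter.val ++ [V.one]) =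
      (Fam.bullet f g).ev (X.map PtGr.Letter.val) := by
  rw [map_val_append_one, Fam.ev_bullet_letters, Fam.ev_bullet_letters, partSum_append_singleton]
  · refine partSum_congr _ _ _ _ fun Bs hBs => ?_
    have hBs0 : Bs ≠ [] := by rintro rfl; exact hX hBs.eq_nil
    simp only [List.map_append, List.map_cons, List.map_nil]
    rw [show PtGr.Letter.val V.oneLetter = V.one from rfl, hg1, hf _ (by simpa using hBs0)]
  · intro As B Bs hB
    refine f.ev_isMultiadditive.eq_zero (List.mem_map.mpr ⟨B ++ [V.oneLetter], by simp, ?_⟩)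
    rw [← map_val_append_one, hg _ (by simpa using hB)]

theorem markSum_eq_zero_of_mem {Y W U : Type*} [AddCommGroup W] [AddCommGroup U]
    (q : Y → ZMod 2) (e : ZMod 2) (g h : Y → W) {F : List W → U}
    (hF : IsMultiadditive F) {y : Y} {ys : List Y} (hy : y ∈ ys) (hgy : g y = 0) (hhy : h y = 0) :
    markSum q e g h F ys = 0 := by
  induction ys generalizing F with
  | nil => rfl
  | cons z ys ih =>
    rw [markSum_cons]
    rcases List.mem_cons.mp hy with rfl | hy
    · have : (fun l => F (g y :: l)) = fun _ => 0 := funext fun l => hF.eq_zero (by simp [hgy])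
      rw [hF.eq_zero (by simp [hhy]), this, markSum_zero, smul_zero, add_zero]
    · rw [ih (hF.cons _) hy, hF.eq_zero (List.mem_cons_of_mem _ (List.mem_map.mpr ⟨y, hy, hgy⟩)),
        smul_zero, add_zero]

theorem markSum_congr_of_ne_nil {Y Y' U : Type*} [AddCommGroup U] (q : Y → ZMod 2) (e : ZMod 2)
    (g h : Y → Y') {F F' : List Y' → U} (hF : ∀ l, l ≠ [] → F l = F' l) (ys : List Y) :
    markSum q e g h F ys = markSum q e g h F' ys := by
  induction ys generalizing F F' with
  | nil => rfl
  | cons y ys ih =>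
    rw [markSum_cons, markSum_cons, hF _ (List.cons_ne_nil _ _), ih fun l _ =>
      hF _ (List.cons_ne_nil _ _)]

/-- As for the composition. In addition the block formed by the unit cannot carry `h`, as `h(1) =
0`. The word `X` may be empty, both sides being zero then. -/
theorem Fam.ev_insert_append_one {f : Fam k W U} {g h : Fam k V W} (hf : f.AbsorbsUnit)
    (hg1 : g.ev [V.one] = W.one) (hg : g.KillsUnit) (hh1 : h.ev [V.one] = 0) (hh : h.KillsUnit)
    (X : List V.Letter) :
    (Fam.insert f g h).ev (X.map PtGr.Letter.val ++ [V.one]) =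
      (Fam.insert f g h).ev (X.map PtGr.Letter.val) := by
  rw [map_val_append_one, Fam.ev_insert_letters, Fam.ev_insert_letters, partSum_append_singleton]
  · congr 1
    funext Bs
    rw [markSum_append_singleton, f.ev_isMultiadditive.eq_zero, smul_zero, add_zero]
    · refine markSum_congr_of_ne_nil _ _ _ _ (fun l hl => ?_) _
      exact (congrArg (fun x => f.ev (l ++ [x])) hg1).trans (hf l hl)
    · simp [PtGr.oneLetter, hh1]
  · intro As B Bs hB
    refine markSum_eq_zero_of_mem _ _ _ _ f.ev_isMultiadditive (y := B ++ [V.oneLetter])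
      (by simp) ?_ ?_
    · rw [← map_val_append_one, hg _ (by simpa using hB)]
    · rw [← map_val_append_one, hh _ (by simpa using hB)]

variable {M : Fam k W W}

theorem Fam.trunc_killsUnit {f : Fam k V U} {n : ℕ}
    (h : ∀ X : List V.Letter, X ≠ [] → X.length + 1 < n →
      f.ev (X.map PtGr.Letter.val ++ [V.one]) = 0) : (f.trunc n).KillsUnit := by
  refine Fam.killsUnit_of_letters fun X hX => ?_
  rw [Fam.ev_trunc]
  split_ifs with hn
  · exact h X hX (by simpa using hn)
  · rfl

/-- Induction on the length. The truncation of `χ` below the arity in question kills the unit, so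
`M` composed with it takes equal values at `X·1` and `X`. As `F` does too, the remaining term
`χ(X·1)` of the triangular equation is zero. -/
theorem Fam.killsUnit_of_bullet (hM1 : ∀ x : Fin 1 → W, M 1 x = x 0) (hM : M.AbsorbsUnit)
    {F χ : Fam k V W} (he : Fam.bullet M χ = F) (hF : F.AbsorbsUnit) (hF1 : F.ev [V.one] = W.one) :
    χ.ev [V.one] = W.one ∧ χ.KillsUnit := by
  have h1 : χ.ev [V.one] = W.one := by
    rw [← hF1, ← he]
    have := Fam.ev_bullet_letters M χ [V.oneLetter]
    rw [partSum_singleton] at this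
    exact (Fam.ev_singleton_of_apply_one hM1 _).symm.trans this.symm
  refine ⟨h1, Fam.killsUnit_of_letters fun X hX => ?_⟩
  induction hn : X.length using Nat.strong_induction_on generalizing X with
  | _ n ih =>
    have hn0 : X.length ≠ 0 := fun h => hX (List.length_eq_zero_iff.mp h)
    have e1 : F.ev (X.map PtGr.Letter.val ++ [V.one]) = χ.ev (X.map PtGr.Letter.val ++ [V.one]) +
        (Fam.bullet M (χ.trunc (n + 1))).ev (X.map PtGr.Letter.val ++ [V.one]) := by
      rw [← he]
      have hl : (X.map PtGr.Letter.val ++ [V.one]).length = n + 1 := by simp [hn]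
      have := DFunLike.congr_fun (Fam.bullet_triangular hM1 χ (n := n + 1) (by simp))
      generalize X.map PtGr.Letter.val ++ [V.one] = l at hl ⊢
      rw [← hl] at this ⊢
      exact this _
    rw [hF _ (by simpa using hX), Fam.ev_bullet_append_one hM ?_ ?_ hX, ← he] at e1
    -- The truncation keeps the arities up to `n`. It removes the top member at `X·1`, of length `n
    -- + 1`, but changes nothing at `X`, of length `n`.
    · have e2 : (Fam.bullet M χ).ev (X.map PtGr.Letter.val) =
          (Fam.bullet M (χ.trunc (n + 1))).ev (X.map PtGr.Letter.val) := by
        rw [Fam.ev_bullet_letters, Fam.ev_bullet_letters]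
        refine partSum_congr _ _ _ _ fun Bs hBs => ?_
        congr 1
        refine List.map_congr_left fun B hB => ?_
        rw [Fam.ev_trunc, if_pos]
        have := hBs.length_le hB
        simp only [List.length_map]
        omega
      rw [e2] at e1
      simpa using e1
    · rw [Fam.ev_trunc, if_pos (by simp; omega), h1]
    · exact Fam.trunc_killsUnit fun Y hY hl => ih Y.length (by omega) Y hY rfl

/-- The same induction with the insertion in place of the composition. -/
theorem Fam.killsUnit_of_insert (hM1 : ∀ x : Fin 1 → W, M 1 x = x 0) (hM : M.AbsorbsUnit)
    {F g η : Fam k V W} (he : Fam.insert M g η = F) (hg1 : g.ev [V.one] = W.one)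
    (hg : g.KillsUnit) (hF : F.AbsorbsUnit) (hF1 : F.ev [V.one] = 0) :
    η.ev [V.one] = 0 ∧ η.KillsUnit := by
  have h1 : η.ev [V.one] = 0 := by
    rw [← hF1, ← he]
    have := Fam.ev_insert_letters M g η [V.oneLetter]
    rw [partSum_singleton, markSum_cons, markSum_nil, smul_zero, add_zero] at this
    exact (Fam.ev_singleton_of_apply_one hM1 _).symm.trans this.symm
  refine ⟨h1, Fam.killsUnit_of_letters fun X hX => ?_⟩
  induction hn : X.length using Nat.strong_induction_on generalizing X with
  | _ n ih =>
    have hn0 : X.length ≠ 0 := fun h => hX (List.length_eq_zero_iff.mp h)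
    have e1 : F.ev (X.map PtGr.Letter.val ++ [V.one]) = η.ev (X.map PtGr.Letter.val ++ [V.one]) +
        (Fam.insert M g (η.trunc (n + 1))).ev (X.map PtGr.Letter.val ++ [V.one]) := by
      rw [← he]
      have hl : (X.map PtGr.Letter.val ++ [V.one]).length = n + 1 := by simp [hn]
      have := DFunLike.congr_fun (Fam.insert_triangular hM1 g η (n := n + 1) (by simp))
      generalize X.map PtGr.Letter.val ++ [V.one] = l at hl ⊢
      rw [← hl] at this ⊢
      exact this _
    rw [hF _ (by simpa using hX), Fam.ev_insert_append_one hM hg1 hg ?_ ?_, ← he] at e1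
    · have e2 : (Fam.insert M g η).ev (X.map PtGr.Letter.val) =
          (Fam.insert M g (η.trunc (n + 1))).ev (X.map PtGr.Letter.val) := by
        rw [Fam.ev_insert_letters, Fam.ev_insert_letters]
        refine partSum_congr _ _ _ _ fun Bs hBs => ?_
        refine markSum_congr _ _ _ (fun _ _ => rfl) fun B hB => ?_
        rw [Fam.ev_trunc, if_pos]
        have := hBs.length_le hB
        simp only [List.length_map]
        omega
      rw [e2] at e1
      simpa using e1
    · rw [Fam.ev_trunc]
      split_ifs
      · exact h1
      · rfl
    · exact Fam.trunc_killsUnit fun Y hY hl => ih Y.length (by omega) Y hY rfl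

end Units

/-! ### Polynomial dependence on a parameter -/

section Polynomial

variable {k : Type u} [Field k] {E F G : Type*} [AddCommGroup E] [Module k E] [AddCommGroup F]
  [Module k F] [AddCommGroup G] [Module k G]

/-- `u` is a polynomial function of the parameter with derivative `u'`. -/
def HasPolyDeriv (u u' : k → E) : Prop :=
  ∃ p : ℕ →₀ E, (∀ t, u t = p.sum fun j a => t ^ j • a) ∧
    ∀ t, u' t = p.sum fun j a => ((j : k) * t ^ (j - 1)) • a

theorem HasPolyDeriv.add {u u' v v' : k → E} (hu : HasPolyDeriv u u') (hv : HasPolyDeriv v v') :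
    HasPolyDeriv (fun t => u t + v t) (fun t => u' t + v' t) := by
  obtain ⟨p, h1, h2⟩ := hu
  obtain ⟨q, h3, h4⟩ := hv
  refine ⟨p + q, fun t => ?_, fun t => ?_⟩
  · simp only [h1, h3]
    exact (Finsupp.sum_add_index' (by simp) (by simp)).symm
  · simp only [h2, h4]
    exact (Finsupp.sum_add_index' (by simp) (by simp)).symm

theorem HasPolyDeriv.zero : HasPolyDeriv (fun _ : k => (0 : E)) fun _ => 0 :=
  ⟨0, by simp, by simp⟩

theorem HasPolyDeriv.sum {ι : Type*} {s : Finset ι} {u u' : ι → k → E}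
    (h : ∀ i ∈ s, HasPolyDeriv (u i) (u' i)) :
    HasPolyDeriv (fun t => ∑ i ∈ s, u i t) (fun t => ∑ i ∈ s, u' i t) := by
  classical
  induction s using Finset.induction_on with
  | empty => simpa using HasPolyDeriv.zero
  | insert i s hi ih =>
    simp only [Finset.sum_insert hi]
    exact (h i (by simp)).add (ih fun j hj => h j (by simp [hj]))

theorem HasPolyDeriv.monomial (j : ℕ) (a : E) :
    HasPolyDeriv (fun t : k => t ^ j • a) fun t => ((j : k) * t ^ (j - 1)) • a :=
  ⟨Finsupp.single j a, by simp, by simp⟩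

theorem HasPolyDeriv.const (a : E) : HasPolyDeriv (fun _ : k => a) fun _ => 0 := by
  simpa using HasPolyDeriv.monomial (k := k) 0 a

theorem HasPolyDeriv.linear (a : E) : HasPolyDeriv (fun t : k => t • a) fun _ => a := by
  simpa using HasPolyDeriv.monomial (k := k) 1 a

/-- The product rule for the evaluation of linear maps. -/
theorem HasPolyDeriv.app {L L' : k → E →ₗ[k] F} {u u' : k → E} (hL : HasPolyDeriv L L')
    (hu : HasPolyDeriv u u') :
    HasPolyDeriv (fun t => L t (u t)) fun t => L' t (u t) + L t (u' t) := by
  obtain ⟨p, h1, h2⟩ := hL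
  obtain ⟨q, h3, h4⟩ := hu
  have key : HasPolyDeriv (fun t : k => ∑ i ∈ p.support, ∑ j ∈ q.support, t ^ (i + j) • p i (q j))
      fun t => ∑ i ∈ p.support, ∑ j ∈ q.support,
        (((i + j : ℕ) : k) * t ^ (i + j - 1)) • p i (q j) :=
    HasPolyDeriv.sum fun i _ => HasPolyDeriv.sum fun j _ => HasPolyDeriv.monomial _ _
  convert key using 1
  · funext t
    simp only [h1, h3, Finsupp.sum, LinearMap.sum_apply, map_sum, LinearMap.smul_apply, map_smul]
    simp only [Finset.smul_sum, smul_smul, pow_add]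
    rw [Finset.sum_comm]
    exact Finset.sum_congr rfl fun i _ => Finset.sum_congr rfl fun j _ => by rw [mul_comm]
  · funext t
    simp only [h1, h2, h3, h4, Finsupp.sum, LinearMap.sum_apply, map_sum, LinearMap.smul_apply,
      map_smul]
    simp only [Finset.smul_sum, smul_smul, ← Finset.sum_add_distrib, ← add_smul]
    rw [Finset.sum_comm]
    refine Finset.sum_congr rfl fun i _ => Finset.sum_congr rfl fun j _ => ?_
    congr 1
    -- The exponents `i - 1` and `j - 1` are truncated at zero, exactly where the coefficients `i`
    -- and `j` vanish.
    rcases i with _ | i <;> rcases j with _ | j <;> simp [pow_add] <;> ring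

theorem HasPolyDeriv.map {u u' : k → E} (hu : HasPolyDeriv u u') (L : E →ₗ[k] F) :
    HasPolyDeriv (fun t => L (u t)) fun t => L (u' t) := by
  simpa using (HasPolyDeriv.const (k := k) L).app hu

theorem HasPolyDeriv.neg {u u' : k → E} (hu : HasPolyDeriv u u') :
    HasPolyDeriv (fun t => -u t) fun t => -u' t :=
  hu.map (-LinearMap.id)

theorem HasPolyDeriv.sub {u u' v v' : k → E} (hu : HasPolyDeriv u u') (hv : HasPolyDeriv v v') :
    HasPolyDeriv (fun t => u t - v t) (fun t => u' t - v' t) := by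
  simpa only [sub_eq_add_neg] using hu.add hv.neg

/-- The product rule for the evaluation of multilinear maps. -/
theorem HasPolyDeriv.multilinear {n : ℕ} {E : Fin n → Type*} [∀ i, AddCommGroup (E i)]
    [∀ i, Module k (E i)] {B B' : k → MultilinearMap k E F} {u u' : k → ∀ i, E i}
    (hB : HasPolyDeriv B B') (hu : ∀ i, HasPolyDeriv (fun t => u t i) fun t => u' t i) :
    HasPolyDeriv (fun t => B t (u t)) fun t =>
      B' t (u t) + ∑ i, B t (Function.update (u t) i (u' t i)) := by
  induction n with
  | zero =>
    have h := hB.map (MultilinearMap.constLinearEquivOfIsEmpty (R := k) (S := k) (M₁ := E)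
      (M₂ := F)).symm.toLinearMap
    convert h using 1
    · funext t
      exact congrArg (B t) (Subsingleton.elim _ _)
    · funext t
      rw [Finset.univ_eq_empty, Finset.sum_empty, add_zero]
      exact congrArg (B' t) (Subsingleton.elim _ _)
  | succ n ih =>
    have h1 := (hB.map (multilinearCurryLeftEquiv k E F).toLinearMap).app (hu 0)
    have h2 := ih h1 (u := fun t i => u t i.succ) (u' := fun t i => u' t i.succ) fun i => hu _
    convert h2 using 1
    · funext t
      exact congrArg (B t) (Fin.cons_self_tail (u t)).symm
    · funext t
      rw [Fin.sum_univ_succ, ← add_assoc]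
      congr 1
      · congr 1
        · exact congrArg (B' t) (Fin.cons_self_tail (u t)).symm
        · refine congrArg (B t) ?_
          conv_lhs => rw [← Fin.cons_self_tail (u t), Fin.update_cons_zero]
          rfl
      · refine Finset.sum_congr rfl fun i _ => congrArg (B t) ?_
        conv_lhs => rw [← Fin.cons_self_tail (u t), ← Fin.cons_update]
        rfl

theorem HasPolyDeriv.exists_polynomial {u u' : k → k} (h : HasPolyDeriv u u') :
    ∃ P : Polynomial k, (∀ t, u t = P.eval t) ∧ ∀ t, u' t = (Polynomial.derivative P).eval t := by
  obtain ⟨p, h1, h2⟩ := h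
  refine ⟨p.sum fun j a => Polynomial.monomial j a, fun t => ?_, fun t => ?_⟩
  · simp [h1, Finsupp.sum, Polynomial.eval_finsetSum, mul_comm]
  · simp [h2, Finsupp.sum, Polynomial.eval_finsetSum, Polynomial.derivative_monomial]
    refine Finset.sum_congr rfl fun j _ => by ring

variable [CharZero k]

/-- Linear functionals separate points and reduce the claim to scalar polynomials. In characteristic
zero a polynomial function determines its polynomial, and a polynomial with zero derivative is
constant. -/
theorem HasPolyDeriv.eq_of_deriv_zero {u : k → E} (h : HasPolyDeriv u fun _ => 0) (t s : k) :
    u t = u s := by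
  rw [← sub_eq_zero, ← Module.forall_dual_apply_eq_zero_iff k]
  intro φ
  obtain ⟨P, h1, h2⟩ := (h.map φ).exists_polynomial
  have hP : Polynomial.derivative P = 0 := Polynomial.funext fun t => by simp [← h2]
  rw [map_sub, h1, h1, Polynomial.eq_C_of_derivative_eq_zero hP]
  simp

theorem HasPolyDeriv.unique {u u' u'' : k → E} (h : HasPolyDeriv u u') (h' : HasPolyDeriv u u'') :
    u' = u'' := by
  funext t
  rw [← sub_eq_zero, ← Module.forall_dual_apply_eq_zero_iff k]
  intro φ
  obtain ⟨P, h1, h2⟩ := ((h.sub h').map φ).exists_polynomial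
  have hP : P = 0 := Polynomial.funext fun t => by simp [← h1]
  rw [h2 t, hP]
  simp

end Polynomial

/-! ### Families that depend polynomially on a parameter. -/

section PolynomialFamilies

variable {k : Type u} [Field k] {V : PtGr.{u, v} k} {W U : Type*} [AddCommGroup W] [Module k W]
  [AddCommGroup U] [Module k U]

theorem update_blocks {n : ℕ} (π : OrderedFinpartition n) [DecidableEq (Fin π.length)]
    (g : ∀ i : Fin π.length, MultilinearMap k (fun _ : Fin (π.partSize i) => V.carrier) W)
    (i : Fin π.length) (c : MultilinearMap k (fun _ : Fin (π.partSize i) => V.carrier) W)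
    (x : Fin n → V) :
    (fun j => Function.update g i c j fun a => x (π.emb j a)) =
      Function.update (fun j => g j fun a => x (π.emb j a)) i (c fun a => x (π.emb i a)) := by
  funext j
  rcases eq_or_ne j i with rfl | hj <;> simp [*]

/-- `blockComp` as a multilinear function of the inner maps. -/
noncomputable def blockCompMultilinear {n : ℕ} (π : OrderedFinpartition n)
    (f : MultilinearMap k (fun _ : Fin π.length => W) U) :
    MultilinearMap k
      (fun i : Fin π.length => MultilinearMap k (fun _ : Fin (π.partSize i) => V.carrier) W)
      (MultilinearMap k (fun _ : Fin n => V.carrier) U) where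
  toFun := blockComp π f
  map_update_add' {_} g i a b := by
    refine MultilinearMap.ext fun x => ?_
    refine (congrArg f (update_blocks π g i (a + b) x)).trans ((f.map_update_add _ _ _ _).trans ?_)
    exact congrArg₂ (· + ·) (congrArg f (update_blocks π g i a x).symm)
      (congrArg f (update_blocks π g i b x).symm)
  map_update_smul' {_} g i c a := by
    refine MultilinearMap.ext fun x => ?_
    refine (congrArg f (update_blocks π g i (c • a) x)).trans ((f.map_update_smul _ _ _ _).trans ?_)
    exact congrArg (c • ·) (congrArg f (update_blocks π g i a x).symm)

theorem PtGr.exists_signed_linear {n : ℕ} (s : (Fin n → ZMod 2) → ℤˣ) :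
    ∃ Φ : MultilinearMap k (fun _ : Fin n => V.carrier) U →ₗ[k]
      MultilinearMap k (fun _ : Fin n => V.carrier) U, ∀ L, V.signed s L = Φ L :=
  ⟨∑ p : Fin n → ZMod 2, (s p : ℤ) • MultilinearMap.compLinearMapₗ fun i => V.parityProj (p i),
    fun L => by simp [PtGr.signed]⟩

/-- A family depends polynomially on the parameter. -/
def Fam.HasDeriv (Φ Φ' : k → Fam k V W) : Prop :=
  ∀ n, HasPolyDeriv (fun t => Φ t n) fun t => Φ' t n

/-- The product rule replaces one inner factor by its derivative, which has the same degree. Nothing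
odd is moved, so the insertion without passing signs appears. -/
theorem Fam.HasDeriv.bullet {Φ Φ' : k → Fam k V W} (h : Fam.HasDeriv Φ Φ')
    (f : Fam k W U) :
    Fam.HasDeriv (fun t => Fam.bullet f (Φ t)) fun t => Fam.insertEven f (Φ t) (Φ' t) := by
  intro n
  refine HasPolyDeriv.sum fun π _ => ?_
  obtain ⟨S, hS⟩ := PtGr.exists_signed_linear (V := V) (U := U) (partSign π)
  have := ((HasPolyDeriv.const (k := k) (blockCompMultilinear π (f π.length))).multilinear
    (u := fun t i => Φ t (π.partSize i)) (u' := fun t i => Φ' t (π.partSize i))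
    fun i => h _).map S
  convert this using 1
  · funext t
    rw [hS]
    rfl
  · funext t
    simp only [zero_apply, zero_add, map_sum, hS]
    refine Finset.sum_congr rfl fun i _ => ?_
    refine congrArg S (congrArg (blockComp π (f π.length)) ?_)
    funext j
    rcases eq_or_ne j i with rfl | hj <;> simp [*]

theorem Fam.HasDeriv.insert {Φ Φ' η η' : k → Fam k V W} (h : Fam.HasDeriv Φ Φ')
    (h' : Fam.HasDeriv η η') (f : Fam k W U) :
    ∃ Ψ, Fam.HasDeriv (fun t => Fam.insert f (Φ t) (η t)) Ψ := by
  have : ∀ n, ∃ u', HasPolyDeriv (fun t => Fam.insert f (Φ t) (η t) n) u' := by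
    intro n
    have key : ∀ (π : OrderedFinpartition n) (i : Fin π.length), ∃ u', HasPolyDeriv (fun t =>
        V.signed (partSignAt π i) (blockComp π (f π.length)
          (fun j => if j = i then η t (π.partSize j) else Φ t (π.partSize j)))) u' := by
      intro π i
      obtain ⟨S, hS⟩ := PtGr.exists_signed_linear (V := V) (U := U) (partSignAt π i)
      have := ((HasPolyDeriv.const (k := k)
        (blockCompMultilinear (V := V) π (f π.length))).multilinear
        (u := fun t j => if j = i then η t (π.partSize j) else Φ t (π.partSize j))
        (u' := fun t j => if j = i then η' t (π.partSize j) else Φ' t (π.partSize j))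
        fun j => by
          by_cases hj : j = i
          · simpa [hj] using h' _
          · simpa [hj] using h _).map S
      simp only [hS]
      exact ⟨_, this⟩
    choose u' hu' using key
    exact ⟨_, HasPolyDeriv.sum fun π _ => HasPolyDeriv.sum fun i _ => hu' π i⟩
  choose u' hu' using this
  exact ⟨fun t n => u' n t, hu'⟩

theorem Fam.HasDeriv.trunc {Φ : k → Fam k V W} {n : ℕ}
    (h : ∀ m < n, ∃ u', HasPolyDeriv (fun t => Φ t m) u') :
    ∃ Ψ, Fam.HasDeriv (fun t => (Φ t).trunc n) Ψ := by
  have : ∀ m, ∃ u', HasPolyDeriv (fun t => (Φ t).trunc n m) u' := by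
    intro m
    by_cases hm : m < n
    · simpa [Fam.trunc, hm] using h m hm
    · simpa [Fam.trunc, hm] using ⟨_, HasPolyDeriv.zero⟩
  choose u' hu' using this
  exact ⟨fun t n => u' n t, hu'⟩

/-- Each member is a polynomial expression in `F` and in members of lower arity. Only existence is
recorded; the derivative is identified later by differentiating the equation `M • Φ = F`. -/
theorem Fam.HasDeriv.of_isBulletSolution {M : Fam k W W} {F F' Φ : k → Fam k V W}
    (hF : Fam.HasDeriv F F') (h : ∀ t, Fam.IsBulletSolution M (F t) (Φ t)) :
    ∃ Φ', Fam.HasDeriv Φ Φ' := by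
  have : ∀ n, ∃ u', HasPolyDeriv (fun t => Φ t n) u' := by
    intro n
    induction n using Nat.strong_induction_on with
    | _ n ih =>
      obtain ⟨Ψ, hΨ⟩ := Fam.HasDeriv.trunc ih
      simp only [fun t => h t n]
      exact ⟨_, (hF n).sub (hΨ.bullet M n)⟩
  choose u' hu' using this
  exact ⟨fun t n => u' n t, hu'⟩

theorem Fam.HasDeriv.of_isInsertSolution {M : Fam k W W} {g g' F F' η : k → Fam k V W}
    (hg : Fam.HasDeriv g g') (hF : Fam.HasDeriv F F')
    (h : ∀ t, Fam.IsInsertSolution M (g t) (F t) (η t)) : ∃ η', Fam.HasDeriv η η' := by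
  have : ∀ n, ∃ u', HasPolyDeriv (fun t => η t n) u' := by
    intro n
    induction n using Nat.strong_induction_on with
    | _ n ih =>
      obtain ⟨Ψ, hΨ⟩ := Fam.HasDeriv.trunc ih
      obtain ⟨Ψ', hΨ'⟩ := hg.insert hΨ M
      simp only [fun t => h t n]
      exact ⟨_, (hF n).sub (hΨ' n)⟩
  choose u' hu' using this
  exact ⟨fun t n => u' n t, hu'⟩

theorem Fam.HasDeriv.exists_polyFam {Φ Φ' : k → Fam k V W} (h : Fam.HasDeriv Φ Φ') :
    ∃ P : PolyFam k V W, P.eval = Φ ∧ P.deriv = Φ' := by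
  choose p h1 h2 using h
  exact ⟨p, funext fun t => funext fun n => (h1 n t).symm,
    funext fun t => funext fun n => (h2 n t).symm⟩

theorem PolyFam.hasDeriv (P : PolyFam k V W) : Fam.HasDeriv P.eval P.deriv :=
  fun n => ⟨P n, fun _ => rfl, fun _ => rfl⟩

end PolynomialFamilies

/-! ### Closure properties of families -/

section Closure

variable {k : Type u} [Field k] {V : PtGr.{u, v} k} {W : PtGr.{u, w} k} {U : PtGr.{u, w'} k}
  {p q : ℤ} {f g : Fam k V W}

theorem IsSymFam.add (hf : IsSymFam V W p f) (hg : IsSymFam V W p g) : IsSymFam V W p (f + g) :=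
  ⟨by simp [hf.1, hg.1], fun n => IsSymAt.add (hf.2 n) (hg.2 n)⟩

theorem IsSymFam.sub (hf : IsSymFam V W p f) (hg : IsSymFam V W p g) : IsSymFam V W p (f - g) :=
  ⟨by simp [hf.1, hg.1], fun n => IsSymAt.sub (hf.2 n) (hg.2 n)⟩

theorem IsSymFam.smul (c : k) (hf : IsSymFam V W p f) : IsSymFam V W p (c • f) :=
  ⟨by simp [hf.1], fun n => IsSymAt.smul c (hf.2 n)⟩

theorem IsSymFam.post (hf : IsSymFam V W p f) {K : W →ₗ[k] U} (hK : HasDeg W U q K) :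
    IsSymFam V U (p + q) (Fam.post K f) :=
  ⟨by ext; simp [Fam.post, hf.1], fun n => IsSymAt.comp (hf.2 n) hK⟩

theorem IsSymFam.zero : IsSymFam V W p (0 : Fam k V W) := ⟨rfl, fun _ => IsSymAt.zero⟩

theorem Fam.AbsorbsUnit.add (hf : f.AbsorbsUnit) (hg : g.AbsorbsUnit) : (f + g).AbsorbsUnit :=
  fun l hl => by rw [Fam.ev_add, Fam.ev_add, hf l hl, hg l hl]

theorem Fam.AbsorbsUnit.sub (hf : f.AbsorbsUnit) (hg : g.AbsorbsUnit) : (f - g).AbsorbsUnit :=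
  fun l hl => by rw [Fam.ev_sub, Fam.ev_sub, hf l hl, hg l hl]

theorem Fam.AbsorbsUnit.smul (c : k) (hf : f.AbsorbsUnit) : (c • f).AbsorbsUnit :=
  fun l hl => by rw [Fam.ev_smul, Fam.ev_smul, hf l hl]

theorem Fam.AbsorbsUnit.post (hf : f.AbsorbsUnit) (K : W →ₗ[k] U) : (Fam.post K f).AbsorbsUnit :=
  fun l hl => by rw [Fam.ev_post, Fam.ev_post, hf l hl]

theorem Fam.AbsorbsUnit.zero : (0 : Fam k V W).AbsorbsUnit := fun _ _ => rfl

theorem Fam.bullet_absorbsUnit {M : Fam k W U} {g : Fam k V W} (hf : M.AbsorbsUnit)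
    (hg1 : g.ev [V.one] = W.one) (hg : g.KillsUnit) : (Fam.bullet M g).AbsorbsUnit :=
  Fam.absorbsUnit_of_letters fun _ hX => Fam.ev_bullet_append_one hf hg1 hg hX

theorem Fam.insert_absorbsUnit {f : Fam k W U} {g h : Fam k V W} (hf : f.AbsorbsUnit)
    (hg1 : g.ev [V.one] = W.one) (hg : g.KillsUnit) (hh1 : h.ev [V.one] = 0) (hh : h.KillsUnit) :
    (Fam.insert f g h).AbsorbsUnit :=
  Fam.absorbsUnit_of_letters fun X _ => Fam.ev_insert_append_one hf hg1 hg hh1 hh X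

theorem Fam.bullet_killsUnit {f : Fam k W U} {g : Fam k V W} (hf : f.KillsUnit)
    (hg1 : g.ev [V.one] = W.one) (hg : g.KillsUnit) : (Fam.bullet f g).KillsUnit := by
  refine Fam.killsUnit_of_letters fun X hX => ?_
  rw [map_val_append_one, Fam.ev_bullet_letters, partSum_append_singleton]
  · rw [← partSum_zero (U := U) (parityOf PtGr.Letter.deg) X]
    refine partSum_congr _ _ _ _ fun Bs hBs => ?_
    have hBs0 : Bs ≠ [] := by rintro rfl; exact hX hBs.eq_nil
    simp only [List.map_append, List.map_cons, List.map_nil]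
    rw [show PtGr.Letter.val V.oneLetter = V.one from rfl, hg1, hf _ (by simpa using hBs0)]
  · intro As B Bs hB
    refine f.ev_isMultiadditive.eq_zero (List.mem_map.mpr ⟨B ++ [V.oneLetter], by simp, ?_⟩)
    rw [← map_val_append_one, hg _ (by simpa using hB)]

theorem Fam.bullet_one {M : Fam k W W} (hM1 : ∀ x : Fin 1 → W, M 1 x = x 0) (χ : Fam k V W) :
    Fam.bullet M χ 1 = χ 1 := by
  refine Fam.apply_ext (g := χ) fun X hX => ?_
  obtain ⟨x, rfl⟩ := List.length_eq_one_iff.mp hX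
  rw [Fam.ev_bullet_letters, partSum_singleton]
  exact Fam.ev_singleton_of_apply_one hM1 _

theorem Fam.ev_bullet_singleton {M : Fam k W W} (hM1 : ∀ x : Fin 1 → W, M 1 x = x 0)
    (χ : Fam k V W) (x : V) : (Fam.bullet M χ).ev [x] = χ.ev [x] := by
  rw [Fam.ev_one_singleton, Fam.ev_one_singleton, Fam.bullet_one hM1]

theorem isDescHomotopy_iff {L : Fam k V W} :
    IsDescHomotopy V W L ↔ IsSymFam V W (-1) L ∧ L.ev [V.one] = 0 ∧ L.AbsorbsUnit := by
  rw [Fam.absorbsUnit_iff, Fam.ev_one_singleton]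
  rfl

theorem isCorrelation_iff {M : Fam k V V} : IsCorrelation V M ↔
    IsSymFam V V 0 M ∧ (∀ x : Fin 1 → V, M 1 x = x 0) ∧ M.AbsorbsUnit := by
  rw [Fam.absorbsUnit_iff]
  rfl

theorem isUnitalHomotopy_iff {L : Fam k V W} : IsUnitalHomotopy V W L ↔
    IsSymFam V W (-1) L ∧ L.KillsUnit ∧ L.ev [V.one] = 0 := by
  rw [Fam.killsUnit_and_iff]
  rfl

theorem IsDescHomotopy.sub {L L' : Fam k V W} (h : IsDescHomotopy V W L)
    (h' : IsDescHomotopy V W L') : IsDescHomotopy V W (L - L') := by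
  rw [isDescHomotopy_iff] at *
  exact ⟨h.1.sub h'.1, by rw [Fam.ev_sub, h.2.1, h'.2.1, sub_zero], h.2.2.sub h'.2.2⟩

theorem IsDescHomotopy.add {L L' : Fam k V W} (h : IsDescHomotopy V W L)
    (h' : IsDescHomotopy V W L') : IsDescHomotopy V W (L + L') := by
  rw [isDescHomotopy_iff] at *
  exact ⟨h.1.add h'.1, by rw [Fam.ev_add, h.2.1, h'.2.1, add_zero], h.2.2.add h'.2.2⟩

theorem IsDescHomotopy.zero : IsDescHomotopy V W 0 :=
  isDescHomotopy_iff.mpr ⟨IsSymFam.zero, rfl, Fam.AbsorbsUnit.zero⟩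

theorem IsDescHomotopy.post {F : Fam k V W} (hF : IsSymFam V W 0 F) (hFu : F.AbsorbsUnit)
    (hF1 : F.ev [V.one] = W.one) {s : W →ₗ[k] U} (hs : HasDeg W U (-1) s) (hs1 : s W.one = 0) :
    IsDescHomotopy V U (Fam.post s F) := by
  refine isDescHomotopy_iff.mpr ⟨?_, by rw [Fam.ev_post, hF1, hs1], hFu.post s⟩
  have := hF.post hs
  rwa [zero_add] at this

theorem SLHom.killsUnit {X : Brackets.{u, v} k} {Y : Brackets.{u, w} k} (φ : SLHom X Y) :
    Fam.KillsUnit (V := X.toPtGr) φ.fam :=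
  Fam.killsUnit_iff.mpr φ.map_unit

theorem SLHom.ev_one {X : Brackets.{u, v} k} {Y : Brackets.{u, w} k} (φ : SLHom X Y) :
    φ.fam.ev [X.one] = Y.one := by
  rw [Fam.ev_one_singleton]
  exact φ.map_one

theorem Fam.eq_zero_of_add_self [CharZero k] {U : Type*} [AddCommGroup U] [Module k U] {x : U}
    (h : x + x = 0) : x = 0 := by
  rw [← two_smul k] at h
  exact (smul_eq_zero.mp h).resolve_left two_ne_zero

theorem markSumPair_self [CharZero k] {Y W U : Type*} [AddCommGroup W] [AddCommGroup U] [Module k U]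
    (q : Y → ZMod 2) (g a : Y → W) (F : List W → U) (ys : List Y) :
    markSumPair q g a a F ys = 0 :=
  Fam.eq_zero_of_add_self (k := k) (markSumPair_antisymm q g a a F ys)

end Closure

/-! ### Iterated insertion of brackets. -/

section Brackets

variable {k : Type u} [Field k] {V : PtGr.{u, v} k} {U : Type*} [AddCommGroup U] [Module k U]

/-- Of the two insertions of `ℓ`, those at different places cancel: the two operators coincide, so
antisymmetry gives twice the term equal to zero. The nested insertions remain. -/
theorem Fam.circ_circ_of_square [CharZero k] {ℓ : Fam k V V} (hℓ : IsSymFam V V 1 ℓ)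
    (f : Fam k V U) : Fam.insert (Fam.insert f (Fam.id k V) ℓ) (Fam.id k V) ℓ =
      Fam.insertEven f (Fam.id k V) (Fam.insert ℓ (Fam.id k V) ℓ) := by
  refine Fam.ext_ev fun X => ?_
  rw [Fam.ev_insert_insert odd_one f _ _ Fam.id_isSymFam hℓ, Fam.bullet_id,
    Fam.insert_id hℓ.1, Fam.bullet_id]
  refine (congrArg _ ?_).trans (add_zero _)
  exact (congrArg (fun F => partSum _ F X) (funext fun Bs =>
    markSumPair_self (k := k) _ _ _ _ Bs)).trans (partSum_zero _ _)

/-- The brackets defined by `K M = M ⋆ ℓ` square to zero. -/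
theorem Fam.circ_self_eq_zero [CharZero k] {M ℓ : Fam k V V} (hM1 : ∀ x : Fin 1 → V, M 1 x = x 0)
    (hℓ : IsSymFam V V 1 ℓ) {K : V →ₗ[k] V} (hK : ∀ x, K (K x) = 0)
    (h : Fam.insert M (Fam.id k V) ℓ = Fam.post K M) : Fam.insert ℓ (Fam.id k V) ℓ = 0 := by
  -- Inserted into `M`, the family `ℓ ⋆ ℓ` becomes `(M ⋆ ℓ) ⋆ ℓ = K² M = 0`.
  refine Fam.insertEven_injective (g := Fam.id k V) hM1 (Fam.insert_zero_arity _ _ _) ?_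
  rw [← Fam.circ_circ_of_square hℓ, h, Fam.post_insert, h, Fam.insertEven_zero]
  funext n
  exact MultilinearMap.ext fun x => hK _

end Brackets

/-! ### Descendants -/

section Descendants

variable {k : Type u} [Field k] (A : PAlg.{u, v} k) (B : PAlg.{u, w} k)

theorem PAlg.M_one (x : Fin 1 → A.toPtGr) : A.M 1 x = x 0 := A.isCorrelation.2.1 x

theorem PAlg.M_absorbsUnit : Fam.AbsorbsUnit (V := A.toPtGr) A.M :=
  Fam.absorbsUnit_iff.mpr A.isCorrelation.2.2

theorem PAlg.M_ev_one : A.M.ev [A.one] = A.one := Fam.ev_singleton_of_apply_one A.M_one _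

theorem PAlg.isSymFam_M : IsSymFam A.toPtGr A.toPtGr 0 A.M := A.isCorrelation.1

theorem PAlg.descBr_isInsertSolution :
    Fam.IsInsertSolution (V := A.toPtGr) A.M (Fam.id k A.toPtGr) (Fam.post A.K A.M) A.descBr :=
  fun n => by
    conv_lhs => rw [PAlg.descBr]
    rfl

theorem PAlg.isSymFam_KM : IsSymFam A.toPtGr A.toPtGr 1 (Fam.post A.K A.M) := by
  have := A.isSymFam_M.post A.isPointedComplex.1
  rwa [zero_add] at this

theorem PAlg.descBr_isSymFam : IsSymFam A.toPtGr A.toPtGr 1 A.descBr :=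
  A.descBr_isInsertSolution.isSymFam odd_one A.isSymFam_M Fam.id_isSymFam A.isSymFam_KM

/-- The defining relation `K M = M ⋆ ℓ`. -/
theorem PAlg.M_circ_descBr :
    Fam.insert (V := A.toPtGr) A.M (Fam.id k A.toPtGr) A.descBr = Fam.post A.K A.M :=
  A.descBr_isInsertSolution.insert_eq A.M_one A.isSymFam_KM.1

theorem PAlg.descBr_unit :
    Fam.ev (A.descBr : Fam k A.toPtGr A.toPtGr) [A.one] = 0 ∧ Fam.KillsUnit (V := A.toPtGr) A.descBr :=
  Fam.killsUnit_of_insert A.M_one A.M_absorbsUnit A.M_circ_descBr (Fam.ev_id_singleton _)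
    Fam.id_killsUnit (A.M_absorbsUnit.post A.K)
    ((congrArg A.K A.M_ev_one).trans A.isPointedComplex.2.2.1)

theorem PAlg.descBr_circ_descBr [CharZero k] :
    Fam.insert (V := A.toPtGr) A.descBr (Fam.id k A.toPtGr) A.descBr = 0 :=
  Fam.circ_self_eq_zero A.M_one A.descBr_isSymFam A.isPointedComplex.2.1 A.M_circ_descBr

theorem PAlg.desc_isUnitalSL [CharZero k] : A.desc.IsUnitalSL :=
  ⟨A.descBr_isSymFam, A.descBr_circ_descBr,
    Fam.killsUnit_and_iff.mp ⟨A.descBr_unit.2, A.descBr_unit.1⟩⟩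

theorem PtGr.trivialSL_isUnitalSL (V : PtGr.{u, v} k) : V.trivialSL.IsUnitalSL :=
  ⟨IsSymFam.zero, Fam.zero_insert _ _, fun _ _ => rfl⟩

variable {A B}

theorem PAlg.descBr_eq_zero (hK : A.K = 0) : A.descBr = (0 : Fam k A.toPtGr A.toPtGr) := by
  refine Fam.insert_injective (g := Fam.id k A.toPtGr) A.M_one A.descBr_isSymFam.1 ?_
  rw [A.M_circ_descBr, Fam.insert_zero, hK]
  rfl

theorem PAlg.desc_eq_trivialSL (hK : A.K = 0) : A.desc = A.toPtGr.trivialSL := by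
  unfold PAlg.desc PtGr.trivialSL
  rw [PAlg.descBr_eq_zero hK]

/-- The coboundary `K' L + L ⋆ ℓ` of a family `L`. -/
noncomputable def PAlg.cobdry (A : PAlg.{u, v} k) (B : PAlg.{u, w} k)
    (L : Fam k A.toPtGr B.toPtGr) : Fam k A.toPtGr B.toPtGr :=
  Fam.post B.K L + Fam.insert (V := A.toPtGr) L (Fam.id k A.toPtGr) A.descBr

variable {L : Fam k A.toPtGr B.toPtGr}

theorem IsDescHomotopy.isSymFam_cobdry (hL : IsDescHomotopy A.toPtGr B.toPtGr L) :
    IsSymFam A.toPtGr B.toPtGr 0 (A.cobdry B L) := by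
  have h1 := hL.1.post B.isPointedComplex.1
  have h2 := hL.1.insert odd_one Fam.id_isSymFam A.descBr_isSymFam
  exact h1.add h2

theorem IsDescHomotopy.cobdry_absorbsUnit (hL : IsDescHomotopy A.toPtGr B.toPtGr L) :
    Fam.AbsorbsUnit (V := A.toPtGr) (A.cobdry B L) := by
  obtain ⟨-, h1, h2⟩ := isDescHomotopy_iff.mp hL
  exact (h2.post B.K).add (Fam.insert_absorbsUnit h2 (Fam.ev_id_singleton _) Fam.id_killsUnit
    A.descBr_unit.1 A.descBr_unit.2)

theorem Fam.ev_insert_singleton {V : PtGr.{u, v} k} {W U : Type*} [AddCommGroup W] [Module k W]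
    [AddCommGroup U] [Module k U] (f : Fam k W U) (g h : Fam k V W) (x : V.Letter) :
    (Fam.insert f g h).ev [x.val] = f.ev [h.ev [x.val]] := by
  have := Fam.ev_insert_letters f g h [x]
  rwa [partSum_singleton, markSum_cons, markSum_nil, smul_zero, add_zero] at this

theorem IsDescHomotopy.ev_cobdry_one (hL : IsDescHomotopy A.toPtGr B.toPtGr L) :
    (A.cobdry B L).ev [A.one] = 0 := by
  obtain ⟨-, h1, -⟩ := isDescHomotopy_iff.mp hL
  have h2 := Fam.ev_insert_singleton L (Fam.id k A.toPtGr) A.descBr A.toPtGr.oneLetter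
  have h3 : L.ev [(0 : A.toPtGr)] = 0 := L.ev_isMultiadditive.eq_zero (by simp)
  rw [show PtGr.Letter.val A.toPtGr.oneLetter = A.one from rfl, A.descBr_unit.1, h3] at h2
  refine (congrArg₂ (· + ·) ((congrArg B.K h1).trans (map_zero _)) h2).trans (add_zero _)

/-- A coboundary commutes with the differentials: `K'²` and `(L ⋆ ℓ) ⋆ ℓ` vanish, and the mixed
terms `K'(L ⋆ ℓ)` agree. -/
theorem PAlg.post_cobdry [CharZero k] (L : Fam k A.toPtGr B.toPtGr) :
    Fam.post B.K (A.cobdry B L) =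
      Fam.insert (V := A.toPtGr) (A.cobdry B L) (Fam.id k A.toPtGr) A.descBr := by
  unfold PAlg.cobdry
  rw [Fam.add_insert, Fam.circ_circ_of_square A.descBr_isSymFam, A.descBr_circ_descBr,
    Fam.insertEven_zero, add_zero, Fam.post_insert]
  funext n
  ext x
  exact (map_add B.K _ _).trans (by rw [show B.K (Fam.post B.K L n x) = 0 from
    B.isPointedComplex.2.1 _, zero_add]; rfl)

/-- `χ` is a unital sL∞-morphism of the descendants. -/
structure PAlg.IsDescHom (A : PAlg.{u, v} k) (B : PAlg.{u, w} k) (χ : Fam k A.toPtGr B.toPtGr) :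
    Prop where
  sym : IsSymFam A.toPtGr B.toPtGr 0 χ
  map_br : Fam.bullet (V := A.toPtGr) B.descBr χ =
    Fam.insert (V := A.toPtGr) χ (Fam.id k A.toPtGr) A.descBr
  ev_one : χ.ev [A.one] = B.one
  killsUnit : Fam.KillsUnit (V := A.toPtGr) χ

theorem PAlg.IsDescHom.exists_SLHom {χ : Fam k A.toPtGr B.toPtGr} (h : A.IsDescHom B χ) :
    ∃ φ : SLHom A.desc B.desc, φ.fam = χ :=
  ⟨⟨χ, h.sym, h.map_br,
    (Fam.ev_one_singleton (V := A.toPtGr) (U := B.toPtGr) χ _).symm.trans h.ev_one,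
    (Fam.killsUnit_iff (V := A.toPtGr) (U := B.toPtGr)).mp h.killsUnit⟩, rfl⟩

theorem SLHom.isDescHom (φ : SLHom A.desc B.desc) : A.IsDescHom B φ.fam :=
  ⟨φ.sym, φ.map_br, φ.ev_one, φ.killsUnit⟩

/-- The density of a morphism of descendants commutes with the differentials. -/
theorem PAlg.IsDescHom.post_bullet {χ : Fam k A.toPtGr B.toPtGr} (h : A.IsDescHom B χ) :
    Fam.post B.K (Fam.bullet (V := A.toPtGr) B.M χ) = Fam.insert (V := A.toPtGr)
      (Fam.bullet (V := A.toPtGr) B.M χ) (Fam.id k A.toPtGr) A.descBr := by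
  have e1 := Fam.insert_bullet B.M (Fam.id k B.toPtGr) B.descBr h.sym
  have e2 := Fam.bullet_insert odd_one B.M χ (Fam.id_isSymFam (V := A.toPtGr)) A.descBr_isSymFam
  rw [Fam.id_bullet h.sym.1, B.M_circ_descBr, Fam.post_bullet] at e1
  rw [Fam.bullet_id] at e2
  rw [e1, e2, h.map_br]

/-- A solution of `M' • χ = F` for a family `F` that commutes with the differentials is a
morphism of the descendants. -/
theorem PAlg.isDescHom_of_solution {F χ : Fam k A.toPtGr B.toPtGr} (hF : IsSymFam A.toPtGr B.toPtGr 0 F)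
    (hFu : Fam.AbsorbsUnit (V := A.toPtGr) F) (hF1 : F.ev [A.one] = B.one)
    (hK : Fam.post B.K F = Fam.insert (V := A.toPtGr) F (Fam.id k A.toPtGr) A.descBr)
    (hχ : Fam.IsBulletSolution (V := A.toPtGr) B.M F χ) :
    A.IsDescHom B χ := by
  have hs : IsSymFam A.toPtGr B.toPtGr 0 χ := hχ.isSymFam B.isSymFam_M hF
  have he : Fam.bullet (V := A.toPtGr) B.M χ = F := hχ.bullet_eq B.isSymFam_M.1 B.M_one hF.1
  obtain ⟨h1, h2⟩ := Fam.killsUnit_of_bullet B.M_one B.M_absorbsUnit he hFu hF1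
  refine ⟨hs, ?_, h1, h2⟩
  -- Both sides of the morphism equation are tested by inserting them into `M'(χ; ·)`: one gives
  -- `K'(M' • χ)`, the other `(M' • χ) ⋆ ℓ`, and these agree by `hK`.
  · refine Fam.insert_injective (g := χ) B.M_one ?_ ?_
    · rw [Fam.bullet_zero_arity _ _ B.descBr_isSymFam.1, Fam.insert_zero_arity]
    · have e1 := Fam.insert_bullet B.M (Fam.id k B.toPtGr) B.descBr hs
      have e2 := Fam.bullet_insert odd_one B.M χ Fam.id_isSymFam A.descBr_isSymFam
      rw [Fam.id_bullet hs.1, B.M_circ_descBr, Fam.post_bullet, he] at e1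
      rw [Fam.bullet_id, he] at e2
      rw [← e1, ← e2, hK]

variable (f : PAlgHom A B)

theorem PAlgHom.desc_isBulletSolution (L : Fam k A.toPtGr B.toPtGr) :
    Fam.IsBulletSolution (V := A.toPtGr) B.M (Fam.post f.lin A.M - A.cobdry B L) (f.desc L) :=
  fun n => by
    conv_lhs => rw [PAlgHom.desc]
    refine Eq.trans ?_ (sub_right_comm _ _ _)
    refine (sub_sub _ _ _).trans ?_
    rfl

theorem PAlgHom.isSymFam_target (hL : IsDescHomotopy A.toPtGr B.toPtGr L) :
    IsSymFam A.toPtGr B.toPtGr 0 (Fam.post f.lin A.M - A.cobdry B L) :=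
  (A.isSymFam_M.post f.deg).sub hL.isSymFam_cobdry

/-- The defining relation `f M = M' • φ + K' L + L ⋆ ℓ` of the descendant. -/
theorem PAlgHom.bullet_desc (hL : IsDescHomotopy A.toPtGr B.toPtGr L) :
    Fam.bullet (V := A.toPtGr) B.M (f.desc L) = Fam.post f.lin A.M - A.cobdry B L :=
  (f.desc_isBulletSolution L).bullet_eq B.isSymFam_M.1 B.M_one (f.isSymFam_target hL).1

theorem PAlgHom.exists_desc [CharZero k] (hL : IsDescHomotopy A.toPtGr B.toPtGr L) :
    ∃ φ : SLHom A.desc B.desc, φ.fam = f.desc L := by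
  refine PAlg.IsDescHom.exists_SLHom <| PAlg.isDescHom_of_solution (f.isSymFam_target hL)
    ((A.M_absorbsUnit.post f.lin).sub hL.cobdry_absorbsUnit) ?_ ?_ (f.desc_isBulletSolution L)
  · rw [Fam.ev_sub, hL.ev_cobdry_one, sub_zero, Fam.ev_post, A.M_ev_one, f.map_one]
  · rw [Fam.sub_insert, ← PAlg.post_cobdry, Fam.post_insert, A.M_circ_descBr]
    funext n
    ext x
    refine (map_sub B.K _ _).trans (congrArg (· - B.K (A.cobdry B L n x)) ?_)
    exact (f.comm _).symm

/-- The densities are joined by the segment `G + t ∂L`, where `∂L = K'L + L ⋆ ℓ`. Every point of it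
is unital and commutes with the differentials, hence is the density of a morphism `Φ_t`. The
generator `η_t` is defined by `M'(Φ_t; η_t) = L`. Expanding `∂L` by the chain rules gives `M'(Φ_t;
·)` of the right side of the flow equation, and differentiating `M' • Φ_t` gives `M'(Φ_t; Φ_t')`. -/
theorem PAlg.IsDescHom.exists_flow [CharZero k] {φ ψ : Fam k A.toPtGr B.toPtGr}
    (hφ : A.IsDescHom B φ) (hψ : A.IsDescHom B ψ) (hL : IsDescHomotopy A.toPtGr B.toPtGr L)
    (h : Fam.bullet (V := A.toPtGr) B.M ψ =
      Fam.bullet (V := A.toPtGr) B.M φ + A.cobdry B L) :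
    ∃ (Φ η : PolyFam k A.toPtGr B.toPtGr),
    (∀ t : k, IsUnitalHomotopy A.toPtGr B.toPtGr (η.eval t)) ∧
    (∀ t : k, IsSymFam A.toPtGr B.toPtGr 0 (Φ.eval t)) ∧
    Φ.eval 0 = φ ∧ Φ.eval 1 = ψ ∧
    ∀ t : k, Φ.deriv t =
      Fam.insert (V := A.toPtGr) B.descBr (Φ.eval t) (η.eval t) +
        Fam.insert (V := A.toPtGr) (η.eval t) (Fam.id k A.toPtGr) A.descBr := by
  set G : Fam k A.toPtGr B.toPtGr := Fam.bullet (V := A.toPtGr) B.M φ with hG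
  have hGs : IsSymFam A.toPtGr B.toPtGr 0 G := B.isSymFam_M.bullet hφ.sym
  have hGu : Fam.AbsorbsUnit (V := A.toPtGr) G :=
    Fam.bullet_absorbsUnit B.M_absorbsUnit hφ.ev_one hφ.killsUnit
  have hG1 : G.ev [A.one] = B.one :=
    (Fam.ev_bullet_singleton (V := A.toPtGr) B.M_one φ A.one).trans hφ.ev_one
  have hGK : Fam.post B.K G = Fam.insert (V := A.toPtGr) G (Fam.id k A.toPtGr) A.descBr :=
    hφ.post_bullet
  let F : k → Fam k A.toPtGr B.toPtGr := fun t => G + t • A.cobdry B L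
  have hFs : ∀ t, IsSymFam A.toPtGr B.toPtGr 0 (F t) := fun t =>
    hGs.add (hL.isSymFam_cobdry.smul t)
  have hF1 : ∀ t, (F t).ev [A.one] = B.one := fun t => by
    change (G + t • A.cobdry B L).ev _ = _
    rw [Fam.ev_add, Fam.ev_smul, hL.ev_cobdry_one, hG1, smul_zero, add_zero]
  have hFu : ∀ t, Fam.AbsorbsUnit (V := A.toPtGr) (F t) := fun t =>
    hGu.add (hL.cobdry_absorbsUnit.smul t)
  have hFK : ∀ t, Fam.post B.K (F t) =
      Fam.insert (V := A.toPtGr) (F t) (Fam.id k A.toPtGr) A.descBr := fun t => by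
    change _ = Fam.insert (V := A.toPtGr) (G + t • A.cobdry B L) (Fam.id k A.toPtGr) A.descBr
    rw [Fam.add_insert, Fam.smul_insert, ← hGK, ← PAlg.post_cobdry]
    funext n
    ext x
    exact (map_add B.K _ _).trans (congrArg (B.K (G n x) + ·) (map_smul B.K t _))
  let Φ : k → Fam k A.toPtGr B.toPtGr := fun t => Fam.solveBullet (V := A.toPtGr) B.M (F t)
  have hΦ : ∀ t, Fam.IsBulletSolution (V := A.toPtGr) B.M (F t) (Φ t) := fun t =>
    Fam.solveBullet_isBulletSolution _ _
  have hχ := fun t => PAlg.isDescHom_of_solution (hFs t) (hFu t) (hF1 t) (hFK t) (hΦ t)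
  have hΦs : ∀ t, IsSymFam A.toPtGr B.toPtGr 0 (Φ t) := fun t => (hχ t).sym
  have hΦe : ∀ t, Fam.bullet (V := A.toPtGr) B.M (Φ t) = F t := fun t =>
    (hΦ t).bullet_eq B.isSymFam_M.1 B.M_one (hFs t).1
  let η : k → Fam k A.toPtGr B.toPtGr := fun t =>
    Fam.solveInsert (V := A.toPtGr) B.M (Φ t) L
  have hη : ∀ t, Fam.IsInsertSolution (V := A.toPtGr) B.M (Φ t) L (η t) := fun t =>
    Fam.solveInsert_isInsertSolution _ _ _
  have hodd : Odd (-1 : ℤ) := by decide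
  have hηs : ∀ t, IsSymFam A.toPtGr B.toPtGr (-1) (η t) := fun t =>
    (hη t).isSymFam hodd B.isSymFam_M (hΦs t) hL.1
  have hηe : ∀ t, Fam.insert (V := A.toPtGr) B.M (Φ t) (η t) = L := fun t =>
    (hη t).insert_eq B.M_one hL.1.1
  have hFd : Fam.HasDeriv F fun _ => A.cobdry B L := fun n => by
    have := (HasPolyDeriv.const (k := k) (G n)).add (HasPolyDeriv.linear (A.cobdry B L n))
    simp only [zero_add] at this
    exact this
  obtain ⟨Φ', hΦ'⟩ := Fam.HasDeriv.of_isBulletSolution hFd hΦ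
  have hLd : Fam.HasDeriv (fun _ : k => L) fun _ => 0 := fun n => HasPolyDeriv.const _
  obtain ⟨η', hη'⟩ := Fam.HasDeriv.of_isInsertSolution hΦ' hLd hη
  obtain ⟨P, hP, hP'⟩ := hΦ'.exists_polyFam
  obtain ⟨Q, hQ, -⟩ := hη'.exists_polyFam
  -- The derivative of `M' • Φ_t = F t`, computed in two ways.
  have key : ∀ t, Fam.insertEven (V := A.toPtGr) B.M (Φ t) (Φ' t) = A.cobdry B L := fun t => by
    funext n
    have h1 := hΦ'.bullet B.M n
    simp only [hΦe] at h1
    exact congrFun (h1.unique (hFd n)) t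
  refine ⟨P, Q, fun t => ?_, fun t => ?_, ?_, ?_, fun t => ?_⟩
  · rw [hQ]
    obtain ⟨-, hL1, hLu⟩ := isDescHomotopy_iff.mp hL
    have h1 : (Φ t).ev [A.one] = B.one := (hχ t).ev_one
    have h2 : Fam.KillsUnit (V := A.toPtGr) (Φ t) := (hχ t).killsUnit
    have := Fam.killsUnit_of_insert B.M_one B.M_absorbsUnit (hηe t) h1 h2 hLu hL1
    exact isUnitalHomotopy_iff.mpr ⟨hηs t, this.2, this.1⟩
  · rw [hP]
    exact hΦs t
  · rw [hP]
    refine Fam.bullet_injective (V := A.toPtGr) B.M_one ((hΦs 0).1.trans hφ.sym.1.symm) ?_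
    rw [hΦe]
    simp [F, hG]
  · rw [hP]
    refine Fam.bullet_injective (V := A.toPtGr) B.M_one ((hΦs 1).1.trans hψ.sym.1.symm) ?_
    rw [hΦe, h]
    simp [F]
  · rw [hP, hP', hQ]
    have hbr : Fam.bullet (V := A.toPtGr) B.descBr (Φ t) =
        Fam.insert (V := A.toPtGr) (Φ t) (Fam.id k A.toPtGr) A.descBr := (hχ t).map_br
    refine Fam.insertEven_injective (g := Φ t) B.M_one ?_ ?_
    -- Injectivity of the insertion says nothing about arity zero. There `Φ_t` vanishes for all `t`,
    -- so its derivative does as well.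
    · have h0 := hΦ' 0
      simp only [fun t => (hΦs t).1] at h0
      have h1 := congrFun (h0.unique HasPolyDeriv.zero) t
      refine h1.trans ?_
      change _ = Fam.insert (V := A.toPtGr) B.descBr (Φ t) (η t) 0 +
        Fam.insert (V := A.toPtGr) (η t) (Fam.id k A.toPtGr) A.descBr 0
      rw [Fam.insert_zero_arity, Fam.insert_zero_arity, add_zero]
    · rw [key, Fam.insertEven_add]
      refine Fam.ext_ev fun X => ?_
      -- The two expansions are those of `K'L`, with `K'M' = M' ⋆ ℓ'`, and of `L ⋆ ℓ`. Their pair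
      -- terms have `η` and `Φ ⋆ ℓ` in opposite roles, because `ℓ' • Φ = Φ ⋆ ℓ`, and cancel.
      have e1 := Fam.ev_insert_insert hodd B.M (Fam.id k B.toPtGr) B.descBr (hΦs t) (hηs t) X
      have e2 := Fam.ev_insert_insert odd_one B.M (Φ t) (η t) Fam.id_isSymFam A.descBr_isSymFam X
      rw [B.M_circ_descBr, Fam.post_insert, hηe, Fam.id_bullet (hΦs t).1,
        Fam.insert_id (hηs t).1, hbr] at e1
      rw [hηe, Fam.bullet_id, Fam.bullet_id] at e2
      unfold PAlg.cobdry
      rw [Fam.ev_add, Fam.ev_add, e1, e2, add_add_add_comm, ← partSum_add]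
      simp only [add_comm (markSumPair _ _ _ (fun B => (Fam.insert _ _ _).ev _) _ _),
        markSumPair_antisymm, partSum_zero, add_zero]

/-- Two morphisms of descendants whose densities differ by a coboundary are homotopic. -/
theorem SLHom.homotopic_of_cobdry [CharZero k] {φ ψ : SLHom A.desc B.desc}
    (hL : IsDescHomotopy A.toPtGr B.toPtGr L)
    (h : Fam.bullet (V := A.toPtGr) B.M ψ.fam =
      Fam.bullet (V := A.toPtGr) B.M φ.fam + A.cobdry B L) : φ.Homotopic ψ :=
  φ.isDescHom.exists_flow ψ.isDescHom hL h

end Descendants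

/-! ### Homotopy invariance -/

section Invariance

variable {k : Type u} [Field k] {V : PtGr.{u, v} k} {C : PAlg.{u, w} k}

theorem HasPolyDeriv.bullet_left {W U : Type*} [AddCommGroup W] [Module k W] [AddCommGroup U]
    [Module k U] {f f' : k → Fam k W U}
    (h : ∀ n, HasPolyDeriv (fun t => f t n) fun t => f' t n) (g : Fam k V W) (n : ℕ) :
    HasPolyDeriv (fun t => Fam.bullet (f t) g n) fun t => Fam.bullet (f' t) g n := by
  refine HasPolyDeriv.sum fun π _ => ?_
  obtain ⟨S, hS⟩ := PtGr.exists_signed_linear (V := V) (U := U) (partSign π)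
  let B : MultilinearMap k (fun _ : Fin π.length => W) U →ₗ[k]
      MultilinearMap k (fun _ : Fin n => V.carrier) U :=
    { toFun := fun F => blockComp π F fun i => g (π.partSize i)
      map_add' := fun _ _ => rfl
      map_smul' := fun _ _ => rfl }
  simp only [hS]
  exact ((h _).map B).map S

theorem markSumPair_singleton {Y W U : Type*} [AddCommGroup W] [AddCommGroup U]
    (q : Y → ZMod 2) (g a b : Y → W) (F : List W → U) (y : Y) :
    markSumPair q g a b F [y] = 0 := by
  simp [markSumPair]

/-- Substitution of `ℓ(Φ, η)` into a family, if `ℓ • Φ` vanishes in lower arities. -/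
theorem Fam.insertEven_bracket_apply (f : Fam k C.toPtGr C.toPtGr) {Φ η : Fam k V C.toPtGr}
    (hΦ : IsSymFam V C.toPtGr 0 Φ) (hη : IsSymFam V C.toPtGr (-1) η) {n : ℕ}
    (h : ∀ m < n, Fam.bullet (V := V) C.descBr Φ m = 0) :
    Fam.insertEven f Φ (Fam.insert (V := V) C.descBr Φ η) n =
      Fam.insert (Fam.insert (V := C.toPtGr) f (Fam.id k C.toPtGr) C.descBr) Φ η n := by
  refine Fam.apply_ext fun X hX => ?_
  have hodd : Odd (-1 : ℤ) := by decide
  have e1 := Fam.ev_insert_insert hodd f (Fam.id k C.toPtGr) C.descBr hΦ hη X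
  rw [Fam.id_bullet hΦ.1, Fam.insert_id hη.1] at e1
  rw [e1, left_eq_add, ← partSum_zero (U := C.carrier) (parityOf PtGr.Letter.deg) X]
  refine partSum_congr _ _ _ _ fun Bs hBs => ?_
  -- A pair needs two different blocks. If there are several, each is shorter than `n` and `ℓ • Φ`
  -- vanishes on it.
  by_cases hB : Bs = [X]
  · rw [hB, markSumPair_singleton]
  · refine markSumPair_eq_zero _ _ _ _ f.ev_isMultiadditive fun B hBm => ?_
    have hl : B.length < n := hX ▸ hBs.length_lt hB hBm
    have := h (B.map PtGr.Letter.val).length (by simpa using hl)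
    exact congrFun (congrArg DFunLike.coe this) _

variable [CharZero k]

/-- A homotopy does not require the intermediate `Φ(t)` to be morphisms; here it is proved for a
source with zero structure. By induction on the arity, the derivative of `ℓ • Φ` is `(ℓ ⋆ ℓ)(Φ; η) =
0`, and the value at `0` is zero. -/
theorem Fam.bullet_bracket_flow {Φ η : PolyFam k V C.toPtGr}
    (hΦs : ∀ t, IsSymFam V C.toPtGr 0 (Φ.eval t)) (hηs : ∀ t, IsSymFam V C.toPtGr (-1) (η.eval t))
    (hd : ∀ t, Φ.deriv t = Fam.insert (V := V) C.descBr (Φ.eval t) (η.eval t))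
    (h0 : Fam.bullet (V := V) C.descBr (Φ.eval 0) = 0) (n : ℕ) (t : k) :
    Fam.bullet (V := V) C.descBr (Φ.eval t) n = 0 := by
  induction n using Nat.strong_induction_on generalizing t with
  | _ n ih =>
    have h1 := Φ.hasDeriv.bullet (V := V) C.descBr n
    have h2 : ∀ t, Fam.insertEven (V := V) C.descBr (Φ.eval t) (Φ.deriv t) n = 0 := fun t => by
      rw [hd, Fam.insertEven_bracket_apply _ (hΦs t) (hηs t) fun m hm => ih m hm t,
        C.descBr_circ_descBr, Fam.zero_insert]
      rfl
    simp only [h2] at h1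
    exact (h1.eq_of_deriv_zero t 0).trans (congrFun h0 n)

/-- The derivative of `M • Φ` is `(M ⋆ ℓ)(Φ; η) = K M(Φ; η)`, which vanishes modulo the image of
`K`. -/
theorem Fam.bullet_M_flow {Φ η : PolyFam k V C.toPtGr}
    (hΦs : ∀ t, IsSymFam V C.toPtGr 0 (Φ.eval t)) (hηs : ∀ t, IsSymFam V C.toPtGr (-1) (η.eval t))
    (hd : ∀ t, Φ.deriv t = Fam.insert (V := V) C.descBr (Φ.eval t) (η.eval t))
    (h0 : Fam.bullet (V := V) C.descBr (Φ.eval 0) = 0) (n : ℕ) (x : Fin n → V) :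
    (LinearMap.range C.K).mkQ (Fam.bullet (V := V) C.M (Φ.eval 0) n x) =
      (LinearMap.range C.K).mkQ (Fam.bullet (V := V) C.M (Φ.eval 1) n x) := by
  let R : MultilinearMap k (fun _ : Fin n => V.carrier) C.carrier →ₗ[k]
      C.carrier ⧸ LinearMap.range C.K :=
    { toFun := fun F => (LinearMap.range C.K).mkQ (F x)
      map_add' := fun _ _ => rfl
      map_smul' := fun _ _ => rfl }
  have h1 := (Φ.hasDeriv.bullet (V := V) C.M n).map R
  have h2 : ∀ t, R (Fam.insertEven (V := V) C.M (Φ.eval t) (Φ.deriv t) n) = 0 := fun t => by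
    rw [hd, Fam.insertEven_bracket_apply _ (hΦs t) (hηs t) fun m _ =>
      Fam.bullet_bracket_flow hΦs hηs hd h0 m t, C.M_circ_descBr, Fam.post_insert]
    exact (Submodule.Quotient.mk_eq_zero _).mpr ⟨_, rfl⟩
  simp only [h2] at h1
  exact h1.eq_of_deriv_zero 0 1

omit [CharZero k] in
theorem SLHom.bullet_descBr (φ : SLHom V.trivialSL C.desc) :
    Fam.bullet (V := V) (W := C.carrier) (U := C.carrier) C.descBr φ.fam = 0 := by
  have key : ∀ f : Fam k V.carrier C.carrier, Fam.insert (V := V) f (Fam.id k V) 0 = 0 :=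
    fun f => Fam.insert_zero _ _
  exact φ.map_br.trans (key φ.fam)

omit [CharZero k] in
theorem SLHom.Homotopic.exists_flow {φ ψ : SLHom V.trivialSL C.desc} (h : φ.Homotopic ψ) :
    ∃ Φ η : PolyFam k V.carrier C.carrier, (∀ t, IsSymFam V C.toPtGr (-1) (η.eval t)) ∧
      (∀ t, IsSymFam V C.toPtGr 0 (Φ.eval t)) ∧ Φ.eval 0 = φ.fam ∧ Φ.eval 1 = ψ.fam ∧
      ∀ t, Φ.deriv t = Fam.insert (V := V) C.descBr (Φ.eval t) (η.eval t) := by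
  obtain ⟨Φ, η, h1, h2, h3, h4, h5⟩ := h
  refine ⟨Φ, η, fun t => (h1 t).1, h2, h3, h4, fun t => (h5 t).trans ?_⟩
  have key : ∀ P e : Fam k V.carrier C.carrier, Fam.insert (V := V) C.descBr P e +
      Fam.insert (V := V) e (Fam.id k V) 0 = Fam.insert (V := V) C.descBr P e := fun P e => by
    rw [Fam.insert_zero, add_zero]
  exact key _ _

/-- The densities of representatives of the same homotopy type agree modulo the image of the
differential. -/
theorem density_of_type_eq {φ ψ : SLHom V.trivialSL C.desc} (h : φ.type = ψ.type) (n : ℕ)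
    (x : Fin n → V) : ∃ y, density ψ n x - density φ n x = C.K y := by
  -- A function that respects single homotopies factors through the quotient, so chains of
  -- homotopies need no separate treatment.
  let J : SLHo V.trivialSL C.desc → C.carrier ⧸ LinearMap.range C.K :=
    Quot.lift (fun φ => (LinearMap.range C.K).mkQ (density φ n x)) (by
      intro φ ψ hφψ
      obtain ⟨Φ, η, h1, h2, h3, h4, h5⟩ := hφψ.exists_flow
      have h8 := Fam.bullet_M_flow h2 h1 h5 (by rw [h3]; exact φ.bullet_descBr) n x
      rw [h3, h4] at h8
      exact h8)
  have h1 : J ψ.type = J φ.type := by rw [h]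
  obtain ⟨y, hy⟩ := (Submodule.Quotient.eq _).mp h1
  exact ⟨y, hy.symm⟩

omit [CharZero k] in
theorem Fam.post_bullet_M {φ : Fam k V C.carrier} (hs : IsSymFam V C.toPtGr 0 φ)
    (h : Fam.bullet (V := V) C.descBr φ = 0) : Fam.post C.K (Fam.bullet (V := V) C.M φ) = 0 := by
  have h1 := Fam.insert_bullet C.M (Fam.id k C.toPtGr) C.descBr hs
  rwa [C.M_circ_descBr, Fam.post_bullet, h, Fam.insert_zero] at h1

omit [CharZero k] in
theorem post_density (φ : SLHom V.trivialSL C.desc) :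
    Fam.post (U := C.carrier) (U' := C.carrier) C.K (density φ) = 0 :=
  Fam.post_bullet_M φ.sym φ.bullet_descBr

omit [CharZero k] in
theorem K_density (φ : SLHom V.trivialSL C.desc) (n : ℕ) (x : Fin n → V) :
    C.K (density φ n x) = 0 :=
  congrFun (congrArg DFunLike.coe (congrFun (post_density φ) n)) x

omit [CharZero k] in
theorem density_one (φ : SLHom V.trivialSL C.desc) (x : Fin 1 → V) :
    density φ 1 x = φ.lin (x 0) := by
  have h := congrFun (congrArg DFunLike.coe (Fam.bullet_one (V := V) (W := C.toPtGr) C.M_one φ.fam)) x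
  refine h.trans (congrArg (φ.fam 1) ?_)
  funext i
  rw [Subsingleton.elim i 0]

omit [CharZero k] in
theorem SLHom.Homotopic.exists_flow_of_trivial {Y : PtGr.{u, w'} k}
    {ψ ψ' : SLHom C.desc Y.trivialSL} (h : ψ.Homotopic ψ') :
    ∃ Ψ η : PolyFam k C.carrier Y.carrier, Ψ.eval 0 = ψ.fam ∧ Ψ.eval 1 = ψ'.fam ∧
      ∀ t, Ψ.deriv t = Fam.insert (V := C.toPtGr) (η.eval t) (Fam.id k C.toPtGr) C.descBr := by
  obtain ⟨Ψ, η, -, -, h3, h4, h5⟩ := h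
  refine ⟨Ψ, η, h3, h4, fun t => (h5 t).trans ?_⟩
  have key : ∀ (P : Fam k C.carrier Y.carrier) (e : Fam k C.carrier Y.carrier),
      Fam.insert (V := C.toPtGr) (0 : Fam k Y.carrier Y.carrier) P e +
        Fam.insert (V := C.toPtGr) e (Fam.id k C.toPtGr) C.descBr =
      Fam.insert (V := C.toPtGr) e (Fam.id k C.toPtGr) C.descBr := fun P e => by
    rw [Fam.zero_insert, zero_add]
  exact key _ _

/-- The composite with a morphism into an algebra with zero structure depends only on the
homotopy type of that morphism. -/
theorem bullet_of_type_eq {Y : PtGr.{u, w'} k} {ψ ψ' : SLHom C.desc Y.trivialSL}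
    (h : ψ.type = ψ'.type) {g g' : Fam k C.carrier Y.carrier} (hg : ψ.fam = g) (hg' : ψ'.fam = g')
    {φ : Fam k V C.carrier} (hs : IsSymFam V C.toPtGr 0 φ)
    (hφ : Fam.bullet (V := V) C.descBr φ = 0) :
    Fam.bullet (V := V) g φ = Fam.bullet (V := V) g' φ := by
  let B : Fam k C.carrier Y.carrier → Fam k V.carrier Y.carrier := fun g =>
    Fam.bullet (V := V) g φ
  let J : SLHo C.desc Y.trivialSL → Fam k V Y.carrier :=
    Quot.lift (fun ψ => B ψ.fam) (by
      intro ψ ψ' hψ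
      obtain ⟨Ψ, η, h3, h4, h5⟩ := hψ.exists_flow_of_trivial
      have h7 : ∀ t, Fam.bullet (V := V) (Ψ.deriv t) φ = 0 := fun t => by
        rw [h5, Fam.insert_bullet _ _ _ hs, hφ, Fam.insert_zero]
      have h8 : Fam.bullet (V := V) (Ψ.eval 0) φ = Fam.bullet (V := V) (Ψ.eval 1) φ := by
        funext n
        have h9 := HasPolyDeriv.bullet_left (PolyFam.hasDeriv (V := C.toPtGr) Ψ) φ n
        simp only [h7] at h9
        exact h9.eq_of_deriv_zero 0 1
      rw [h3, h4] at h8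
      exact h8)
  rw [← hg, ← hg']
  exact congrArg J h

end Invariance

/-! ### Homogeneous parts of linear maps and splittings -/

section Splitting

variable {k : Type u} [Field k] (V : PtGr.{u, v} k) (W : PtGr.{u, w} k)

/-- The projection onto the homogeneous component of degree `j`. -/
noncomputable def PtGr.component (j : ℤ) : V →ₗ[k] V :=
  letI := V.internal.chooseDecomposition
  (V.gr j).subtype ∘ₗ DirectSum.component k ℤ (fun i => V.gr i) j ∘ₗ
    (DirectSum.decomposeLinearEquiv V.gr).toLinearMap

theorem PtGr.component_mem (j : ℤ) (x : V) : V.component j x ∈ V.gr j :=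
  Subtype.mem _

variable {V W}

theorem PtGr.component_apply {j : ℤ} {x : V} (hx : x ∈ V.gr j) (i : ℤ) :
    V.component i x = if i = j then x else 0 := by
  let _ := V.internal.chooseDecomposition
  change ((DirectSum.decompose V.gr x i : V.gr i) : V) = _
  split_ifs with h
  · subst h
    exact DirectSum.decompose_of_mem_same V.gr hx
  · exact DirectSum.decompose_of_mem_ne V.gr hx (Ne.symm h)

theorem PtGr.linearMap_ext {U : Type*} [AddCommGroup U] [Module k U] {L L' : V →ₗ[k] U}
    (h : ∀ j, ∀ x ∈ V.gr j, L x = L' x) : L = L' := by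
  classical
  let _ := V.internal.chooseDecomposition
  ext x
  rw [← DirectSum.sum_support_decompose V.gr x, map_sum, map_sum]
  exact Finset.sum_congr rfl fun j _ => h j _ (DirectSum.decompose V.gr x j).2

theorem PtGr.component_map {q : ℤ} {K : V →ₗ[k] W} (hK : HasDeg V W q K) {i j : ℤ}
    (hi : i = j + q) (y : V) : W.component i (K y) = K (V.component j y) := by
  have : W.component i ∘ₗ K = K ∘ₗ V.component j := by
    refine PtGr.linearMap_ext fun a x hx => ?_
    simp only [LinearMap.comp_apply]
    rw [PtGr.component_apply hx, PtGr.component_apply (hK a x hx)]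
    by_cases h : j = a
    · rw [if_pos h, if_pos (by omega)]
    · rw [if_neg h, if_neg (by omega), map_zero]
  exact LinearMap.congr_fun this y

/-- The homogeneous part of degree `p` of a linear map. -/
noncomputable def PtGr.degPart (p : ℤ) (L : V →ₗ[k] W) : V →ₗ[k] W :=
  letI := V.internal.chooseDecomposition
  (DirectSum.toModule k ℤ W fun j => W.component (j + p) ∘ₗ L ∘ₗ (V.gr j).subtype) ∘ₗ
    (DirectSum.decomposeLinearEquiv V.gr).toLinearMap

theorem PtGr.degPart_apply {p : ℤ} (L : V →ₗ[k] W) {i j : ℤ} {x : V} (hx : x ∈ V.gr j)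
    (hi : i = j + p) : PtGr.degPart p L x = W.component i (L x) := by
  let _ := V.internal.chooseDecomposition
  have h : DirectSum.decompose V.gr x = DirectSum.of (fun i => V.gr i) j ⟨x, hx⟩ :=
    DirectSum.decompose_of_mem V.gr hx
  unfold PtGr.degPart
  simp only [LinearMap.comp_apply, LinearEquiv.coe_coe, DirectSum.decomposeLinearEquiv_apply]
  erw [h]
  erw [DirectSum.toModule_lof]
  rw [hi]
  rfl

theorem PtGr.degPart_hasDeg (p : ℤ) (L : V →ₗ[k] W) : HasDeg V W p (PtGr.degPart p L) :=
  fun j x hx => by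
    rw [PtGr.degPart_apply L hx rfl]
    exact W.component_mem _ _

/-- A complex of vector spaces with its cohomology splits. -/
theorem exists_ungraded_splitting {S C : Type*} [AddCommGroup S] [Module k S] [AddCommGroup C]
    [Module k C] {K : C →ₗ[k] C} (hK : ∀ x, K (K x) = 0) {f : S →ₗ[k] C}
    (hKf : ∀ s, K (f s) = 0) (hinj : ∀ s y, f s = K y → s = 0)
    (hsurj : ∀ y, K y = 0 → ∃ s z, y = f s + K z) :
    ∃ (h : C →ₗ[k] S) (b : C →ₗ[k] C), (∀ x, h (K x) = 0) ∧ (∀ s, h (f s) = s) ∧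
      (∀ s, b (f s) = 0) ∧ ∀ x, f (h x) = x + K (b x) + b (K x) := by
  -- `σ` is a section of `K` on its image, extended to the whole space, so `K σ K = K`.
  obtain ⟨r, hr⟩ := K.rangeRestrict.exists_rightInverse_of_surjective K.range_rangeRestrict
  obtain ⟨σ, hσ⟩ := r.exists_extend
  have hσK : ∀ x, K (σ (K x)) = K x := fun x => by
    have h1 : σ (K x) = r ⟨K x, x, rfl⟩ := LinearMap.congr_fun hσ ⟨K x, x, rfl⟩
    rw [h1]
    exact congrArg Subtype.val (LinearMap.congr_fun hr ⟨K x, x, rfl⟩)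
  -- By `hinj` the map `f` stays injective modulo the image of `K`; `g` inverts it from the left.
  obtain ⟨g, hg⟩ := ((LinearMap.range K).mkQ ∘ₗ f).exists_leftInverse_of_injective (by
    rw [LinearMap.ker_eq_bot']
    intro s hs
    obtain ⟨y, hy⟩ := (Submodule.Quotient.mk_eq_zero _).mp hs
    exact hinj s y hy.symm)
  let h₁ : C →ₗ[k] S := g ∘ₗ (LinearMap.range K).mkQ
  have h₁f : ∀ s, h₁ (f s) = s := fun s => LinearMap.congr_fun hg s
  have h₁K : ∀ x, h₁ (K x) = 0 := fun x => by
    have : (LinearMap.range K).mkQ (K x) = 0 := (Submodule.Quotient.mk_eq_zero _).mpr ⟨x, rfl⟩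
    simp [h₁, this]
  -- `1 - σ K` is a projection onto the cocycles. Passing through it makes `f h x` cohomologous to a
  -- cocycle for every `x`.
  let h : C →ₗ[k] S := h₁ ∘ₗ (LinearMap.id - σ ∘ₗ K)
  have hx : ∀ x, h x = h₁ (x - σ (K x)) := fun x => rfl
  -- The cocycle `x - σ K x` and `f h x` differ by an exact element, of which `σ` picks a primitive.
  -- With this choice `b` vanishes on the image of `f`.
  let b : C →ₗ[k] C := -(σ ∘ₗ (LinearMap.id - σ ∘ₗ K - f ∘ₗ h))
  have hb : ∀ x, b x = -σ (x - σ (K x) - f (h x)) := fun x => rfl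
  have hhK : ∀ x, h (K x) = 0 := fun x => by rw [hx, hK, map_zero, sub_zero, h₁K]
  have hhf : ∀ s, h (f s) = s := fun s => by rw [hx, hKf, map_zero, sub_zero, h₁f]
  refine ⟨h, b, hhK, hhf, fun s => ?_, fun x => ?_⟩
  · rw [hb, hKf, hhf]
    simp
  · obtain ⟨s, z, hz⟩ := hsurj (x - σ (K x)) (by rw [map_sub, hσK, sub_self])
    have h2 : h x = s := by rw [hx, hz, map_add, h₁f, h₁K, add_zero]
    have h3 : K (b x) = -K z := by
      rw [hb, h2, hz, add_sub_cancel_left, map_neg, hσK]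
    have h4 : b (K x) = -σ (K x) := by
      rw [hb, hhK, hK]
      simp
    rw [h3, h4, h2, add_right_comm, ← sub_eq_add_neg x, hz]
    abel

/-- A homotopy inverse of a quasi-isomorphism from a complex with zero differential. -/
theorem exists_splitting {S : PtGr.{u, w} k} {C : PtGr.{u, v} k} {K : C →ₗ[k] C}
    (hd : HasDeg C C 1 K) (hK : ∀ x, K (K x) = 0) {f : S →ₗ[k] C} (hf : HasDeg S C 0 f)
    (hKf : ∀ s, K (f s) = 0) (hinj : ∀ s y, f s = K y → s = 0)
    (hsurj : ∀ y, K y = 0 → ∃ s z, y = f s + K z) :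
    ∃ (h : C →ₗ[k] S) (b : C →ₗ[k] C), HasDeg C S 0 h ∧ (∀ x, h (K x) = 0) ∧
      (∀ s, h (f s) = s) ∧ HasDeg C C (-1) b ∧ (∀ s, b (f s) = 0) ∧
      ∀ x, f (h x) = x + K (b x) + b (K x) := by
  obtain ⟨h, b, h1, h2, h3, h4⟩ := exists_ungraded_splitting hK hKf hinj hsurj
  -- `f` and `K` are homogeneous, so all the identities persist for the homogeneous parts of `h` and
  -- `b` of degrees `0` and `-1`.
  refine ⟨PtGr.degPart 0 h, PtGr.degPart (-1) b, PtGr.degPart_hasDeg _ _, ?_, ?_,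
    PtGr.degPart_hasDeg _ _, ?_, ?_⟩
  · refine LinearMap.congr_fun (f := PtGr.degPart 0 h ∘ₗ K) (g := 0)
      (PtGr.linearMap_ext fun j x hx => ?_)
    rw [LinearMap.comp_apply, PtGr.degPart_apply h (hd j x hx) rfl, h1, map_zero,
      LinearMap.zero_apply]
  · refine LinearMap.congr_fun (f := PtGr.degPart 0 h ∘ₗ f) (g := LinearMap.id)
      (PtGr.linearMap_ext fun j x hx => ?_)
    rw [LinearMap.comp_apply, PtGr.degPart_apply h (hf j x hx) rfl, h2,
      PtGr.component_apply hx, if_pos (by omega), LinearMap.id_apply]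
  · refine LinearMap.congr_fun (f := PtGr.degPart (-1) b ∘ₗ f) (g := 0)
      (PtGr.linearMap_ext fun j x hx => ?_)
    rw [LinearMap.comp_apply, PtGr.degPart_apply b (hf j x hx) rfl, h3, map_zero,
      LinearMap.zero_apply]
  · refine LinearMap.congr_fun (f := f ∘ₗ PtGr.degPart 0 h)
      (g := LinearMap.id + K ∘ₗ PtGr.degPart (-1) b + PtGr.degPart (-1) b ∘ₗ K)
      (PtGr.linearMap_ext fun j x hx => ?_)
    simp only [LinearMap.comp_apply, LinearMap.add_apply, LinearMap.id_apply]
    rw [PtGr.degPart_apply h hx rfl, PtGr.degPart_apply b hx rfl,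
      PtGr.degPart_apply (i := j) b (hd j x hx) (by omega),
      ← PtGr.component_map hf (i := j) (by omega), ← PtGr.component_map hd (i := j) (by omega), h4,
      map_add, map_add, PtGr.component_apply hx, if_pos rfl]

end Splitting

/-! ### Descendants of homotopic morphisms -/

section HomotopyDescendants

variable {k : Type u} [Field k] {A : PAlg.{u, v} k} {B : PAlg.{u, w} k}

theorem PAlg.cobdry_add (L L' : Fam k A.toPtGr B.toPtGr) :
    A.cobdry B (L + L') = A.cobdry B L + A.cobdry B L' := by
  unfold PAlg.cobdry
  rw [Fam.add_insert, add_add_add_comm]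
  congr 1
  funext n
  exact MultilinearMap.ext fun x => map_add B.K _ _

theorem PAlg.cobdry_sub (L L' : Fam k A.toPtGr B.toPtGr) :
    A.cobdry B (L - L') = A.cobdry B L - A.cobdry B L' := by
  rw [eq_sub_iff_add_eq, ← PAlg.cobdry_add, sub_add_cancel]

theorem PAlg.cobdry_of_K_eq_zero (hK : A.K = 0) (L : Fam k A.toPtGr B.toPtGr) :
    A.cobdry B L = Fam.post B.K L := by
  unfold PAlg.cobdry
  rw [PAlg.descBr_eq_zero hK, Fam.insert_zero, add_zero]

/-- As `K M = M ⋆ ℓ`, the term `s K M` equals `(s M) ⋆ ℓ`. A chain homotopy `s` thus becomes the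
coboundary of the family `s M`. -/
theorem PAlgHom.post_sub_post {f g : PAlgHom A B} {s : A.toPtGr →ₗ[k] B.toPtGr}
    (hs : ∀ x, f.lin x - g.lin x = s (A.K x) + B.K (s x)) :
    Fam.post f.lin A.M - Fam.post g.lin A.M = A.cobdry B (Fam.post s A.M) := by
  unfold PAlg.cobdry
  rw [Fam.post_insert, A.M_circ_descBr]
  funext n
  exact MultilinearMap.ext fun x => (hs _).trans (add_comm _ _)

variable [CharZero k]

/-- Descendants of homotopic morphisms up to arbitrary homotopies are homotopic. -/
theorem PAlgHom.type_desc_eq {f g : PAlgHom A B} (h : f.type = g.type)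
    {L L' : Fam k A.toPtGr B.toPtGr} (hL : IsDescHomotopy A.toPtGr B.toPtGr L)
    (hL' : IsDescHomotopy A.toPtGr B.toPtGr L') {χ χ' : SLHom A.desc B.desc}
    (hχ : χ.fam = f.desc L) (hχ' : χ'.fam = g.desc L') : χ.type = χ'.type := by
  obtain ⟨s, hs1, hs2, hs3⟩ : f.Homotopic g := Quotient.exact h
  have h1 : IsDescHomotopy A.toPtGr B.toPtGr (Fam.post s A.M) :=
    IsDescHomotopy.post A.isSymFam_M A.M_absorbsUnit A.M_ev_one hs1 hs2
  symm
  -- The densities are `f M - ∂L` and `g M - ∂L'`, and `f M - g M = ∂(s M)`; they differ by the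
  -- coboundary of `s M - L + L'`.
  refine Quot.sound (SLHom.homotopic_of_cobdry ((h1.sub hL).add hL') ?_)
  rw [hχ, hχ']
  refine (f.bullet_desc hL).trans (Eq.trans ?_ (congrArg (· + _) (g.bullet_desc hL').symm))
  rw [PAlg.cobdry_add, PAlg.cobdry_sub, ← PAlgHom.post_sub_post hs3]
  abel

end HomotopyDescendants

/-! ### Transport of homotopy types along equalities. -/

section Transport

variable {k : Type u} [Field k]

theorem SLHom.exists_cast {X X' : Brackets.{u, v} k} {Y Y' : Brackets.{u, w} k} (hX : X = X')
    (hY : Y = Y') (φ : SLHom X Y) :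
    ∃ φ' : SLHom X' Y', HEq φ'.fam φ.fam ∧ φ.type.cast hX hY = φ'.type := by
  subst hX hY
  exact ⟨φ, HEq.rfl, rfl⟩

theorem SLHo.cast_cast {X X' : Brackets.{u, v} k} {Y Y' : Brackets.{u, w} k} (hX : X = X')
    (hY : Y = Y') (T : SLHo X Y) : (T.cast hX hY).cast hX.symm hY.symm = T := by
  subst hX hY
  rfl

end Transport

/-! ### Complete spaces -/

section Complete

variable {k : Type u} [Field k] {V : PtGr.{u, w} k} {C : PAlg.{u, v} k}

theorem PAlg.descBr_one_apply (x : Fin 1 → C.toPtGr) : C.descBr 1 x = C.K (x 0) := by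
  have h : Fam.insert (V := C.toPtGr) C.M (Fam.id k C.toPtGr) C.descBr 1 = C.descBr 1 := by
    refine Fam.apply_ext (g := C.descBr) fun X hX => ?_
    obtain ⟨x, rfl⟩ := List.length_eq_one_iff.mp hX
    exact (Fam.ev_insert_singleton _ _ _ x).trans (Fam.ev_singleton_of_apply_one C.M_one _)
  rw [← h, C.M_circ_descBr]
  exact congrArg C.K (C.M_one x)

theorem SLHom.lin_hasDeg (φ : SLHom V.trivialSL C.desc) : HasDeg V C.toPtGr 0 φ.lin := by
  intro j x hx
  have := (φ.sym.2 1 (fun _ => j) (fun _ => x) fun _ => hx).1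
  rw [Fin.sum_univ_one] at this
  exact this

theorem SLHom.lin_one (φ : SLHom V.trivialSL C.desc) : φ.lin V.one = C.one := φ.map_one

theorem SLHom.K_lin (φ : SLHom V.trivialSL C.desc) (x : V) : C.K (φ.lin x) = 0 := by
  have := K_density φ 1 fun _ => x
  rwa [density_one] at this

theorem SLHom.lin_of_type_eq [CharZero k] {φ ψ : SLHom V.trivialSL C.desc}
    (h : φ.type = ψ.type) (x : V) : ∃ y, ψ.lin x - φ.lin x = C.K y := by
  have := density_of_type_eq h 1 fun _ => x
  rwa [density_one, density_one] at this

theorem SLHom.IsQuasiIso.eq_zero {φ : SLHom V.trivialSL C.desc} (h : φ.IsQuasiIso) (s : V)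
    (y : C.toPtGr) (hs : φ.lin s = C.K y) : s = 0 := by
  obtain ⟨z, hz⟩ := h.1 s rfl ⟨y, hs.trans (PAlg.descBr_one_apply fun _ => y).symm⟩
  exact hz

theorem SLHom.IsQuasiIso.exists_eq {φ : SLHom V.trivialSL C.desc} (h : φ.IsQuasiIso)
    (y : C.toPtGr) (hy : C.K y = 0) : ∃ s z, y - C.K z = φ.lin s := by
  obtain ⟨s, -, z, hz⟩ := h.2 y ((PAlg.descBr_one_apply fun _ => y).trans hy)
  have key : ∀ p d : C.carrier, y = p + d → d = C.K z → y - C.K z = p := by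
    rintro p _ rfl rfl
    exact add_sub_cancel_right _ _
  exact ⟨s, z, key _ _ hz (PAlg.descBr_one_apply fun _ => z)⟩

theorem density_isSymFam (φ : SLHom V.trivialSL C.desc) :
    IsSymFam V C.toPtGr 0 (density φ) :=
  IsSymFam.bullet (V := V) (W := C.toPtGr) (U := C.toPtGr) C.isSymFam_M φ.sym

theorem density_absorbsUnit (φ : SLHom V.trivialSL C.desc) :
    Fam.AbsorbsUnit (V := V) (density φ) :=
  Fam.bullet_absorbsUnit (V := V) (W := C.toPtGr) C.M_absorbsUnit φ.ev_one φ.killsUnit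

theorem density_ev_one (φ : SLHom V.trivialSL C.desc) : (density φ).ev [V.one] = C.one :=
  (Fam.ev_bullet_singleton (V := V) (W := C.toPtGr) C.M_one φ.fam V.one).trans φ.ev_one

/-- The product `h ∘ Π` is characterised modulo the image of the differential. -/
theorem lin_product [CharZero k] {φ₀ φ : SLHom V.trivialSL C.desc} (h : φ₀.type = φ.type)
    {g : C.toPtGr →ₗ[k] V} (hg : IsHomotopyInverse (S := V) (C := C) φ.lin g) (n : ℕ)
    (x : Fin n → V) : ∃ y, φ₀.lin (g (density φ n x)) = density φ₀ n x + C.K y := by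
  obtain ⟨-, -, -, b, -, hb⟩ := hg
  obtain ⟨y₁, h1⟩ := SLHom.lin_of_type_eq h (g (density φ n x))
  obtain ⟨y₂, h2⟩ := density_of_type_eq h n x
  have h3 := hb (density φ n x)
  rw [K_density, map_zero, add_zero] at h3
  have key : ∀ p q d d₀ y : C.carrier, p - q = C.K y₁ → d - d₀ = C.K y₂ → p = d + C.K y →
      q = d₀ + C.K (y₂ - y₁ + y) := by
    intro p q d d₀ y e1 e2 e3
    rw [map_add, map_sub, ← e1, ← e2, e3]
    abel
  exact ⟨_, key _ _ _ _ _ h1 h2 h3⟩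

/-- Composition of the descendant of a morphism to an algebra with zero differential with a
morphism from a zero structure. -/
theorem PAlgHom.bullet_desc_bullet {B : PAlg.{u, w'} k} (hB : B.K = 0) (c : PAlgHom C B)
    {L : Fam k C.toPtGr B.toPtGr} (hL : IsDescHomotopy C.toPtGr B.toPtGr L)
    {φ : Fam k V C.carrier} (hs : IsSymFam V C.toPtGr 0 φ)
    (hφ : Fam.bullet (V := V) C.descBr φ = 0) :
    Fam.bullet (V := V) B.M (Fam.bullet (V := V) (c.desc L) φ) =
      Fam.post c.lin (Fam.bullet (V := V) C.M φ) := by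
  have h0 : Fam.post B.K L = 0 := by
    rw [hB]
    rfl
  -- The choice of `L` does not matter: `K' L` vanishes with `K'`, and `(L ⋆ ℓ) • φ = L(φ; ℓ • φ) =
  -- 0`.
  rw [← Fam.bullet_bullet _ _ hs, c.bullet_desc hL, Fam.sub_bullet, Fam.post_bullet]
  unfold PAlg.cobdry
  rw [h0, zero_add, Fam.insert_bullet _ _ _ hs, hφ, Fam.insert_zero, sub_zero]

end Complete

/-! ### Splittings and the products on a complete space. -/

section Products

variable {k : Type u} [Field k] [CharZero k] {V : PtGr.{u, w} k} {C : PAlg.{u, v} k}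

/-- The data of a splitting along the first component `f` of a quasi-isomorphism. -/
structure IsSplitting (φ : SLHom V.trivialSL C.desc) (f : V →ₗ[k] C.toPtGr)
    (h : C.toPtGr →ₗ[k] V) (b : C.toPtGr →ₗ[k] C.toPtGr) : Prop where
  lin_eq : φ.lin = f
  hasDeg_f : HasDeg V C.toPtGr 0 f
  f_one : f V.one = C.one
  K_f : ∀ s, C.K (f s) = 0
  eq_zero : ∀ s y, f s = C.K y → s = 0
  hasDeg_h : HasDeg C.toPtGr V 0 h
  h_K : ∀ x, h (C.K x) = 0
  h_f : ∀ s, h (f s) = s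
  hasDeg_b : HasDeg C.toPtGr C.toPtGr (-1) b
  b_f : ∀ s, b (f s) = 0
  f_h : ∀ x, f (h x) = x + C.K (b x) + b (C.K x)

omit [CharZero k] in
theorem SLHom.IsQuasiIso.exists_isSplitting {φ : SLHom V.trivialSL C.desc} (hφ : φ.IsQuasiIso) :
    ∃ f h b, IsSplitting (V := V) (C := C) φ f h b := by
  obtain ⟨f, hf⟩ : ∃ f : V →ₗ[k] C.toPtGr, φ.lin = f := ⟨_, rfl⟩
  have h1 : HasDeg V C.toPtGr 0 f := hf ▸ φ.lin_hasDeg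
  have h2 : ∀ s, C.K (f s) = 0 := hf ▸ φ.K_lin
  have h3 : ∀ s y, f s = C.K y → s = 0 := hf ▸ hφ.eq_zero
  have h4 : ∀ y, C.K y = 0 → ∃ s z, y - C.K z = f s := hf ▸ hφ.exists_eq
  have h5 : f V.one = C.one := hf ▸ φ.lin_one
  obtain ⟨h, b, e1, e2, e3, e4, e5, e6⟩ := exists_splitting C.isPointedComplex.1
    C.isPointedComplex.2.1 h1 h2 h3 fun y hy => by
      obtain ⟨s, z, hz⟩ := h4 y hy
      exact ⟨s, z, sub_eq_iff_eq_add.mp hz⟩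
  exact ⟨f, h, b, hf, h1, h5, h2, h3, e1, e2, e3, e4, e5, e6⟩

variable {φ : SLHom V.trivialSL C.desc} {f : V →ₗ[k] C.toPtGr}
  {h : C.toPtGr →ₗ[k] V} {b : C.toPtGr →ₗ[k] C.toPtGr} (H : IsSplitting (V := V) (C := C) φ f h b)

include H

omit [CharZero k] in
theorem IsSplitting.isHomotopyInverse : IsHomotopyInverse (S := V) (C := C) φ.lin h := by
  rw [H.lin_eq]
  exact ⟨H.hasDeg_h, H.h_K, H.h_f, b, H.hasDeg_b, H.f_h⟩

omit [CharZero k] in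
theorem IsSplitting.b_one : b C.one = 0 := by rw [← H.f_one, H.b_f]

omit [CharZero k] in
theorem IsSplitting.one_ne_zero : V.one ≠ 0 := fun h0 =>
  C.isPointedComplex.2.2.2 0 (by rw [map_zero, ← H.f_one, h0, map_zero])

/-- The products `h ∘ Π`. -/
noncomputable def productOf (φ : SLHom V.trivialSL C.desc) (h : C.toPtGr →ₗ[k] V) : Fam k V V :=
  Fam.post (U := C.carrier) h (density φ)

omit [CharZero k] in
theorem IsSplitting.isCorrelation : IsCorrelation V (productOf φ h) := by
  refine isCorrelation_iff.mpr ⟨?_, fun x => ?_, ?_⟩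
  · exact IsSymFam.post (W := C.toPtGr) (U := V) (density_isSymFam φ) H.hasDeg_h
  · refine (congrArg h (density_one φ x)).trans ?_
    rw [H.lin_eq]
    exact H.h_f _
  · exact Fam.AbsorbsUnit.post (W := C.toPtGr) (U := V) (density_absorbsUnit φ) h

-- Densities are cocycles, so the term `b K` of the splitting drops out. This exact formula exhibits
-- `b Π` as the homotopy between `φ` and the descendant of `f`.
omit [CharZero k] in
theorem IsSplitting.f_product (n : ℕ) (x : Fin n → V) :
    f (productOf φ h n x) = density φ n x + C.K (b (density φ n x)) := by
  refine (H.f_h _).trans ?_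
  rw [K_density, map_zero, add_zero]

/-- Under `f` either product equals the density `Π` of `φ` modulo the image of `K`, and `f` reflects
exactness. -/
theorem IsSplitting.product_unique {φ' : SLHom V.trivialSL C.desc} (he : φ.type = φ'.type)
    {g : C.toPtGr →ₗ[k] V} (hg : IsHomotopyInverse (S := V) (C := C) φ'.lin g) :
    productOf φ' g = productOf φ h := by
  funext n
  refine MultilinearMap.ext fun x => ?_
  obtain ⟨y, hy⟩ := lin_product he hg n x
  rw [H.lin_eq] at hy
  have h1 := H.f_product n x
  rw [← sub_eq_zero]
  refine H.eq_zero _ (y - b (density φ n x)) ?_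
  have key : ∀ d y' : C.carrier, f (productOf φ' g n x) = d + C.K y →
      f (productOf φ h n x) = d + C.K y' →
      f (productOf φ' g n x - productOf φ h n x) = C.K (y - y') := by
    intro d y' e1 e2
    rw [map_sub, map_sub, e1, e2]
    abel
  exact key _ _ hy h1

end Products

/-! ### Independence of representatives. -/

section Representatives

variable {k : Type u} [Field k] [CharZero k] {V : PtGr.{u, w} k} {C : PAlg.{u, v} k}
  {φ : SLHom V.trivialSL C.desc} {f : V →ₗ[k] C.toPtGr}
  {h : C.toPtGr →ₗ[k] V} {b : C.toPtGr →ₗ[k] C.toPtGr}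

/-- First components of representatives of a homotopy type are homotopic. -/
theorem IsSplitting.exists_homotopy (H : IsSplitting (V := V) (C := C) φ f h b)
    {φ' : SLHom V.trivialSL C.desc} (he : φ.type = φ'.type) {f' : V →ₗ[k] C.toPtGr}
    (hf' : φ'.lin = f') : ∃ s : V →ₗ[k] C.toPtGr, HasDeg V C.toPtGr (-1) s ∧ s V.one = 0 ∧
      ∀ x, f' x - f x = C.K (s x) := by
  have h1 : HasDeg V C.toPtGr 0 f' := hf' ▸ φ'.lin_hasDeg
  have h2 : f' V.one = C.one := hf' ▸ φ'.lin_one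
  -- The values of `f' - f` are exact, `f' x - f x = K y`, so `h` kills them and the splitting reads
  -- `0 = K y + K b K y`.
  refine ⟨-(b ∘ₗ (f' - f)), fun j x hx => ?_, ?_, fun x => ?_⟩
  · have h3 := H.hasDeg_b (j + 0) (f' x - f x) (Submodule.sub_mem _ (h1 j x hx) (H.hasDeg_f j x hx))
    rw [add_zero] at h3
    exact Submodule.neg_mem _ h3
  · simp [h2, H.f_one]
  · obtain ⟨y, hy⟩ : ∃ y, f' x - f x = C.K y := by
      have := SLHom.lin_of_type_eq he x
      rwa [hf', H.lin_eq] at this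
    have h4 := H.f_h (C.K y)
    rw [H.h_K, map_zero, C.isPointedComplex.2.1, map_zero, add_zero] at h4
    rw [LinearMap.neg_apply, LinearMap.comp_apply, LinearMap.sub_apply, hy, map_neg]
    exact (neg_eq_of_add_eq_zero_left h4.symm).symm

/-- After applying `M'` both sides become morphisms `c`, `c'` evaluated at densities. As the target
differential is zero, homotopic morphisms agree on cocycles and vanish on exact elements, and the
two densities differ by exact elements. -/
theorem bullet_desc_eq {B : PAlg.{u, w'} k} (hB : B.K = 0) {c c' : PAlgHom C B}
    (hc : c.type = c'.type) {L L' : Fam k C.toPtGr B.toPtGr}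
    (hL : IsDescHomotopy C.toPtGr B.toPtGr L) (hL' : IsDescHomotopy C.toPtGr B.toPtGr L')
    {φ φ' : SLHom V.trivialSL C.desc} (he : φ.type = φ'.type) {g g' : Fam k V C.carrier}
    (hg : φ.fam = g) (hg' : φ'.fam = g') :
    Fam.bullet (V := V) (c'.desc L') g' = Fam.bullet (V := V) (c.desc L) g := by
  have hs : IsSymFam V C.toPtGr 0 g := hg ▸ φ.sym
  have hs' : IsSymFam V C.toPtGr 0 g' := hg' ▸ φ'.sym
  have hb : Fam.bullet (V := V) C.descBr g = 0 := hg ▸ φ.bullet_descBr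
  have hb' : Fam.bullet (V := V) C.descBr g' = 0 := hg' ▸ φ'.bullet_descBr
  have hd : Fam.bullet (V := V) C.M g = density φ := hg ▸ rfl
  have hd' : Fam.bullet (V := V) C.M g' = density φ' := hg' ▸ rfl
  have h0 : ∀ (c : PAlgHom C B) (L), IsDescHomotopy C.toPtGr B.toPtGr L → c.desc L 0 = 0 :=
    fun c L hL => (c.desc_isBulletSolution L).zero B.isSymFam_M.1 (c.isSymFam_target hL).1
  refine Fam.bullet_injective B.M_one ?_ ?_
  · rw [Fam.bullet_zero_arity _ _ (h0 c L hL), Fam.bullet_zero_arity _ _ (h0 c' L' hL')]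
  · rw [c.bullet_desc_bullet hB hL hs hb, c'.bullet_desc_bullet hB hL' hs' hb']
    obtain ⟨s, -, -, hs3⟩ : c.Homotopic c' := Quotient.exact hc
    funext n
    refine MultilinearMap.ext fun x => ?_
    have hK : C.K (Fam.bullet (V := V) C.M g n x) = 0 := by
      rw [hd]
      exact K_density φ n x
    obtain ⟨y, hy⟩ : ∃ y, Fam.bullet (V := V) C.M g' n x - Fam.bullet (V := V) C.M g n x =
        C.K y := by
      rw [hd, hd']
      exact density_of_type_eq he n x
    change c'.lin (Fam.bullet (V := V) C.M g' n x) = c.lin (Fam.bullet (V := V) C.M g n x)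
    have h1 := hs3 (Fam.bullet (V := V) C.M g n x)
    rw [hK, map_zero, hB, LinearMap.zero_apply, add_zero, sub_eq_zero] at h1
    rw [h1, ← sub_eq_zero, ← map_sub, hy, c'.comm, hB, LinearMap.zero_apply]

theorem lin_comp_eq {B : PAlg.{u, w'} k} (hB : B.K = 0) {c c' : PAlgHom C B}
    (hc : c.type = c'.type) {φ φ' : SLHom V.trivialSL C.desc} (he : φ.type = φ'.type)
    {f f' : V →ₗ[k] C.carrier} (hf : φ.lin = f) (hf' : φ'.lin = f') :
    c.lin ∘ₗ f = c'.lin ∘ₗ f' := by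
  obtain ⟨s, -, -, hs3⟩ : c.Homotopic c' := Quotient.exact hc
  refine LinearMap.ext fun x => ?_
  have hK : C.K (f x) = 0 := hf ▸ φ.K_lin x
  obtain ⟨y, hy⟩ : ∃ y, f' x - f x = C.K y := by
    have := SLHom.lin_of_type_eq he x
    rwa [hf, hf'] at this
  have h1 := hs3 (f x)
  rw [hK, map_zero, hB, LinearMap.zero_apply, add_zero, sub_eq_zero] at h1
  have h2 : c'.lin (f' x - f x) = 0 := by rw [hy, c'.comm, hB, LinearMap.zero_apply]
  rw [map_sub, sub_eq_zero] at h2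
  exact h1.trans h2.symm

/-- Morphisms between zero structures. -/
theorem PtGr.exists_hom_of_trivialSL {Y : PtGr.{u, w'} k} {G : Fam k V Y}
    (hs : IsSymFam V Y 0 G) (h1 : G.ev [V.one] = Y.one) (hk : Fam.KillsUnit (V := V) G) :
    ∃ κ : SLHom V.trivialSL Y.trivialSL, κ.fam = G := by
  have h2 : Fam.bullet (V := V) (0 : Fam k Y Y) G = Fam.insert (V := V) G (Fam.id k V) 0 := by
    rw [Fam.zero_bullet, Fam.insert_zero]
  have h3 : G 1 (fun _ => V.one) = Y.one := by rw [← Fam.ev_one_singleton, h1]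
  exact ⟨⟨G, hs, h2, h3, Fam.killsUnit_iff (V := V) (U := Y.carrier).mp hk⟩, rfl⟩

end Representatives

/-! ### The complete space as a homotopy probability algebra. -/

theorem mainTheorem8 (k : Type u) [Field k] [CharZero k] (C : PAlg.{u, v} k)
    (c : PAlgHo C (ground k)) (S : CompleteRVSpace.{u, v, w} C) :
    -- the canonical products on the complete space, and the algebra `S_C = (S, M, 0)`
    ∃ M : Fam k S.space S.space, S.IsProduct M ∧ (∀ M', S.IsProduct M' → M' = M) ∧
    ∃ (hM : IsCorrelation S.space M) (h1 : S.space.one ≠ 0),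
    let SC : PAlg.{u, w} k := PAlg.ofCorrelation S.space M hM h1
    -- the descendants are objects of the category of unital sL∞-algebras, and `hoDes(S_C) = (S, 0)`
    C.desc.IsUnitalSL ∧ S.space.trivialSL.IsUnitalSL ∧
    ∃ (hS : SC.desc = S.space.trivialSL) (hk : (ground k).desc = (groundPtGr k).trivialSL)
      (f : PAlgHo SC C) (ι : PAlgHom SC (ground k))
      (κ : SLHom S.space.trivialSL (groundPtGr k).trivialSL),
      -- `[f]` is the homotopy type of the first components of the representatives of `[S]`
      (∀ φ : SLHom S.space.trivialSL C.desc, φ.type = S.type →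
        ∃ f₀ : PAlgHom SC C, f₀.lin = φ.lin ∧ f₀.type = f) ∧
      -- `ι = c ∘ f`, for all representatives
      (∀ (φ : SLHom S.space.trivialSL C.desc) (c₀ : PAlgHom C (ground k)),
        φ.type = S.type → c₀.type = c → ι.lin = c₀.lin ∘ₗ φ.lin) ∧
      -- `κ` is the cumulant morphism, for all representatives and all homotopies `Λ`
      (∀ (φ : SLHom S.space.trivialSL C.desc) (c₀ : PAlgHom C (ground k))
        (L : Fam k C.toPtGr (ground k).toPtGr), φ.type = S.type → c₀.type = c →
        IsDescHomotopy C.toPtGr (ground k).toPtGr L →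
        κ.fam = Fam.bullet (V := S.space) (c₀.desc L) φ.fam) ∧
      -- `hoDes([ι]) = [κ]` and `hoDes([f]) = [S]`
      IsHoDes ι.type (κ.type.cast hS.symm hk.symm) ∧
      IsHoDes f (S.type.cast hS.symm rfl) ∧
      -- the inner triangle commutes
      ι.type = c.comp f ∧
      -- the outer triangle commutes
      ∃ c' : SLHo C.desc (groundPtGr k).trivialSL,
        IsHoDes c (c'.cast rfl hk.symm) ∧ SLHo.IsComp c' S.type κ.type := by
  obtain ⟨φ, hφ, hq⟩ := S.quasiIso
  obtain ⟨f, h, b, H⟩ := hq.exists_isSplitting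
  obtain ⟨c₀, rfl⟩ : ∃ c₀ : PAlgHom C (ground k), c₀.type = c := Quotient.exists_rep c
  obtain ⟨g, hg⟩ : ∃ g : Fam k S.space C.carrier, φ.fam = g := ⟨_, rfl⟩
  have hgK : (ground k).K = 0 := rfl
  have hL0 : IsDescHomotopy C.toPtGr (ground k).toPtGr 0 := IsDescHomotopy.zero
  refine ⟨productOf φ h, ⟨φ, hφ, h, H.isHomotopyInverse, fun _ => rfl⟩, ?_, H.isCorrelation,
    H.one_ne_zero, C.desc_isUnitalSL, S.space.trivialSL_isUnitalSL,
    PAlg.desc_eq_trivialSL rfl, PAlg.desc_eq_trivialSL rfl, ?_⟩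
  · rintro M' ⟨φ', hφ', g', hg', hM'⟩
    rw [← H.product_unique (hφ.trans hφ'.symm) hg']
    exact funext hM'
  set SC : PAlg.{u, w} k := PAlg.ofCorrelation S.space (productOf φ h) H.isCorrelation
    H.one_ne_zero with hSC
  have hSK : SC.K = 0 := rfl
  let F : PAlgHom SC C := ⟨f, H.hasDeg_f, fun x => (map_zero f).trans (H.K_f x).symm, H.f_one⟩
  -- the cumulant morphism
  obtain ⟨χ₀, hχ₀⟩ := c₀.exists_desc hL0
  have hκs : IsSymFam S.space (ground k).toPtGr 0 (Fam.bullet (V := S.space) (c₀.desc 0) g) := by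
    have h1 : IsSymFam C.toPtGr (ground k).toPtGr 0 (c₀.desc 0) := hχ₀ ▸ χ₀.sym
    exact h1.bullet (hg ▸ φ.sym)
  have hgs : IsSymFam S.space C.toPtGr 0 g := hg ▸ φ.sym
  have hgb : Fam.bullet (V := S.space) C.descBr g = 0 := hg ▸ φ.bullet_descBr
  have hgd : Fam.bullet (V := S.space) C.M g = density φ := hg ▸ rfl
  -- The characterization of the cumulants: `M • κ = c Π` in the ground field.
  have hG := c₀.bullet_desc_bullet hgK hL0 hgs hgb
  rw [hgd] at hG
  obtain ⟨G, hGe⟩ : ∃ G : Fam k S.space (ground k).carrier,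
    Fam.bullet (V := S.space) (c₀.desc 0) g = G := ⟨_, rfl⟩
  rw [hGe] at hG hκs
  have hG1 : G.ev [S.space.one] = (ground k).one := by
    rw [← Fam.ev_bullet_singleton (V := S.space) (ground k).M_one G, hG]
    exact (congrArg c₀.lin (density_ev_one φ)).trans c₀.map_one
  have hGk : Fam.KillsUnit (V := S.space) G := by
    have h1 : Fam.KillsUnit (V := C.toPtGr) (U := (ground k).carrier) (c₀.desc 0) :=
      hχ₀ ▸ χ₀.killsUnit
    rw [← hGe]
    exact Fam.bullet_killsUnit (W := C.toPtGr) (U := (ground k).toPtGr) h1 (hg ▸ φ.ev_one)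
      (hg ▸ φ.killsUnit)
  obtain ⟨κ, hκ⟩ : ∃ κ : SLHom S.space.trivialSL (groundPtGr k).trivialSL, κ.fam = G :=
    PtGr.exists_hom_of_trivialSL hκs hG1 hGk
  refine ⟨F.type, c₀.comp F, κ, fun φ' hφ' => ?_, fun φ' c₁ hφ' hc₁ => ?_,
    fun φ' c₁ L hφ' hc₁ hL => ?_, fun f' hf' L hL => ?_, fun f' hf' L hL => ?_, rfl, ?_⟩
  · obtain ⟨f', hf'⟩ : ∃ f' : S.space →ₗ[k] C.toPtGr, φ'.lin = f' := ⟨_, rfl⟩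
    obtain ⟨s, hs1, hs2, hs3⟩ := H.exists_homotopy (hφ.trans hφ'.symm) hf'
    refine ⟨⟨f', hf' ▸ φ'.lin_hasDeg, fun x => (map_zero f').trans ?_, hf' ▸ φ'.lin_one⟩,
      hf'.symm, Quotient.sound ⟨s, hs1, hs2, fun x => (hs3 x).trans ?_⟩⟩
    · rw [← hf']
      exact (φ'.K_lin x).symm
    · exact (zero_add _).symm.trans (congrArg (· + _) (map_zero s).symm)
  · exact lin_comp_eq hgK hc₁.symm (hφ.trans hφ'.symm) H.lin_eq rfl
  · rw [hκ, ← hGe]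
    exact (bullet_desc_eq hgK hc₁.symm hL0 hL (hφ.trans hφ'.symm) hg rfl).symm
  · obtain ⟨κ', hκ', hκt⟩ := κ.exists_cast (PAlg.desc_eq_trivialSL (A := SC) rfl).symm
      (PAlg.desc_eq_trivialSL (A := ground k) rfl).symm
    obtain ⟨χ, hχ⟩ := f'.exists_desc hL
    refine ⟨χ, hχ, Eq.trans ?_ hκt.symm⟩
    have hL1 : IsDescHomotopy SC.toPtGr (ground k).toPtGr 0 := IsDescHomotopy.zero
    -- It suffices to treat the representative `c ∘ f` with homotopy zero. Its descendant equals `κ`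
    -- on the nose, by comparison after applying `M`.
    refine PAlgHom.type_desc_eq hf' hL hL1 hχ ((eq_of_heq hκ').trans (hκ.trans ?_))
    refine (Fam.bullet_injective (V := SC.toPtGr) (ground k).M_one ?_ ?_).symm
    · exact (((c₀.comp F).desc_isBulletSolution 0).zero (ground k).isSymFam_M.1
        ((c₀.comp F).isSymFam_target hL1).1).trans hκs.1.symm
    · rw [PAlgHom.bullet_desc _ hL1, PAlg.cobdry_of_K_eq_zero hSK]
      refine Eq.trans ?_ hG.symm
      funext n
      refine MultilinearMap.ext fun x => (sub_zero _).trans ?_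
      refine (congrArg c₀.lin (H.f_product n x)).trans ?_
      -- `c f M^S = c Π + c K b Π`, and the last term vanishes because the ground field has zero
      -- differential.
      rw [map_add, c₀.comm]
      exact add_zero _
  · obtain ⟨φ', hφ', hφt⟩ := φ.exists_cast (PAlg.desc_eq_trivialSL (A := SC) rfl).symm rfl
    obtain ⟨χ, hχ⟩ := f'.exists_desc hL
    have hL1 : IsDescHomotopy SC.toPtGr C.toPtGr 0 := IsDescHomotopy.zero
    obtain ⟨χF, hχF⟩ := F.exists_desc hL1
    refine ⟨χ, hχ, (PAlgHom.type_desc_eq hf' hL hL1 hχ hχF).trans ?_⟩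
    refine Eq.trans ?_ (hφt.symm.trans (congrArg (SLHo.cast _ rfl) hφ))
    -- The densities of `φ` and of the descendant of `f` are `Π` and `f M^S = Π + K b Π`. Over a
    -- zero differential the coboundary of `b Π` is just `K b Π`, so `b Π` generates the homotopy.
    have hb : IsDescHomotopy SC.toPtGr C.toPtGr (Fam.post (U := C.carrier) b (density φ)) :=
      IsDescHomotopy.post (V := S.space) (W := C.toPtGr) (U := C.toPtGr) (density_isSymFam φ)
        (density_absorbsUnit φ) (density_ev_one φ) H.hasDeg_b H.b_one
    refine (Quot.sound (SLHom.homotopic_of_cobdry hb ?_)).symm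
    rw [hχF, PAlgHom.bullet_desc _ hL1, PAlg.cobdry_of_K_eq_zero hSK,
      PAlg.cobdry_of_K_eq_zero hSK]
    have hφ'g : φ'.fam = g := (eq_of_heq hφ').trans hg
    rw [hφ'g]
    refine Eq.trans ?_ (congrArg (· + _) hgd.symm)
    funext n
    exact MultilinearMap.ext fun x => ((congrArg (F.lin _ - ·) (map_zero C.K)).trans
      (sub_zero _)).trans (H.f_product n x)
  · have hk := PAlg.desc_eq_trivialSL (A := ground k) rfl
    refine ⟨χ₀.type.cast rfl hk, fun c₁ hc₁ L hL => ?_, fun φ' ψ hφ' hψ => ⟨κ, ?_, rfl⟩⟩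
    · obtain ⟨χ, hχ⟩ := c₁.exists_desc hL
      exact ⟨χ, hχ, (PAlgHom.type_desc_eq hc₁ hL hL0 hχ hχ₀).trans
        (SLHo.cast_cast rfl hk _).symm⟩
    · obtain ⟨χ', hχ', ht⟩ := χ₀.exists_cast rfl hk
      obtain ⟨p, hp⟩ : ∃ p : Fam k S.space C.carrier, φ'.fam = p := ⟨_, rfl⟩
      obtain ⟨q, hq⟩ : ∃ q : Fam k C.carrier (groundPtGr k).carrier, ψ.fam = q := ⟨_, rfl⟩
      -- `ψ` and `φ'` are arbitrary representatives. First `ψ` is replaced by the chosen descendant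
      -- of `c`, then `φ'` by `φ`; the composite is unchanged as a family, not only up to homotopy.
      have h1 := bullet_of_type_eq (hψ.trans ht) hq ((eq_of_heq hχ').trans hχ₀)
        (hp ▸ φ'.sym) (hp ▸ φ'.bullet_descBr)
      have h2 := bullet_desc_eq hgK (c := c₀) rfl hL0 hL0 (hφ.trans hφ'.symm) hg hp
      rw [hκ, ← hGe]
      refine (h1.trans h2).symm.trans ?_
      rw [← hp, ← hq]
      rfl
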